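/- Let $M$ be a compact smooth manifold without boundary, of dimension $n$, endowed with a smooth Riemannian metric $\|\cdot\|$. Let $X$ be a $C^1$ vector field on $M$, with flow $(X_t)_{t\in\mathbb R}$ and tangent flow $\Phi_t(x)=DX_t(x)\colon T_xM\to T_{X_t(x)}M$. A set $\Lambda\subset M$ is invariant if $X_t(\Lambda)=\Lambda$ for all $t\in\mathbb R$. A compact invariant set $\Lambda\subset M$ is called *sectional-hyperbolic* for $X$ if there is a continuous splitting $T_\Lambda M=E\oplus F$, invariant under $\Phi_t$ for all $t\in\mathbb R$, and there are constants $K,\lambda>0$ such that for all $x\in\Lambda$ and all $t>0$: 1. (domination) $\|\Phi_t(x)u\|\,\|v\|\le Ke^{-\lambda t}\,\|\Phi_t(x)v\|\,\|u\|$ for all $u\in E_x$ and $v\in F_x$, that is, $\|\Phi_t(x)|_{E_x}\|/m(\Phi_t(x)|_{F_x})\le Ke^{-\lambda t}$, where $m$ denotes the co-norm; 2. (contraction) $\|\Phi_t(x)|_{E_x}\|\le Ke^{-\lambda t}$; 3. (sectional expansion) $|\det \Phi_t(x)|_{L}|\ge Ke^{\lambda t}$ for every two-dimensional subspace $L\subset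 F_x$ (the constants may differ from one condition to another). **Lemma.** If $\Lambda$ is a sectional-hyperbolic set for the $C^1$ vector field $X$, then there is a neighbourhood $U$ of $\Lambda$ such that the maximal invariant set $\widetilde\Lambda=\bigcap_{t\in\mathbb R}X_t(U)$ of the flow in $U$ is also sectional-hyperbolic for $X$. -/

import Mathlib

open Set Topology Manifold
open scoped ContDiff Bundle

noncomputable section

namespace SectionalHyperbolicity

/-- `|det (A|_L)|` for a linear map `A : V → W` between Euclidean spaces and a subspace `L` of `V`:
the factor by which `A` multiplies `dim L`-dimensional volume on `L`, that is, `√ det (B* B)`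
with `B = A|_L : L → W`. -/
def absDetOn {V W : Type*} [NormedAddCommGroup V] [InnerProductSpace ℝ V] [FiniteDimensional ℝ V]
    [NormedAddCommGroup W] [InnerProductSpace ℝ W] [FiniteDimensional ℝ W]
    (A : V →ₗ[ℝ] W) (L : Submodule ℝ V) : ℝ :=
  √(LinearMap.det (LinearMap.adjoint (A ∘ₗ L.subtype) ∘ₗ (A ∘ₗ L.subtype)))

instance instFiniteDimensionalTangentSpace {n : ℕ} {M : Type*} [TopologicalSpace M]
    [ChartedSpace (EuclideanSpace ℝ (Fin n)) M] (x : M) :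
    FiniteDimensional ℝ (TangentSpace (𝓡 n) x) :=
  inferInstanceAs (FiniteDimensional ℝ (EuclideanSpace ℝ (Fin n)))

variable {n : ℕ} {M : Type*} [TopologicalSpace M] [ChartedSpace (EuclideanSpace ℝ (Fin n)) M]

section Flow

variable [IsManifold (𝓡 n) ∞ M]

/-- `X` is a vector field of class `C¹` on `M`. -/
def IsC1VectorField (X : (x : M) → TangentSpace (𝓡 n) x) : Prop :=
  ContMDiff (𝓡 n) (𝓡 n).tangent 1 (fun x => (⟨x, X x⟩ : TangentBundle (𝓡 n) M))

open Classical in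
/-- The flow `(t, x) ↦ X_t(x)`: the integral curve of `X`, defined on all of `ℝ`, that passes
through `x` at time `0`. (On a compact manifold and for a `C¹` vector field there is exactly one;
without such a curve the value is `x`.) -/
def flow (X : (x : M) → TangentSpace (𝓡 n) x) (t : ℝ) (x : M) : M :=
  if h : ∃ γ : ℝ → M, γ 0 = x ∧ IsMIntegralCurve γ X then h.choose t else x

/-- The tangent flow `Φ_t(x) = D X_t(x) : T_x M → T_{X_t(x)} M`. -/
def tangentFlow (X : (x : M) → TangentSpace (𝓡 n) x) (t : ℝ) (x : M) :
    TangentSpace (𝓡 n) x →L[ℝ] TangentSpace (𝓡 n) (flow X t x) :=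
  mfderiv (𝓡 n) (𝓡 n) (flow X t) x

/-- `X_t(Λ) = Λ` for every `t ∈ ℝ`. -/
def IsFlowInvariant (X : (x : M) → TangentSpace (𝓡 n) x) (Λ : Set M) : Prop :=
  ∀ t : ℝ, flow X t '' Λ = Λ

/-- The maximal invariant set `⋂_{t ∈ ℝ} X_t(U)` of the flow in `U`. -/
def maximalInvariantSet (X : (x : M) → TangentSpace (𝓡 n) x) (U : Set M) : Set M :=
  ⋂ t : ℝ, flow X t '' U

/-- The family of subspaces `E x ⊆ T_x M`, `x ∈ Λ`, is a continuous subbundle of `T_Λ M`: near each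
point of `Λ` it has a frame consisting of sections that are continuous on `Λ`. -/
def IsContinuousSubbundle (Λ : Set M) (E : (x : M) → Submodule ℝ (TangentSpace (𝓡 n) x)) : Prop :=
  ∀ x₀ ∈ Λ, ∃ V ∈ 𝓝 x₀, ∃ (k : ℕ) (e : Fin k → (x : M) → TangentSpace (𝓡 n) x),
    (∀ i, ContinuousOn (fun x => (⟨x, e i x⟩ : TangentBundle (𝓡 n) M)) (Λ ∩ V)) ∧
    ∀ x ∈ Λ ∩ V, LinearIndependent ℝ (fun i => e i x) ∧
      Submodule.span ℝ (range fun i => e i x) = E x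

/-- `T_Λ M = E ⊕ F` is a continuous splitting, invariant under the tangent flow. -/
structure IsInvariantSplitting (X : (x : M) → TangentSpace (𝓡 n) x) (Λ : Set M)
    (E F : (x : M) → Submodule ℝ (TangentSpace (𝓡 n) x)) : Prop where
  isCompl : ∀ x ∈ Λ, IsCompl (E x) (F x)
  continuous_left : IsContinuousSubbundle Λ E
  continuous_right : IsContinuousSubbundle Λ F
  map_left : ∀ x ∈ Λ, ∀ t : ℝ, (E x).map (tangentFlow X t x).toLinearMap = E (flow X t x)
  map_right : ∀ x ∈ Λ, ∀ t : ℝ, (F x).map (tangentFlow X t x).toLinearMap = F (flow X t x)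

end Flow

section Hyperbolicity

variable [IsManifold (𝓡 n) ∞ M] [Bundle.RiemannianBundle (fun x : M => TangentSpace (𝓡 n) x)]

/-- Domination of `E` by `F` over `Λ`:
`‖Φ_t(x)|_{E_x}‖ / m(Φ_t(x)|_{F_x}) ≤ K e^{-λt}` for all `x ∈ Λ`, `t > 0`, where `m` is the co-norm.
The inequality is written for all vectors `u ∈ E_x`, `v ∈ F_x` and without denominators. -/
def IsDominated (X : (x : M) → TangentSpace (𝓡 n) x) (Λ : Set M)
    (E F : (x : M) → Submodule ℝ (TangentSpace (𝓡 n) x)) : Prop :=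
  ∃ K > (0 : ℝ), ∃ lam > (0 : ℝ), ∀ x ∈ Λ, ∀ t > (0 : ℝ), ∀ u ∈ E x, ∀ v ∈ F x,
    ‖tangentFlow X t x u‖ * ‖v‖ ≤ K * Real.exp (-lam * t) * (‖tangentFlow X t x v‖ * ‖u‖)

/-- `E` is uniformly contracting over `Λ`: `‖Φ_t(x)|_{E_x}‖ ≤ K e^{-λt}` for `x ∈ Λ`, `t > 0`. -/
def IsUniformlyContracting (X : (x : M) → TangentSpace (𝓡 n) x) (Λ : Set M)
    (E : (x : M) → Submodule ℝ (TangentSpace (𝓡 n) x)) : Prop :=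
  ∃ K > (0 : ℝ), ∃ lam > (0 : ℝ), ∀ x ∈ Λ, ∀ t > (0 : ℝ), ∀ u ∈ E x,
    ‖tangentFlow X t x u‖ ≤ K * Real.exp (-lam * t) * ‖u‖

/-- `F` is sectional-expanding over `Λ`: `|det Φ_t(x)|_L| ≥ K e^{λt}` for all `x ∈ Λ`, `t > 0` and
every two-dimensional subspace `L` of `F_x`. -/
def IsSectionalExpanding (X : (x : M) → TangentSpace (𝓡 n) x) (Λ : Set M)
    (F : (x : M) → Submodule ℝ (TangentSpace (𝓡 n) x)) : Prop :=
  ∃ K > (0 : ℝ), ∃ lam > (0 : ℝ), ∀ x ∈ Λ, ∀ t > (0 : ℝ),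
    ∀ L : Submodule ℝ (TangentSpace (𝓡 n) x), L ≤ F x → Module.finrank ℝ L = 2 →
      K * Real.exp (lam * t) ≤ absDetOn (tangentFlow X t x).toLinearMap L

/-- `Λ` is a sectional-hyperbolic set for `X`: it is compact and invariant and has a dominated
splitting `T_Λ M = E ⊕ F` with `E` uniformly contracting and `F` sectional-expanding. -/
def IsSectionalHyperbolic (X : (x : M) → TangentSpace (𝓡 n) x) (Λ : Set M) : Prop :=
  IsCompact Λ ∧ IsFlowInvariant X Λ ∧
    ∃ E F : (x : M) → Submodule ℝ (TangentSpace (𝓡 n) x),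
      IsInvariantSplitting X Λ E F ∧ IsDominated X Λ E F ∧
      IsUniformlyContracting X Λ E ∧ IsSectionalExpanding X Λ F

end Hyperbolicity

end SectionalHyperbolicity

end

/-! The flow of a C¹ field on a compact manifold is jointly C¹ (`ContDiffAt.exists_contDiffOn_flow`,
`IsC1VectorField.contMDiff_flow`), so the tangent flow is a continuous flow on `TM`, linear on
fibres. Everything else is proved for a `LinearFlow` on a Riemannian vector bundle over a compact
Hausdorff base, and rests on one principle: a strict inequality over Λ, tested on unit vectors,
persists over a neighbourhood of Λ because the sphere bundle is compact.

Extension of the splitting. Over Λ the slope of `u + v` is `‖v‖ / (‖u‖ + ‖v‖)`; Tietze's theorem on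
the sphere bundle extends it to a homogeneous function Θ on the whole bundle, hence to a cone field
`Θ ≤ 1/2` around E and a cone field `Θ ≥ 1/2` around F. By domination, for large T the time `-T` map
sends the first cone strictly inside itself, and over time T vectors of the first cone whose image
is still in it lose at least a factor 2 against those of the second. Both facts persist near Λ
(`exists_isConeNhd`). Over an orbit that stays there, the new E consists of 0 and the vectors whose
images at the times `nT` never leave the first cone: a limit of frames produces a subspace of such
vectors of the right dimension, and the factor 2 shows that there are no others
(`IsConeNhd.finrank_stableSpace`). The reversed flow with the slope `1 - Θ` gives the new F. The two
families are closed and complementary, hence continuous; they contain E and F over Λ and so agree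
with them there (`exists_extension_splitting`).

Extension of the estimates. Each of the three conditions yields a strict inequality at a single time
over Λ, with factor 1/2, or 2 for squared areas. It persists for the extended bundles near Λ, and
iterating it along orbits that stay there gives exponential rates (`le_exp_of_halving`). Areas are
handled by the Gram determinant `gramTwo` of pairs of vectors. Finally, choosing U closed makes its
maximal invariant set compact. -/

noncomputable section

/-! ### Differentiable dependence of solutions of an ODE on the initial point. -/

section ODE

open Metric Function

/-- A two-sided Grönwall inequality on a symmetric time interval. -/
lemma norm_le_of_norm_deriv_le_symm_Icc {E : Type*} [NormedAddCommGroup E] [NormedSpace ℝ E]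
    {f f' : ℝ → E} {δ K η ε : ℝ} (hK : 1 ≤ K) (hδ : 0 ≤ δ) (hη : 0 ≤ η)
    (hf : ∀ t ∈ Icc (-ε) ε, HasDerivWithinAt f (f' t) (Icc (-ε) ε) t) (h0 : ‖f 0‖ ≤ δ)
    (bound : ∀ t ∈ Icc (-ε) ε, ‖f' t‖ ≤ K * ‖f t‖ + η) :
    ∀ t ∈ Icc (-ε) ε, ‖f t‖ ≤ (δ + η) * Real.exp (K * ε) := by
  -- Since `K ≥ 1`, the forcing term `η / K` of the Grönwall bound may be replaced by `η`.
  have key : ∀ t ∈ Icc (0 : ℝ) ε, gronwallBound δ K η (t - 0) ≤ (δ + η) * Real.exp (K * ε) := by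
    intro t ht
    rw [gronwallBound_of_K_ne_0 (by positivity), sub_zero]
    have h1 : Real.exp (K * t) ≤ Real.exp (K * ε) :=
      Real.exp_le_exp.2 (mul_le_mul_of_nonneg_left ht.2 (by positivity))
    have h2 : η / K ≤ η := div_le_self hη hK
    have h3 : 0 ≤ η / K := by positivity
    have h4 := Real.exp_pos (K * t)
    nlinarith
  have fwd : ∀ g g' : ℝ → E, (∀ t ∈ Icc (-ε) ε, HasDerivWithinAt g (g' t) (Icc (-ε) ε) t) →
      ‖g 0‖ ≤ δ → (∀ t ∈ Icc (-ε) ε, ‖g' t‖ ≤ K * ‖g t‖ + η) →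
      ∀ t ∈ Icc (0 : ℝ) ε, ‖g t‖ ≤ (δ + η) * Real.exp (K * ε) := by
    intro g g' hg hg0 hb t ht
    have hsub : Icc (0 : ℝ) ε ⊆ Icc (-ε) ε := fun s hs => ⟨by linarith [hs.1, hs.2], hs.2⟩
    refine (norm_le_gronwallBound_of_norm_deriv_right_le (f' := g') (a := 0) (b := ε)
      (fun s hs => (hg s (hsub hs)).continuousWithinAt.mono hsub) (fun s hs => ?_) hg0
      (fun s hs => hb s (hsub (Ico_subset_Icc_self hs))) t ht).trans (key t ht)
    refine (hg s (hsub (Ico_subset_Icc_self hs))).mono_of_mem_nhdsWithin ?_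
    exact Filter.mem_of_superset (Icc_mem_nhdsGE hs.2)
      (Icc_subset_Icc (by linarith [hs.1, hs.2]) le_rfl)
  intro t ht
  rcases le_total 0 t with h | h
  · exact fwd f f' hf h0 bound t ⟨h, ht.2⟩
  · have hneg : MapsTo (fun s : ℝ => -s) (Icc (-ε) ε) (Icc (-ε) ε) :=
      fun s hs => ⟨by linarith [hs.2], by linarith [hs.1]⟩
    have := fwd (fun s => f (-s)) (fun s => -f' (-s)) (fun s hs => ?_) (by simpa using h0)
      (fun s hs => by simpa using bound (-s) (hneg hs)) (-t) ⟨by linarith, by linarith [ht.1]⟩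
    · simpa using this
    · have := (hf (-s) (hneg hs)).scomp s ((hasDerivWithinAt_id s _).neg) hneg
      simpa [Function.comp_def] using this

/-- Solutions of a linear ODE `D' = A D` with `D 0 = 1`, on a short time interval. -/
lemma exists_linear_ode_solution {E : Type*} [NormedAddCommGroup E] [NormedSpace ℝ E]
    [CompleteSpace E] {A : ℝ → E →L[ℝ] E} {K ε : ℝ} (hε : 0 < ε) (hK : 0 ≤ K)
    (hKε : 2 * K * ε ≤ 1)
    (hA : ContinuousOn A (Icc (-ε) ε)) (hb : ∀ t ∈ Icc (-ε) ε, ‖A t‖ ≤ K) :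
    ∃ D : ℝ → E →L[ℝ] E, D 0 = ContinuousLinearMap.id ℝ E ∧
      ∀ t ∈ Icc (-ε) ε, HasDerivWithinAt D (A t ∘L D t) (Icc (-ε) ε) t := by
  have hz : (0 : ℝ) ∈ Icc (-ε) ε := ⟨by linarith, hε.le⟩
  -- On the unit ball around the identity, `‖B‖ ≤ 2`, so the speed is at most `2K`; the condition
  -- `2Kε ≤ 1` keeps the solution in that ball.
  have h : IsPicardLindelof (fun t (B : E →L[ℝ] E) => A t ∘L B) (tmin := -ε) (tmax := ε) ⟨0, hz⟩
      (ContinuousLinearMap.id ℝ E) 1 0 (2 * ⟨K, hK⟩) ⟨K, hK⟩ := by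
    refine ⟨fun t ht => ?_, fun B _ => ?_, fun t ht B hB => ?_, ?_⟩
    · refine LipschitzOnWith.of_dist_le_mul fun B _ C _ => ?_
      rw [dist_eq_norm, dist_eq_norm, ← ContinuousLinearMap.comp_sub]
      exact (ContinuousLinearMap.opNorm_comp_le _ _).trans
        (mul_le_mul_of_nonneg_right (hb t ht) (norm_nonneg _))
    · exact hA.clm_comp continuousOn_const
    · refine (ContinuousLinearMap.opNorm_comp_le _ _).trans ?_
      have h1 : ‖B‖ ≤ 2 := by
        have h2 : ‖B - ContinuousLinearMap.id ℝ E‖ ≤ 1 := by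
          simpa [dist_eq_norm] using hB
        have h3 := norm_le_norm_sub_add B (ContinuousLinearMap.id ℝ E)
        have h4 := ContinuousLinearMap.norm_id_le (𝕜 := ℝ) (E := E)
        linarith
      have := mul_le_mul (hb t ht) h1 (norm_nonneg _) hK
      change _ ≤ 2 * K
      linarith
    · push_cast
      change 2 * K * _ ≤ _
      simp [hKε]
  exact h.exists_eq_forall_mem_Icc_hasDerivWithinAt₀

/-- The flow of a `C¹` vector field is locally jointly of class `C¹`. -/
theorem ContDiffAt.exists_contDiffOn_flow {E : Type*} [NormedAddCommGroup E] [NormedSpace ℝ E]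
    [ProperSpace E] {f : E → E} {x₀ : E} (hf : ContDiffAt ℝ 1 f x₀) {S : Set E}
    (hS : S ∈ 𝓝 x₀) :
    ∃ r > 0, ∃ ε > 0, ∃ α : E → ℝ → E,
      (∀ x ∈ ball x₀ r, α x 0 = x ∧
        ∀ t ∈ Ioo (-ε) ε, HasDerivAt (α x) (f (α x t)) t ∧ α x t ∈ S) ∧
      ContDiffOn ℝ 1 (uncurry α) (ball x₀ r ×ˢ Ioo (-ε) ε) := by
  have : CompleteSpace E := inferInstance
  -- a closed ball on which `f` is differentiable with continuous derivative
  obtain ⟨ρ, hρ, hρS, hdf, hcdf⟩ : ∃ ρ > 0, closedBall x₀ ρ ⊆ S ∧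
      (∀ x ∈ closedBall x₀ ρ, HasFDerivAt f (fderiv ℝ f x) x) ∧
      ContinuousOn (fderiv ℝ f) (closedBall x₀ ρ) := by
    have h1 : ∀ᶠ x in 𝓝 x₀, ContDiffAt ℝ 1 f x := hf.eventually (by simp)
    obtain ⟨ρ, hρ, h⟩ := Metric.eventually_nhds_iff_ball.1 (h1.and hS)
    have hsub : closedBall x₀ (ρ / 2) ⊆ ball x₀ ρ := closedBall_subset_ball (by linarith)
    refine ⟨ρ / 2, by positivity, fun x hx => (h x (hsub hx)).2, fun x hx =>
      ((h x (hsub hx)).1.differentiableAt (by simp)).hasFDerivAt, fun x hx =>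
      ((h x (hsub hx)).1.fderiv_right (m := 0) (by simp)).continuousAt.continuousWithinAt⟩
  have hcpt : IsCompact (closedBall x₀ ρ) := isCompact_closedBall _ _
  obtain ⟨K₀, hK₀⟩ := hcpt.exists_bound_of_continuousOn hcdf
  set K := max K₀ 1 with hKdef
  have hK1 : 1 ≤ K := le_max_right _ _
  have hKb : ∀ x ∈ closedBall x₀ ρ, ‖fderiv ℝ f x‖ ≤ K := fun x hx =>
    (hK₀ x hx).trans (le_max_left _ _)
  -- first order Taylor estimate, uniform on the ball
  have huc : ∀ η > 0, ∃ δ > 0, ∀ p ∈ closedBall x₀ ρ, ∀ q ∈ closedBall x₀ ρ, ‖q - p‖ < δ →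
      ‖fderiv ℝ f q - fderiv ℝ f p‖ ≤ η ∧ ‖f q - f p - fderiv ℝ f p (q - p)‖ ≤ η * ‖q - p‖ := by
    intro η hη
    have := Metric.uniformContinuousOn_iff.1 (hcpt.uniformContinuousOn_of_continuous hcdf) η hη
    obtain ⟨δ, hδ, h⟩ := this
    refine ⟨δ, hδ, fun p hp q hq hpq => ⟨?_, ?_⟩⟩
    · rw [← dist_eq_norm]
      exact (h q hq p hp (by rwa [dist_eq_norm])).le
    · have hseg : segment ℝ p q ⊆ closedBall x₀ ρ := (convex_closedBall x₀ ρ).segment_subset hp hq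
      refine Convex.norm_image_sub_le_of_norm_hasFDerivWithin_le' (s := segment ℝ p q)
        (fun z hz => (hdf z (hseg hz)).hasFDerivWithinAt) (fun z hz => ?_) (convex_segment _ _)
        (left_mem_segment _ _ _) (right_mem_segment _ _ _)
      rw [← dist_eq_norm]
      refine (h z (hseg hz) p hp ?_).le
      rw [dist_eq_norm]
      exact (norm_sub_le_of_mem_segment hz).trans_lt hpq
  -- the local flow
  obtain ⟨ε₀, hε₀, a, r₀, L, K', hr₀, hpl⟩ := IsPicardLindelof.of_contDiffAt_one hf
  obtain ⟨α, hα, L', hL'⟩ :=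
    (hpl 0).exists_forall_mem_closedBall_eq_hasDerivWithinAt_lipschitzOnWith
  simp only [zero_sub, zero_add] at hα hL'
  have hr₀' : (0 : ℝ) < r₀ := hr₀
  have hαc : ContinuousOn (uncurry α) (closedBall x₀ r₀ ×ˢ Icc (-ε₀) ε₀) :=
    continuousOn_prod_of_continuousOn_lipschitzOnWith _ L'
      (fun x hx => HasDerivWithinAt.continuousOn (hα x hx).2) hL'
  have hz₀ : (0 : ℝ) ∈ Icc (-ε₀) ε₀ := ⟨by linarith, hε₀.le⟩
  obtain ⟨r, hr, hrr, ε, hε, hεε, hKε, hball⟩ : ∃ r : ℝ, r > 0 ∧ r ≤ r₀ ∧ ∃ ε > 0, ε < ε₀ ∧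
      2 * K * ε ≤ 1 ∧ ∀ x ∈ ball x₀ r, ∀ t ∈ Icc (-ε) ε, α x t ∈ closedBall x₀ ρ := by
    have hat : ContinuousAt (uncurry α) (x₀, 0) :=
      hαc.continuousAt (prod_mem_nhds (closedBall_mem_nhds _ hr₀')
        (Icc_mem_nhds (by linarith) hε₀))
    have h0 : uncurry α (x₀, 0) = x₀ := (hα x₀ (mem_closedBall_self hr₀'.le)).1
    have hn : uncurry α ⁻¹' closedBall x₀ ρ ∈ 𝓝 (x₀, (0 : ℝ)) :=
      hat (by rw [h0]; exact closedBall_mem_nhds _ hρ)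
    obtain ⟨σ, hσ, h⟩ := Metric.mem_nhds_iff.1 hn
    have hK0 : 0 < K := by positivity
    refine ⟨min (r₀ : ℝ) σ, lt_min hr₀' hσ, min_le_left _ _, min (min (ε₀ / 2) (σ / 2)) (1 / (2 * K)),
      by positivity, ?_, ?_, fun x hx t ht => ?_⟩
    · exact ((min_le_left _ _).trans (min_le_left _ _)).trans_lt (by linarith)
    · have := min_le_right (min (ε₀ / 2) (σ / 2)) (1 / (2 * K))
      calc _ ≤ 2 * K * (1 / (2 * K)) := by gcongr
        _ = 1 := by field_simp
    · refine h (a := (x, t)) ?_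
      rw [mem_ball, Prod.dist_eq, max_lt_iff]
      refine ⟨(mem_ball.1 hx).trans_le (min_le_right _ _), ?_⟩
      have h1 : |t| ≤ σ / 2 := (abs_le.2 ht).trans ((min_le_left _ _).trans (min_le_right _ _))
      simpa using h1.trans_lt (by linarith)
  have hsubI : Icc (-ε) ε ⊆ Icc (-ε₀) ε₀ := Icc_subset_Icc (by linarith) hεε.le
  have hsubB : ball x₀ r ⊆ closedBall x₀ r₀ := ball_subset_closedBall.trans
    (closedBall_subset_closedBall hrr)
  have hz : (0 : ℝ) ∈ Icc (-ε) ε := ⟨by linarith, hε.le⟩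
  have hαd : ∀ x ∈ ball x₀ r, ∀ t ∈ Icc (-ε) ε,
      HasDerivWithinAt (α x) (f (α x t)) (Icc (-ε) ε) t := fun x hx t ht =>
    ((hα x (hsubB hx)).2 t (hsubI ht)).mono hsubI
  have hαL : ∀ x ∈ ball x₀ r, ∀ y ∈ ball x₀ r, ∀ t ∈ Icc (-ε) ε,
      ‖α y t - α x t‖ ≤ L' * ‖y - x‖ := fun x hx y hy t ht => by
    simpa [dist_eq_norm] using (hL' t (hsubI ht)).dist_le_mul y (hsubB hy) x (hsubB hx)
  have hαc' : ContinuousOn (uncurry α) (ball x₀ r ×ˢ Icc (-ε) ε) :=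
    hαc.mono (prod_mono hsubB hsubI)
  -- the solution of the variational equation
  have hD : ∀ x ∈ ball x₀ r, ∃ D : ℝ → E →L[ℝ] E, D 0 = ContinuousLinearMap.id ℝ E ∧
      ∀ t ∈ Icc (-ε) ε,
        HasDerivWithinAt D (fderiv ℝ f (α x t) ∘L D t) (Icc (-ε) ε) t := fun x hx =>
    exists_linear_ode_solution hε (by positivity) hKε
      (hcdf.comp (fun t ht => (hαd x hx t ht).continuousWithinAt) (fun t ht => hball x hx t ht))
      (fun t ht => hKb _ (hball x hx t ht))
  choose! D hD0 hDd using hD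
  set C := Real.exp (K * ε) with hC
  have hCpos : 0 < C := Real.exp_pos _
  have hDb : ∀ x ∈ ball x₀ r, ∀ t ∈ Icc (-ε) ε, ‖D x t‖ ≤ C := by
    intro x hx t ht
    have := norm_le_of_norm_deriv_le_symm_Icc hK1 zero_le_one le_rfl (hDd x hx)
      (by rw [hD0 x hx]; exact ContinuousLinearMap.norm_id_le)
      (fun s hs => by
        rw [add_zero]
        exact (ContinuousLinearMap.opNorm_comp_le _ _).trans
          (mul_le_mul_of_nonneg_right (hKb _ (hball x hx s hs)) (norm_nonneg _))) t ht
    simpa using this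
  have hLpos : (0 : ℝ) < L' + 1 := by positivity
  have hclose : ∀ δ > 0, ∀ x ∈ ball x₀ r, ∀ᶠ y in 𝓝 x, y ∈ ball x₀ r ∧
      ∀ t ∈ Icc (-ε) ε, ‖α y t - α x t‖ < δ := by
    intro δ hδ x hx
    have h2 : ∀ᶠ y in 𝓝 x, ‖y - x‖ < δ / (L' + 1) := by
      filter_upwards [ball_mem_nhds x (div_pos hδ hLpos)] with y hy
      simpa [dist_eq_norm] using hy
    filter_upwards [isOpen_ball.mem_nhds hx, h2] with y hy h2
    refine ⟨hy, fun t ht => (hαL x hx y hy t ht).trans_lt ?_⟩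
    rw [lt_div_iff₀ hLpos] at h2
    nlinarith [norm_nonneg (y - x)]
  -- continuity of `D` in `x`, uniformly in `t`
  have hDcont : ∀ x ∈ ball x₀ r, ∀ η > 0, ∀ᶠ y in 𝓝 x, ∀ t ∈ Icc (-ε) ε,
      ‖D y t - D x t‖ ≤ η := by
    intro x hx η hη
    -- One factor `C` absorbs the bound on `D y`, the other the Grönwall factor `exp (K * ε)`.
    obtain ⟨δ, hδ, h⟩ := huc (η / (C * C)) (by positivity)
    filter_upwards [hclose δ hδ x hx] with y ⟨hy, hyt⟩ t ht
    have := norm_le_of_norm_deriv_le_symm_Icc (f := fun s => D y s - D x s) (δ := 0)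
      (η := η / C) hK1 le_rfl (by positivity)
      (fun s hs => (hDd y hy s hs).sub (hDd x hx s hs)) (by simp [hD0 x hx, hD0 y hy])
      (fun s hs => ?_) t ht
    · refine this.trans (le_of_eq ?_)
      rw [← hC]; field_simp; ring
    · have hdec : fderiv ℝ f (α y s) ∘L D y s - fderiv ℝ f (α x s) ∘L D x s =
          fderiv ℝ f (α x s) ∘L (D y s - D x s) +
            (fderiv ℝ f (α y s) - fderiv ℝ f (α x s)) ∘L D y s := by
        ext v; simp
      rw [hdec]
      refine (norm_add_le _ _).trans (add_le_add ?_ ?_)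
      · exact (ContinuousLinearMap.opNorm_comp_le _ _).trans
          (mul_le_mul_of_nonneg_right (hKb _ (hball x hx s hs)) (norm_nonneg _))
      · refine (ContinuousLinearMap.opNorm_comp_le _ _).trans ?_
        have h1 := (h _ (hball x hx s hs) _ (hball y hy s hs) (hyt s hs)).1
        calc _ ≤ η / (C * C) * C := mul_le_mul h1 (hDb y hy s hs) (norm_nonneg _) (by positivity)
          _ = η / C := by field_simp
  -- `D x t` is the derivative of `α · t`
  have hder : ∀ x ∈ ball x₀ r, ∀ t ∈ Icc (-ε) ε, HasFDerivAt (fun y => α y t) (D x t) x := by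
    intro x hx t ht
    rw [hasFDerivAt_iff_isLittleO, Asymptotics.isLittleO_iff]
    intro η hη
    -- The Taylor remainder is at most this constant times `‖α y s - α x s‖ ≤ L' * ‖y - x‖`, and
    -- Grönwall contributes `C`. Adding 1 to `L'` avoids division by zero.
    obtain ⟨δ, hδ, h⟩ := huc (η / (C * (L' + 1))) (by positivity)
    filter_upwards [hclose δ hδ x hx] with y ⟨hy, hyt⟩
    have := norm_le_of_norm_deriv_le_symm_Icc
      (f := fun s => α y s - α x s - D x s (y - x)) (δ := 0)
      (η := η / C * ‖y - x‖) hK1 le_rfl (by positivity)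
      (fun s hs => ((hαd y hy s hs).sub (hαd x hx s hs)).sub
        ((hDd x hx s hs).clm_apply (hasDerivWithinAt_const s _ (y - x))))
      (by simp [hD0 x hx, (hα x (hsubB hx)).1, (hα y (hsubB hy)).1]) (fun s hs => ?_) t ht
    · refine this.trans (le_of_eq ?_)
      rw [← hC]; field_simp; ring
    · have hdec : f (α y s) - f (α x s) -
          ((fderiv ℝ f (α x s) ∘L D x s) (y - x) + (D x s) 0) =
          fderiv ℝ f (α x s) (α y s - α x s - D x s (y - x)) +
            (f (α y s) - f (α x s) - fderiv ℝ f (α x s) (α y s - α x s)) := by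
        simp
      rw [hdec]
      refine (norm_add_le _ _).trans (add_le_add ?_ ?_)
      · exact (ContinuousLinearMap.le_opNorm _ _).trans
          (mul_le_mul_of_nonneg_right (hKb _ (hball x hx s hs)) (norm_nonneg _))
      · refine (h _ (hball x hx s hs) _ (hball y hy s hs) (hyt s hs)).2.trans ?_
        calc _ ≤ η / (C * (L' + 1)) * (L' * ‖y - x‖) := by
              gcongr; exact hαL x hx y hy s hs
          _ ≤ η / (C * (L' + 1)) * ((L' + 1) * ‖y - x‖) := by gcongr; linarith
          _ = η / C * ‖y - x‖ := by field_simp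
  have hDjoint : ContinuousOn (uncurry D) (ball x₀ r ×ˢ Icc (-ε) ε) := by
    rintro ⟨x, t⟩ ⟨hx, ht⟩
    rw [ContinuousWithinAt, Metric.tendsto_nhds]
    intro η hη
    have h1 : ∀ᶠ q : E × ℝ in 𝓝[ball x₀ r ×ˢ Icc (-ε) ε] (x, t),
        ∀ s ∈ Icc (-ε) ε, ‖D q.1 s - D x s‖ ≤ η / 2 :=
      ((continuousAt_fst (p := (x, t))).eventually
        (hDcont x hx (η / 2) (by positivity))).filter_mono nhdsWithin_le_nhds
    have h2 : ∀ᶠ q : E × ℝ in 𝓝[ball x₀ r ×ˢ Icc (-ε) ε] (x, t),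
        Dist.dist (D x q.2) (D x t) < η / 2 := by
      have h3 : ContinuousWithinAt (fun q : E × ℝ => D x q.2) (ball x₀ r ×ˢ Icc (-ε) ε) (x, t) :=
        (hDd x hx t ht).continuousWithinAt.comp (f := Prod.snd) continuousWithinAt_snd
          (fun q hq => hq.2)
      exact Metric.tendsto_nhds.1 h3 _ (by positivity)
    filter_upwards [h1, h2, self_mem_nhdsWithin] with q h1 h2 hq
    have := dist_triangle (D q.1 q.2) (D x q.2) (D x t)
    have h3 := h1 q.2 hq.2
    rw [← dist_eq_norm] at h3
    change Dist.dist (D q.1 q.2) (D x t) < η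
    linarith
  refine ⟨r, hr, ε, hε, α, fun x hx => ⟨(hα x (hsubB hx)).1, fun t ht => ⟨?_, ?_⟩⟩, ?_⟩
  · exact (hαd x hx t (Ioo_subset_Icc_self ht)).hasDerivAt (Icc_mem_nhds ht.1 ht.2)
  · exact hρS (hball x hx t (Ioo_subset_Icc_self ht))
  · have hO : IsOpen (ball x₀ r ×ˢ Ioo (-ε) ε) := isOpen_ball.prod isOpen_Ioo
    set D₂ : E → ℝ → ℝ →L[ℝ] E := fun x t => ContinuousLinearMap.toSpanSingleton ℝ (f (α x t))
    have hmono : ball x₀ r ×ˢ Ioo (-ε) ε ⊆ ball x₀ r ×ˢ Icc (-ε) ε :=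
      prod_mono le_rfl Ioo_subset_Icc_self
    have hD₂c : ContinuousOn (uncurry D₂) (ball x₀ r ×ˢ Ioo (-ε) ε) := by
      have h1 : ContinuousOn (fun q : E × ℝ => f (uncurry α q)) (ball x₀ r ×ˢ Ioo (-ε) ε) :=
        ContinuousOn.comp (t := closedBall x₀ ρ)
          (fun x hx => (hdf x hx).continuousAt.continuousWithinAt) (hαc'.mono hmono)
          (fun q hq => hball q.1 hq.1 q.2 (Ioo_subset_Icc_self hq.2))
      exact (ContinuousLinearMap.toSpanSingletonCLE (𝕜 := ℝ) (E := E)).continuous.comp_continuousOn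
        h1
    have hDc := hDjoint.mono hmono
    -- Both partial derivatives exist and are jointly continuous, so the flow is differentiable in
    -- the two variables together.
    have hstrict : ∀ q ∈ ball x₀ r ×ˢ Ioo (-ε) ε,
        HasFDerivAt (uncurry α) ((uncurry D q).coprod (uncurry D₂ q)) q := by
      intro q hq
      refine (hasStrictFDerivAt_uncurry_coprod (f := α) (f₁ := D) (f₂ := D₂) ?_ ?_
        (hDc.continuousAt (hO.mem_nhds hq)) (hD₂c.continuousAt (hO.mem_nhds hq))).hasFDerivAt
      · filter_upwards [hO.mem_nhds hq] with v hv
        exact hder v.1 hv.1 v.2 (Ioo_subset_Icc_self hv.2)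
      · filter_upwards [hO.mem_nhds hq] with v hv
        exact ((hαd v.1 hv.1 v.2 (Ioo_subset_Icc_self hv.2)).hasDerivAt
          (Icc_mem_nhds hv.2.1 hv.2.2)).hasFDerivAt
    rw [← zero_add (1 : WithTop ℕ∞), contDiffOn_succ_iff_fderiv_of_isOpen hO]
    refine ⟨fun q hq => (hstrict q hq).differentiableAt.differentiableWithinAt, by simp,
      contDiffOn_zero.2 ?_⟩
    have hcc : ContinuousOn (fun q => (uncurry D q).coprod (uncurry D₂ q))
        (ball x₀ r ×ˢ Ioo (-ε) ε) := by
      exact (ContinuousLinearMap.coprodEquivL ℝ).continuous.comp_continuousOn (hDc.prodMk hD₂c)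
    exact hcc.congr fun q hq => (hstrict q hq).fderiv

end ODE

namespace SectionalHyperbolicity

/-! ### The flow and the tangent flow of a C¹ field on a compact manifold. -/

section Flow

variable {n : ℕ} {M : Type*} [TopologicalSpace M] [ChartedSpace (EuclideanSpace ℝ (Fin n)) M]
  [IsManifold (𝓡 n) ∞ M]

lemma IsC1VectorField.exists_local_flow {X : (x : M) → TangentSpace (𝓡 n) x}
    (hX : IsC1VectorField X) (x₀ : M) :
    ∃ V, IsOpen V ∧ x₀ ∈ V ∧ ∃ ε > 0, ∃ β : M → ℝ → M,
      (∀ x ∈ V, β x 0 = x ∧ IsMIntegralCurveOn (β x) X (Ioo (-ε) ε)) ∧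
      ContMDiffOn ((𝓡 n).prod 𝓘(ℝ, ℝ)) (𝓡 n) 1 (Function.uncurry β) (V ×ˢ Ioo (-ε) ε) := by
  have hv := contMDiffAt_iff.1 (hX x₀)
  obtain ⟨r, hr, ε, hε, α, hα, hαc⟩ :=
    (hv.2.contDiffAt (range_mem_nhds_isInteriorPoint
      (BoundarylessManifold.isInteriorPoint))).snd.exists_contDiffOn_flow
      (extChartAt_target_mem_nhds (I := 𝓡 n) x₀)
  set ψ := extChartAt (𝓡 n) x₀ with hψ
  refine ⟨ψ.source ∩ ψ ⁻¹' Metric.ball (ψ x₀) r, ?_, ⟨mem_extChartAt_source x₀,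
    Metric.mem_ball_self hr⟩, ε, hε, fun x t => ψ.symm (α (ψ x) t), fun x hx => ⟨?_, ?_⟩, ?_⟩
  · exact (continuousOn_extChartAt x₀).isOpen_inter_preimage (isOpen_extChartAt_source x₀)
      Metric.isOpen_ball
  · change ψ.symm (α (ψ x) 0) = x
    rw [(hα (ψ x) hx.2).1, ψ.left_inv hx.1]
  · intro t ht
    obtain ⟨h, hf3'⟩ := (hα (ψ x) hx.2).2 t ht
    set f := α (ψ x)
    let xₜ : M := ψ.symm (f t)
    replace h : HasDerivAt f (fderivWithin ℝ (ψ ∘ (extChartAt (𝓡 n) xₜ).symm)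
      (range (𝓡 n)) (extChartAt (𝓡 n) xₜ xₜ) (X xₜ)) t := h
    rw [hψ, ← tangentCoordChange_def] at h
    have hft1 : xₜ ∈ ψ.source := ψ.map_target hf3'
    have hft2 := mem_extChartAt_source (I := 𝓡 n) xₜ
    let vₜ : EuclideanSpace ℝ (Fin n) := X xₜ
    -- The manifold derivative at time `t` is read in the chart at `xₜ`, whereas `α` solves the
    -- equation in the chart at `x₀`; a coordinate change and its inverse cancel.
    have key : HasDerivAt ((extChartAt (𝓡 n) xₜ ∘ ψ.symm) ∘ f) vₜ t := by
      have hvt : vₜ = tangentCoordChange (𝓡 n) x₀ xₜ xₜ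
          (tangentCoordChange (𝓡 n) xₜ x₀ xₜ vₜ) :=
        ((tangentCoordChange_comp (I := 𝓡 n) (w := xₜ) (x := x₀) (y := xₜ) (v := vₜ)
          ⟨⟨hft2, hft1⟩, hft2⟩).trans
          (tangentCoordChange_self (I := 𝓡 n) (x := xₜ) (z := xₜ) (v := vₜ) hft2)).symm
      rw [hvt]
      apply HasFDerivAt.comp_hasDerivAt _ _ h
      have hd := hasFDerivWithinAt_tangentCoordChange (I := 𝓡 n) (x := x₀) (y := xₜ)
        ⟨hft1, hft2⟩
      have hrange : range (𝓡 n) = univ := ModelWithCorners.range_eq_univ _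
      rw [hrange, hasFDerivWithinAt_univ, ← hψ, ψ.right_inv hf3'] at hd
      exact hd
    have key' : HasFDerivAt ((extChartAt (𝓡 n) xₜ ∘ ψ.symm) ∘ f)
        ((1 : ℝ →L[ℝ] ℝ).smulRight vₜ) t := by
      rw [ContinuousLinearMap.smulRight_one_eq_toSpanSingleton]
      exact key.hasFDerivAt
    apply HasMFDerivAt.hasMFDerivWithinAt
    refine ⟨(continuousAt_extChartAt_symm'' hf3').comp h.continuousAt, ?_⟩
    exact key'.hasFDerivWithinAt
  · have h1 : ContMDiffOn ((𝓡 n).prod 𝓘(ℝ, ℝ)) (𝓘(ℝ, EuclideanSpace ℝ (Fin n) × ℝ)) 1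
        (fun p : M × ℝ => (ψ p.1, p.2))
        ((ψ.source ∩ ψ ⁻¹' Metric.ball (ψ x₀) r) ×ˢ Ioo (-ε) ε) := by
      refine ContMDiffOn.prodMk_space ?_ contMDiffOn_snd
      refine ContMDiffOn.comp (I' := 𝓡 n) (t := ψ.source) ?_ contMDiffOn_fst (fun p hp => hp.1.1)
      have := contMDiffOn_extChartAt (I := 𝓡 n) (x := x₀) (n := 1)
      rwa [hψ, extChartAt_source]
    have h2 := hαc.contMDiffOn.comp h1 (fun p hp => ⟨hp.1.2, hp.2⟩)
    exact (contMDiffOn_extChartAt_symm (n := 1) x₀).comp h2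
      (fun p hp => ((hα (ψ p.1) hp.1.2).2 p.2 hp.2).2)

variable [CompactSpace M] {X : (x : M) → TangentSpace (𝓡 n) x}

/-- Compactness makes the time of existence uniform; this is what lets integral curves be continued
to all of ℝ. -/
lemma IsC1VectorField.exists_uniform_local_flow (hX : IsC1VectorField X) :
    ∃ ε > 0, ∀ x₀ : M, ∃ V, IsOpen V ∧ x₀ ∈ V ∧ ∃ β : M → ℝ → M,
      (∀ x ∈ V, β x 0 = x ∧ IsMIntegralCurveOn (β x) X (Ioo (-ε) ε)) ∧
      ContMDiffOn ((𝓡 n).prod 𝓘(ℝ, ℝ)) (𝓡 n) 1 (Function.uncurry β) (V ×ˢ Ioo (-ε) ε) := by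
  choose V hVo hV ε hε β hβ hβc using hX.exists_local_flow
  obtain ⟨s, hs⟩ := isCompact_univ.elim_nhds_subcover V (fun x _ => (hVo x).mem_nhds (hV x))
  have hfin : ∃ δ > 0, ∀ y ∈ s, δ ≤ ε y := by
    rcases s.eq_empty_or_nonempty with rfl | hne
    · exact ⟨1, one_pos, by simp⟩
    · obtain ⟨y, _, hy⟩ := s.exists_min_image ε hne
      exact ⟨ε y, hε y, hy⟩
  obtain ⟨δ, hδ, hδs⟩ := hfin
  refine ⟨δ, hδ, fun x₀ => ?_⟩
  obtain ⟨y, hy, hxy⟩ := mem_iUnion₂.1 (hs.2 (mem_univ x₀))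
  have hsub : Ioo (-δ) δ ⊆ Ioo (-ε y) (ε y) :=
    Ioo_subset_Ioo (neg_le_neg (hδs y hy)) (hδs y hy)
  exact ⟨V y, hVo y, hxy, β y, fun x hx => ⟨(hβ y x hx).1, (hβ y x hx).2.mono hsub⟩,
    (hβc y).mono (prod_mono le_rfl hsub)⟩

variable [T2Space M]

lemma IsC1VectorField.exists_isMIntegralCurve (hX : IsC1VectorField X) (x : M) :
    ∃ γ : ℝ → M, γ 0 = x ∧ IsMIntegralCurve γ X := by
  have : IsManifold (𝓡 n) 1 M := IsManifold.of_le (n := ∞) (by norm_num)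
  obtain ⟨ε, hε, h⟩ := hX.exists_uniform_local_flow
  refine exists_isMIntegralCurve_of_isMIntegralCurveOn hX hε (fun y => ?_) x
  obtain ⟨V, _, hy, β, hβ, _⟩ := h y
  exact ⟨β y, hβ y hy⟩

/-- The curve chosen in the definition of `flow` depends on `x` only, so varying `t` follows a
single integral curve. -/
lemma IsC1VectorField.flow_spec (hX : IsC1VectorField X) (x : M) :
    flow X 0 x = x ∧ IsMIntegralCurve (fun t => flow X t x) X := by
  have h := hX.exists_isMIntegralCurve x
  have : (fun t => flow X t x) = h.choose := by
    funext t; simp only [flow, dif_pos h]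
  rw [this]
  refine ⟨?_, h.choose_spec.2⟩
  exact (congrFun this 0).trans h.choose_spec.1

lemma IsC1VectorField.flow_zero (hX : IsC1VectorField X) (x : M) : flow X 0 x = x :=
  (hX.flow_spec x).1

lemma IsC1VectorField.flow_add (hX : IsC1VectorField X) (s t : ℝ) (x : M) :
    flow X (s + t) x = flow X s (flow X t x) := by
  have : IsManifold (𝓡 n) 1 M := IsManifold.of_le (n := ∞) (by norm_num)
  have h := isMIntegralCurve_Ioo_eq_of_contMDiff_boundaryless (t₀ := 0) hX
    ((hX.flow_spec x).2.comp_add t) (hX.flow_spec (flow X t x)).2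
    (by simp [hX.flow_zero])
  exact congrFun h s

theorem IsC1VectorField.contMDiff_flow (hX : IsC1VectorField X) :
    ContMDiff ((𝓡 n).prod 𝓘(ℝ, ℝ)) (𝓡 n) 1 (fun p : M × ℝ => flow X p.2 p.1) := by
  have : IsManifold (𝓡 n) 1 M := IsManifold.of_le (n := ∞) (by norm_num)
  obtain ⟨ε, hε, h⟩ := hX.exists_uniform_local_flow
  have hloc : ∀ (x : M) (t : ℝ), |t| < ε →
      ContMDiffAt ((𝓡 n).prod 𝓘(ℝ, ℝ)) (𝓡 n) 1 (fun p : M × ℝ => flow X p.2 p.1) (x, t) := by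
    intro x t ht
    obtain ⟨V, hVo, hx, β, hβ, hβc⟩ := h x
    have hn : V ×ˢ Ioo (-ε) ε ∈ 𝓝 (x, t) :=
      (hVo.prod isOpen_Ioo).mem_nhds ⟨hx, abs_lt.1 ht⟩
    refine (hβc.contMDiffAt hn).congr_of_eventuallyEq ?_
    filter_upwards [hn] with p hp
    have hz : (0 : ℝ) ∈ Ioo (-ε) ε := ⟨by linarith, hε⟩
    exact isMIntegralCurveOn_Ioo_eqOn_of_contMDiff_boundaryless hz hX
      ((hX.flow_spec p.1).2.isMIntegralCurveOn _) (hβ p.1 hp.1).2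
      (by rw [(hβ p.1 hp.1).1]; exact hX.flow_zero _) hp.2
  have hind : ∀ (k : ℕ) (x : M) (t : ℝ), |t| < (k + 1) * ε →
      ContMDiffAt ((𝓡 n).prod 𝓘(ℝ, ℝ)) (𝓡 n) 1 (fun p : M × ℝ => flow X p.2 p.1) (x, t) := by
    intro k
    induction k with
    | zero => intro x t ht; exact hloc x t (by simpa using ht)
    | succ k ih =>
      intro x t ht
      push_cast at ht
      have hk : (0 : ℝ) < k + 1 + 1 := by positivity
      -- Split `t = d * t + c * t`: the part `c * t` is short enough for the induction hypothesis
      -- and `d * t` for the local statement.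
      set c : ℝ := (k + 1) / (k + 1 + 1)
      set d : ℝ := 1 / (k + 1 + 1)
      have hcd : ∀ s : ℝ, s = d * s + c * s := by
        intro s; simp only [c, d]; field_simp; ring
      have hfun : (fun p : M × ℝ => flow X p.2 p.1) =
          (fun p : M × ℝ => flow X p.2 p.1) ∘
            (fun p : M × ℝ => (flow X (c * p.2) p.1, d * p.2)) := by
        funext p
        simp only [Function.comp]
        rw [← hX.flow_add, ← hcd]
      have hmul : ∀ a : ℝ, ContMDiff ((𝓡 n).prod 𝓘(ℝ, ℝ)) 𝓘(ℝ, ℝ) 1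
          (fun p : M × ℝ => a * p.2) := fun a =>
        (contDiff_const.mul contDiff_id).contMDiff.comp contMDiff_snd
      have h1 : ContMDiffAt ((𝓡 n).prod 𝓘(ℝ, ℝ)) (𝓡 n) 1
          (fun p : M × ℝ => flow X (c * p.2) p.1) (x, t) := by
        refine ContMDiffAt.comp (x, t) (g := fun p : M × ℝ => flow X p.2 p.1)
          (f := fun p : M × ℝ => (p.1, c * p.2)) (ih x (c * t) ?_)
          (contMDiffAt_fst.prodMk (hmul c).contMDiffAt)
        rw [abs_mul, abs_of_pos (by positivity : 0 < c)]
        calc c * |t| < c * ((k + 1 + 1) * ε) := by gcongr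
          _ = (k + 1) * ε := by simp only [c]; field_simp
      rw [hfun]
      refine ContMDiffAt.comp (x, t) (hloc _ _ ?_) (h1.prodMk (hmul d).contMDiffAt)
      simp only
      rw [abs_mul, abs_of_pos (by positivity : 0 < d)]
      calc d * |t| < d * ((k + 1 + 1) * ε) := by gcongr
        _ = ε := by simp only [d]; field_simp
  rintro ⟨x, t⟩
  obtain ⟨k, hk⟩ := exists_nat_gt (|t| / ε)
  refine hind k x t ?_
  rw [div_lt_iff₀ hε] at hk
  nlinarith

lemma IsC1VectorField.mdifferentiable_flow (hX : IsC1VectorField X) (t : ℝ) :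
    MDifferentiable (𝓡 n) (𝓡 n) (flow X t) := by
  have h : ContMDiff (𝓡 n) (𝓡 n) 1 (flow X t) :=
    hX.contMDiff_flow.comp (contMDiff_id.prodMk contMDiff_const)
  exact h.mdifferentiable (by simp)

/-- The tangent flow as a map of the tangent bundle. -/
def tangentBundleFlow (X : (x : M) → TangentSpace (𝓡 n) x) (t : ℝ) (w : TangentBundle (𝓡 n) M) :
    TangentBundle (𝓡 n) M :=
  ⟨flow X t w.1, tangentFlow X t w.1 w.2⟩

lemma IsC1VectorField.tangentBundleFlow_zero (hX : IsC1VectorField X)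
    (w : TangentBundle (𝓡 n) M) : tangentBundleFlow X 0 w = w := by
  have h : flow X 0 = @id M := funext hX.flow_zero
  change tangentMap (𝓡 n) (𝓡 n) (flow X 0) w = w
  rw [h, tangentMap_id]
  rfl

lemma IsC1VectorField.tangentBundleFlow_add (hX : IsC1VectorField X) (s t : ℝ)
    (w : TangentBundle (𝓡 n) M) :
    tangentBundleFlow X (s + t) w = tangentBundleFlow X s (tangentBundleFlow X t w) := by
  have h : flow X (s + t) = flow X s ∘ flow X t := funext (hX.flow_add s t)
  change tangentMap (𝓡 n) (𝓡 n) (flow X (s + t)) w =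
    tangentMap (𝓡 n) (𝓡 n) (flow X s) (tangentMap (𝓡 n) (𝓡 n) (flow X t) w)
  rw [h, tangentMap_comp (hX.mdifferentiable_flow s) (hX.mdifferentiable_flow t)]
  rfl

/-- Continuity jointly in time and vector comes from the tangent map of `(x, t) ↦ X_t(x)` on `TM ×
Tℝ`, evaluated on zero vectors in the time direction. -/
theorem IsC1VectorField.continuous_tangentBundleFlow (hX : IsC1VectorField X) :
    Continuous (fun p : ℝ × TangentBundle (𝓡 n) M => tangentBundleFlow X p.1 p.2) := by
  have : IsManifold (𝓡 n) 1 M := IsManifold.of_le (n := ∞) (by norm_num)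
  have hT := hX.contMDiff_flow.continuous_tangentMap le_rfl
  have hE := (contMDiff_equivTangentBundleProd_symm (I := 𝓡 n) (M := M) (I' := 𝓘(ℝ, ℝ))
    (M' := ℝ) (n := 0)).continuous
  have hz : Continuous (fun t : ℝ => (⟨t, 0⟩ : TangentBundle 𝓘(ℝ, ℝ) ℝ)) :=
    (Bundle.contMDiff_zeroSection ℝ (TangentSpace 𝓘(ℝ, ℝ) : ℝ → Type _) (n := 0)
      (IB := 𝓘(ℝ, ℝ))).continuous
  have hc := hT.comp (hE.comp (continuous_snd.prodMk (hz.comp continuous_fst)) :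
    Continuous (fun p : ℝ × TangentBundle (𝓡 n) M =>
      (equivTangentBundleProd (𝓡 n) M 𝓘(ℝ, ℝ) ℝ).symm (p.2, ⟨p.1, 0⟩)))
  refine hc.congr fun p => ?_
  obtain ⟨t, x, v⟩ := p
  have hι : MDifferentiableAt (𝓡 n) ((𝓡 n).prod 𝓘(ℝ, ℝ)) (fun y : M => (y, t)) x :=
    mdifferentiableAt_id.prodMk mdifferentiableAt_const
  have hcomp := tangentMap_comp_at (I := 𝓡 n) (I' := (𝓡 n).prod 𝓘(ℝ, ℝ)) (I'' := 𝓡 n)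
    (f := fun y : M => (y, t)) (g := fun p : M × ℝ => flow X p.2 p.1) ⟨x, v⟩
    (hX.contMDiff_flow.mdifferentiable (by simp) _) hι
  change _ = tangentMap (𝓡 n) (𝓡 n) ((fun p : M × ℝ => flow X p.2 p.1) ∘ fun y : M => (y, t))
    ⟨x, v⟩
  rw [hcomp]
  simp only [Function.comp]
  congr 1
  rw [tangentMap, mfderiv_prod_left]
  rfl

end Flow

open Bundle Filter

/-! ### Convergence and compactness in the total space of a Riemannian vector bundle. -/

section Bundles

variable {B : Type*} [TopologicalSpace B]
  {F : Type*} [NormedAddCommGroup F] [NormedSpace ℝ F]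
  {V : B → Type*} [TopologicalSpace (TotalSpace F V)] [∀ x, NormedAddCommGroup (V x)]
  [∀ x, InnerProductSpace ℝ (V x)] [FiberBundle F V] [VectorBundle ℝ F V]

/-- The second condition involves a single trivialization, and a map that is linear on every fibre,
so the fibrewise vector operations pass to limits. -/
lemma tendsto_totalSpace_iff {ι : Type*} {l : Filter ι} {f : ι → TotalSpace F V}
    {w : TotalSpace F V} :
    Tendsto f l (𝓝 w) ↔ Tendsto (fun i => (f i).1) l (𝓝 w.1) ∧
      Tendsto (fun i => (trivializationAt F V w.1).linearMapAt ℝ (f i).1 (f i).2) l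
        (𝓝 ((trivializationAt F V w.1).linearMapAt ℝ w.1 w.2)) := by
  set e := trivializationAt F V w.1
  have hw : w.1 ∈ e.baseSet := FiberBundle.mem_baseSet_trivializationAt' w.1
  have hval : ∀ z : TotalSpace F V, z.1 ∈ e.baseSet → (e z).2 = e.linearMapAt ℝ z.1 z.2 := by
    intro z hz
    rw [e.coe_linearMapAt_of_mem hz]
  rw [e.tendsto_nhds_iff (e.mem_source.2 hw)]
  refine and_congr_right fun h1 => ?_
  rw [hval w hw]
  refine tendsto_congr' ?_
  filter_upwards [h1 (e.open_baseSet.mem_nhds hw)] with i hi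
  exact hval _ hi

variable {ι : Type*} {l : Filter ι} {b : ι → B} {v w : ∀ i, V (b i)} {x : B} {v₀ w₀ : V x}

lemma tendsto_fiber_add
    (hv : Tendsto (fun i => (⟨b i, v i⟩ : TotalSpace F V)) l (𝓝 ⟨x, v₀⟩))
    (hw : Tendsto (fun i => (⟨b i, w i⟩ : TotalSpace F V)) l (𝓝 ⟨x, w₀⟩)) :
    Tendsto (fun i => (⟨b i, v i + w i⟩ : TotalSpace F V)) l (𝓝 ⟨x, v₀ + w₀⟩) := by
  rw [tendsto_totalSpace_iff] at *
  refine ⟨hv.1, ?_⟩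
  simp only [map_add]
  exact hv.2.add hw.2

lemma tendsto_fiber_smul {c : ι → ℝ} {c₀ : ℝ} (hc : Tendsto c l (𝓝 c₀))
    (hv : Tendsto (fun i => (⟨b i, v i⟩ : TotalSpace F V)) l (𝓝 ⟨x, v₀⟩)) :
    Tendsto (fun i => (⟨b i, c i • v i⟩ : TotalSpace F V)) l (𝓝 ⟨x, c₀ • v₀⟩) := by
  rw [tendsto_totalSpace_iff] at *
  refine ⟨hv.1, ?_⟩
  simp only [map_smul]
  exact hc.smul hv.2

lemma tendsto_fiber_sub
    (hv : Tendsto (fun i => (⟨b i, v i⟩ : TotalSpace F V)) l (𝓝 ⟨x, v₀⟩))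
    (hw : Tendsto (fun i => (⟨b i, w i⟩ : TotalSpace F V)) l (𝓝 ⟨x, w₀⟩)) :
    Tendsto (fun i => (⟨b i, v i - w i⟩ : TotalSpace F V)) l (𝓝 ⟨x, v₀ - w₀⟩) := by
  rw [tendsto_totalSpace_iff] at *
  refine ⟨hv.1, ?_⟩
  simp only [map_sub]
  exact hv.2.sub hw.2

lemma tendsto_fiber_sum {κ : Type*} {s : Finset κ} {v : κ → ∀ i, V (b i)} {v₀ : κ → V x}
    (hb : Tendsto b l (𝓝 x))
    (hv : ∀ k ∈ s, Tendsto (fun i => (⟨b i, v k i⟩ : TotalSpace F V)) l (𝓝 ⟨x, v₀ k⟩)) :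
    Tendsto (fun i => (⟨b i, ∑ k ∈ s, v k i⟩ : TotalSpace F V)) l (𝓝 ⟨x, ∑ k ∈ s, v₀ k⟩) := by
  rw [tendsto_totalSpace_iff]
  refine ⟨hb, ?_⟩
  simp only [map_sum]
  exact tendsto_finsetSum _ fun k hk => (tendsto_totalSpace_iff.1 (hv k hk)).2

lemma linearMapAt_injective {e : Trivialization F (π F V)} [MemTrivializationAtlas e] {x : B}
    (hx : x ∈ e.baseSet) : Function.Injective (e.linearMapAt ℝ x) := by
  intro v w h
  have := congrArg (e.symm x) h
  rwa [e.symm_linearMapAt hx, e.symm_linearMapAt hx] at this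

lemma t2Space_totalSpace [T2Space B] : T2Space (TotalSpace F V) := by
  refine t2_iff_ultrafilter.2 fun {w z} f hw hz => ?_
  have hw' := tendsto_totalSpace_iff.1 (show Tendsto id (f : Filter (TotalSpace F V)) (𝓝 w) from hw)
  have hz' := tendsto_totalSpace_iff.1 (show Tendsto id (f : Filter (TotalSpace F V)) (𝓝 z) from hz)
  obtain ⟨x, v⟩ := w
  obtain ⟨y, u⟩ := z
  obtain rfl : x = y := tendsto_nhds_unique hw'.1 hz'.1
  congr 1
  exact linearMapAt_injective (FiberBundle.mem_baseSet_trivializationAt' x)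
    (tendsto_nhds_unique hw'.2 hz'.2)

section Metric
variable [IsContinuousRiemannianBundle F V]

lemma continuous_norm_totalSpace : Continuous (fun w : TotalSpace F V => ‖w.2‖) := by
  have h : Continuous (fun w : TotalSpace F V => inner ℝ w.2 w.2) :=
    Continuous.inner_bundle (F := F) (b := fun w : TotalSpace F V => w.1)
      (v := fun w => w.2) (w := fun w => w.2) continuous_id continuous_id
  have h2 : (fun w : TotalSpace F V => ‖w.2‖) = fun w => √(inner ℝ w.2 w.2) := by
    funext w; rw [real_inner_self_eq_norm_sq, Real.sqrt_sq (norm_nonneg _)]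
  rw [h2]
  exact h.sqrt

lemma tendsto_fiber_norm
    (hv : Tendsto (fun i => (⟨b i, v i⟩ : TotalSpace F V)) l (𝓝 ⟨x, v₀⟩)) :
    Tendsto (fun i => ‖v i‖) l (𝓝 ‖v₀‖) :=
  ((continuous_norm_totalSpace (F := F) (V := V)).tendsto _).comp hv

lemma tendsto_fiber_inner
    (hv : Tendsto (fun i => (⟨b i, v i⟩ : TotalSpace F V)) l (𝓝 ⟨x, v₀⟩))
    (hw : Tendsto (fun i => (⟨b i, w i⟩ : TotalSpace F V)) l (𝓝 ⟨x, w₀⟩)) :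
    Tendsto (fun i => inner ℝ (v i) (w i)) l (𝓝 (inner ℝ v₀ w₀)) := by
  simp only [real_inner_eq_norm_add_mul_self_sub_norm_mul_self_sub_norm_mul_self_div_two]
  have h1 := tendsto_fiber_norm hv
  have h2 := tendsto_fiber_norm hw
  have h3 := tendsto_fiber_norm (tendsto_fiber_add hv hw)
  exact (((h3.mul h3).sub (h1.mul h1)).sub (h2.mul h2)).div_const 2

/-- The bundle of discs of radius `R` is compact. -/
lemma isCompact_discBundle [CompactSpace B] [T2Space B] [FiniteDimensional ℝ F] (R : ℝ) :
    IsCompact {w : TotalSpace F V | ‖w.2‖ ≤ R} := by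
  have hcl : IsClosed {w : TotalSpace F V | ‖w.2‖ ≤ R} :=
    isClosed_le continuous_norm_totalSpace continuous_const
  have hloc : ∀ x : B, ∃ N ∈ 𝓝 x, ∃ Z : Set (TotalSpace F V), IsCompact Z ∧
      ∀ w : TotalSpace F V, w.1 ∈ N → ‖w.2‖ ≤ R → w ∈ Z := by
    intro x
    obtain ⟨C, hC, h⟩ := eventually_norm_trivializationAt_lt F V x
    set e := trivializationAt F V x
    have hx : x ∈ e.baseSet := FiberBundle.mem_baseSet_trivializationAt' x
    obtain ⟨N, hN, hNs, hNc⟩ := local_compact_nhds (inter_mem h (e.open_baseSet.mem_nhds hx))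
    refine ⟨N, hN, e.toOpenPartialHomeomorph.symm '' (N ×ˢ Metric.closedBall (0 : F) (C * R)),
      (hNc.prod (isCompact_closedBall 0 _)).image_of_continuousOn
        (e.toOpenPartialHomeomorph.continuousOn_symm.mono fun p hp => ?_), fun w hwN hwR => ?_⟩
    · exact e.mem_target.2 (hNs hp.1).2
    · have hws : w ∈ e.source := e.mem_source.2 (hNs hwN).2
      refine ⟨e w, ⟨?_, ?_⟩, e.toOpenPartialHomeomorph.left_inv hws⟩
      · rwa [e.coe_fst hws]
      · rw [mem_closedBall_zero_iff]
        have h1 : (e w).2 = e.continuousLinearMapAt ℝ w.1 w.2 :=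
          (e.continuousLinearMapAt_apply_of_mem ℝ (hNs hwN).2 w.2).symm
        rw [h1]
        refine (ContinuousLinearMap.le_opNorm _ _).trans ?_
        exact mul_le_mul (hNs hwN).1.le hwR (norm_nonneg _) hC.le
  choose N hN Z hZ hNZ using hloc
  obtain ⟨s, hs⟩ := isCompact_univ.elim_nhds_subcover N (fun x _ => hN x)
  refine (s.isCompact_biUnion fun x _ => hZ x).of_isClosed_subset hcl fun w hw => ?_
  obtain ⟨y, hy, hwy⟩ := mem_iUnion₂.1 (hs.2 (mem_univ w.1))
  exact mem_iUnion₂.2 ⟨y, hy, hNZ y w hwy hw⟩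

end Metric
end Bundles

/-- If a property holds near every point over `Λ` of a compact set fibred over `B`, then it holds
over a neighbourhood of `Λ`. -/
lemma exists_nhdsSet_forall_of_isCompact {B Y : Type*} [TopologicalSpace B] [T2Space B]
    [TopologicalSpace Y] {Z : Set Y} (hZ : IsCompact Z) {p : Y → B} (hp : Continuous p)
    {Λ : Set B} {Q : Y → Prop} (hQ : ∀ y ∈ Z, p y ∈ Λ → ∀ᶠ z in 𝓝[Z] y, Q z) :
    ∃ U ∈ 𝓝ˢ Λ, ∀ y ∈ Z, p y ∈ U → Q y := by
  set O : Set Y := ⋃₀ {O | IsOpen O ∧ ∀ z ∈ O ∩ Z, Q z}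
  have hO : IsOpen O := isOpen_sUnion fun O hO => hO.1
  -- `O` is the union of the open sets on which `Q` holds within `Z`. The remainder is compact, so
  -- its image in `B` is closed, and it misses `Λ`.
  have hC : IsClosed (p '' (Z \ O)) := ((hZ.diff hO).image hp).isClosed
  refine ⟨(p '' (Z \ O))ᶜ, hC.isOpen_compl.mem_nhdsSet.2 fun x hx => ?_, fun y hy hpy => ?_⟩
  · rintro ⟨y, ⟨hy, hyO⟩, rfl⟩
    obtain ⟨W, hW, hyW, h⟩ := mem_nhdsWithin.1 (hQ y hy hx)
    exact hyO (mem_sUnion.2 ⟨W, ⟨hW, h⟩, hyW⟩)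
  · have : y ∈ O := by
      by_contra hyO
      exact hpy ⟨y, ⟨hy, hyO⟩, rfl⟩
    obtain ⟨W, ⟨_, hW⟩, hyW⟩ := mem_sUnion.1 this
    exact hW y ⟨hyW, hy⟩

/-! ### Continuous splittings: local frames, projections, closed families. -/

section Bundles

set_option linter.unusedSectionVars false

variable {B : Type*} [TopologicalSpace B]
  {F : Type*} [NormedAddCommGroup F] [NormedSpace ℝ F]
  {V : B → Type*} [TopologicalSpace (TotalSpace F V)] [∀ x, NormedAddCommGroup (V x)]
  [∀ x, InnerProductSpace ℝ (V x)] [FiberBundle F V] [VectorBundle ℝ F V]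

/-- The family of subspaces `E x`, `x ∈ S`, has continuous local frames. -/
def HasLocalFrames (F : Type*) [NormedAddCommGroup F] [NormedSpace ℝ F]
    {V : B → Type*} [TopologicalSpace (TotalSpace F V)] [∀ x, NormedAddCommGroup (V x)]
    [∀ x, InnerProductSpace ℝ (V x)] (S : Set B) (E : ∀ x, Submodule ℝ (V x)) : Prop :=
  ∀ x₀ ∈ S, ∃ N ∈ 𝓝 x₀, ∃ (k : ℕ) (e : Fin k → ∀ x, V x),
    (∀ i, ContinuousOn (fun x => (⟨x, e i x⟩ : TotalSpace F V)) (S ∩ N)) ∧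
    ∀ x ∈ S ∩ N, LinearIndependent ℝ (fun i => e i x) ∧
      Submodule.span ℝ (range fun i => e i x) = E x

open Classical in
/-- The projection to `E x` along `G x` (zero if these spaces are not complementary). -/
def fiberProj (E G : ∀ x, Submodule ℝ (V x)) (x : B) (v : V x) : V x :=
  if h : IsCompl (E x) (G x) then (E x).projection (G x) h v else 0

section fiberProj
variable {E G : ∀ x, Submodule ℝ (V x)} {x : B}

lemma fiberProj_add (h : IsCompl (E x) (G x)) {u v : V x} (hu : u ∈ E x) (hv : v ∈ G x) :
    fiberProj E G x (u + v) = u := by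
  rw [fiberProj, dif_pos h, map_add, (E x).projection_apply_of_mem_left h hu,
    (Submodule.projection_apply_eq_zero_iff h).2 hv, add_zero]

lemma fiberProj_mem (h : IsCompl (E x) (G x)) (v : V x) : fiberProj E G x v ∈ E x := by
  rw [fiberProj, dif_pos h]; exact Submodule.projection_apply_mem h v

lemma sub_fiberProj_mem (h : IsCompl (E x) (G x)) (v : V x) : v - fiberProj E G x v ∈ G x := by
  rw [fiberProj, dif_pos h]; exact Submodule.sub_projection_mem h v

end fiberProj

/-- The splitting `E ⊕ G` over `S` has continuous projections. -/
def IsContinuousSplitting (F : Type*) [NormedAddCommGroup F] [NormedSpace ℝ F]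
    {V : B → Type*} [TopologicalSpace (TotalSpace F V)] [∀ x, NormedAddCommGroup (V x)]
    [∀ x, InnerProductSpace ℝ (V x)] (S : Set B) (E G : ∀ x, Submodule ℝ (V x)) : Prop :=
  (∀ x ∈ S, IsCompl (E x) (G x)) ∧
    ContinuousOn (fun w : TotalSpace F V => (⟨w.1, fiberProj E G w.1 w.2⟩ : TotalSpace F V))
      {w | w.1 ∈ S}

variable {S : Set B} {E G : ∀ x, Submodule ℝ (V x)}

lemma IsContinuousSplitting.symm (h : IsContinuousSplitting F S E G) :
    IsContinuousSplitting F S G E := by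
  refine ⟨fun x hx => (h.1 x hx).symm, fun w hw => ?_⟩
  have h1 : Tendsto (fun z : TotalSpace F V => (⟨z.1, z.2 - fiberProj E G z.1 z.2⟩ :
      TotalSpace F V)) (𝓝[{w | w.1 ∈ S}] w) (𝓝 ⟨w.1, w.2 - fiberProj E G w.1 w.2⟩) :=
    tendsto_fiber_sub (tendsto_id.mono_left nhdsWithin_le_nhds) (h.2 w hw)
  have hval : ∀ z : TotalSpace F V, z.1 ∈ S →
      fiberProj G E z.1 z.2 = z.2 - fiberProj E G z.1 z.2 := by
    intro z hz
    have := fiberProj_add (h.1 _ hz).symm (sub_fiberProj_mem (h.1 _ hz) z.2)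
      (fiberProj_mem (h.1 _ hz) z.2)
    rwa [sub_add_cancel] at this
  rw [ContinuousWithinAt, hval w hw]
  refine h1.congr' ?_
  filter_upwards [self_mem_nhdsWithin] with z hz
  rw [hval z hz]

/-- Read in a trivialization, the two frames together form an invertible matrix `Γ x` depending
continuously on `x`. Its inverse is then continuous, and the projection keeps the coordinates along
the frame of `E`. -/
lemma HasLocalFrames.isContinuousSplitting [FiniteDimensional ℝ F]
    (hc : ∀ x ∈ S, IsCompl (E x) (G x)) (hE : HasLocalFrames F S E) (hG : HasLocalFrames F S G) :
    IsContinuousSplitting F S E G := by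
  refine ⟨hc, fun w₀ hw₀ => ?_⟩
  obtain ⟨N₁, hN₁, k, e, hec, he⟩ := hE w₀.1 hw₀
  obtain ⟨N₂, hN₂, m, f, hfc, hf⟩ := hG w₀.1 hw₀
  set τ := trivializationAt F V w₀.1
  have hx₀ : w₀.1 ∈ τ.baseSet := FiberBundle.mem_baseSet_trivializationAt' w₀.1
  set a : Fin k ⊕ Fin m → ∀ x, V x := Sum.elim e f
  set Γ : B → (Fin k ⊕ Fin m → ℝ) →L[ℝ] F := fun x =>
    ∑ i, (ContinuousLinearMap.proj (R := ℝ) (φ := fun _ : Fin k ⊕ Fin m => ℝ) i).smulRight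
      (τ.linearMapAt ℝ x (a i x))
  -- the frames give coordinates
  have hbasis : ∀ x ∈ S ∩ (N₁ ∩ N₂), ∃ bx : Module.Basis (Fin k ⊕ Fin m) ℝ (V x),
      ∀ i, bx i = a i x := by
    intro x hx
    obtain ⟨hli, hspan⟩ := he x ⟨hx.1, hx.2.1⟩
    obtain ⟨hli', hspan'⟩ := hf x ⟨hx.1, hx.2.2⟩
    have hli2 : LinearIndependent ℝ (fun i => a i x) := by
      have h := hli.sum_type hli' (by rw [hspan, hspan']; exact (hc x hx.1).disjoint)
      have h' : (fun i => a i x) = Sum.elim (fun i => e i x) fun i => f i x := by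
        funext i
        cases i <;> rfl
      rwa [h']
    refine ⟨Module.Basis.mk hli2 ?_, fun i => by rw [Module.Basis.mk_apply]⟩
    have h3 : Submodule.span ℝ (range fun i => a i x) = ⊤ := by
      have : (range fun i => a i x) = (range fun i => e i x) ∪ range fun i => f i x := by
        ext v; simp [a, Sum.exists]
      rw [this, Submodule.span_union, hspan, hspan']
      exact (hc x hx.1).sup_eq_top
    exact h3.ge
  have hequiv : ∀ x ∈ S ∩ (N₁ ∩ N₂), ∀ hxb : x ∈ τ.baseSet,
      ∃ Φ : (Fin k ⊕ Fin m → ℝ) ≃L[ℝ] F, (Φ : (Fin k ⊕ Fin m → ℝ) →L[ℝ] F) = Γ x ∧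
        ∀ v : V x, fiberProj E G x v =
          ∑ i : Fin k, (Φ.symm (τ.linearMapAt ℝ x v)) (Sum.inl i) • e i x := by
    intro x hx hxb
    obtain ⟨bx, hbx⟩ := hbasis x hx
    set Φ := (bx.equivFun.symm.trans (τ.linearEquivAt ℝ x hxb)).toContinuousLinearEquiv
    have hΦ : ∀ c, Φ c = Γ x c := by
      intro c
      have h1 : Φ c = τ.linearEquivAt ℝ x hxb (bx.equivFun.symm c) := rfl
      have h2 : ∀ v, τ.linearEquivAt ℝ x hxb v = τ.linearMapAt ℝ x v := by
        intro v; rw [τ.linearMapAt_def_of_mem hxb]; rfl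
      rw [h1, h2, Module.Basis.equivFun_symm_apply, map_sum]
      simp [Γ, hbx]
    refine ⟨Φ, ContinuousLinearMap.ext hΦ, fun v => ?_⟩
    set c := Φ.symm (τ.linearMapAt ℝ x v)
    have hv : v = ∑ i, c i • a i x := by
      apply linearMapAt_injective hxb
      rw [map_sum]
      have h3 : Φ c = τ.linearMapAt ℝ x v := Φ.apply_symm_apply _
      rw [← h3, hΦ]
      simp [Γ]
    have hv' : v = (∑ i, c (Sum.inl i) • e i x) + ∑ i, c (Sum.inr i) • f i x := by
      rw [Fintype.sum_sum_type] at hv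
      exact hv
    conv_lhs => rw [hv']
    refine fiberProj_add (hc x hx.1) (Submodule.sum_mem _ fun i _ => Submodule.smul_mem _ _ ?_)
      (Submodule.sum_mem _ fun i _ => Submodule.smul_mem _ _ ?_)
    · rw [← (he x ⟨hx.1, hx.2.1⟩).2]
      exact Submodule.subset_span ⟨i, rfl⟩
    · rw [← (hf x ⟨hx.1, hx.2.2⟩).2]
      exact Submodule.subset_span ⟨i, rfl⟩
  set l := 𝓝[{w : TotalSpace F V | w.1 ∈ S}] w₀
  have hproj : Tendsto (fun w : TotalSpace F V => w.1) l (𝓝 w₀.1) :=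
    ((FiberBundle.continuous_proj F V).tendsto w₀).mono_left nhdsWithin_le_nhds
  have hS : ∀ᶠ w in l, w.1 ∈ S := self_mem_nhdsWithin
  have hmem : ∀ᶠ w in l, w.1 ∈ S ∩ (N₁ ∩ N₂) ∧ w.1 ∈ τ.baseSet := by
    filter_upwards [hS, hproj hN₁, hproj hN₂, hproj (τ.open_baseSet.mem_nhds hx₀)]
      with w h1 h2 h3 h4 using ⟨⟨h1, h2, h3⟩, h4⟩
  have hat : ∀ i, Tendsto (fun w : TotalSpace F V => (⟨w.1, a i w.1⟩ : TotalSpace F V)) l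
      (𝓝 ⟨w₀.1, a i w₀.1⟩) := by
    have key : ∀ (N : Set B) (g : ∀ x, V x), N ∈ 𝓝 w₀.1 →
        ContinuousOn (fun x => (⟨x, g x⟩ : TotalSpace F V)) (S ∩ N) →
        Tendsto (fun w : TotalSpace F V => (⟨w.1, g w.1⟩ : TotalSpace F V)) l
          (𝓝 ⟨w₀.1, g w₀.1⟩) := by
      intro N g hN hg
      refine Tendsto.comp (y := 𝓝[S ∩ N] w₀.1) (hg w₀.1 ⟨hw₀, mem_of_mem_nhds hN⟩)
        (tendsto_nhdsWithin_of_tendsto_nhds_of_eventually_within _ hproj ?_)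
      filter_upwards [hS, hproj hN] with w h1 h2 using ⟨h1, h2⟩
    rintro (i | i)
    · exact key N₁ (e i) hN₁ (hec i)
    · exact key N₂ (f i) hN₂ (hfc i)
  have hΓ : Tendsto (fun w : TotalSpace F V => Γ w.1) l (𝓝 (Γ w₀.1)) := by
    refine tendsto_finsetSum _ fun i _ => ?_
    have h1 := (tendsto_totalSpace_iff.1 (hat i)).2
    exact ((ContinuousLinearMap.smulRightL ℝ (Fin k ⊕ Fin m → ℝ) F
      (ContinuousLinearMap.proj (R := ℝ) (φ := fun _ : Fin k ⊕ Fin m => ℝ) i)).continuous.tendsto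
        _).comp h1
  have hw₀N : w₀.1 ∈ S ∩ (N₁ ∩ N₂) := ⟨hw₀, mem_of_mem_nhds hN₁, mem_of_mem_nhds hN₂⟩
  obtain ⟨Φ₀, hΦ₀, hproj₀⟩ := hequiv w₀.1 hw₀N hx₀
  have hinv : Tendsto (fun w : TotalSpace F V => ContinuousLinearMap.inverse (Γ w.1)) l
      (𝓝 (ContinuousLinearMap.inverse (Γ w₀.1))) := by
    rw [← hΦ₀] at hΓ ⊢
    exact ((contDiffAt_map_inverse (𝕜 := ℝ) (n := 0) Φ₀).continuousAt.tendsto).comp hΓ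
  have hc : Tendsto (fun w : TotalSpace F V =>
      ContinuousLinearMap.inverse (Γ w.1) (τ.linearMapAt ℝ w.1 w.2)) l
      (𝓝 (ContinuousLinearMap.inverse (Γ w₀.1) (τ.linearMapAt ℝ w₀.1 w₀.2))) :=
    (isBoundedBilinearMap_apply.continuous.tendsto _).comp (hinv.prodMk_nhds
      ((tendsto_totalSpace_iff.1 (tendsto_id (x := 𝓝 w₀))).2.mono_left nhdsWithin_le_nhds))
  have hsum := tendsto_fiber_sum (F := F) (s := Finset.univ) (b := fun w : TotalSpace F V => w.1)
    (v := fun i w => ContinuousLinearMap.inverse (Γ w.1) (τ.linearMapAt ℝ w.1 w.2) (Sum.inl i) •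
      e i w.1) (v₀ := fun i => ContinuousLinearMap.inverse (Γ w₀.1)
        (τ.linearMapAt ℝ w₀.1 w₀.2) (Sum.inl i) • e i w₀.1) hproj
    (fun i _ => tendsto_fiber_smul (((continuous_apply (Sum.inl i)).tendsto _).comp hc)
      (hat (Sum.inl i)))
  have hval : ∀ w : TotalSpace F V, w.1 ∈ S ∩ (N₁ ∩ N₂) → w.1 ∈ τ.baseSet →
      fiberProj E G w.1 w.2 = ∑ i, ContinuousLinearMap.inverse (Γ w.1)
        (τ.linearMapAt ℝ w.1 w.2) (Sum.inl i) • e i w.1 := by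
    intro w h1 h2
    obtain ⟨Φ, hΦ, h⟩ := hequiv w.1 h1 h2
    rw [← hΦ, ContinuousLinearMap.inverse_equiv]
    exact h w.2
  rw [ContinuousWithinAt, hval w₀ hw₀N hx₀]
  refine hsum.congr' ?_
  filter_upwards [hmem] with w hw
  rw [hval w hw.1 hw.2]

end Bundles

section Bundles
set_option linter.unusedSectionVars false

variable {B : Type*} [TopologicalSpace B]
  {F : Type*} [NormedAddCommGroup F] [NormedSpace ℝ F]
  {V : B → Type*} [TopologicalSpace (TotalSpace F V)] [∀ x, NormedAddCommGroup (V x)]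
  [∀ x, InnerProductSpace ℝ (V x)] [FiberBundle F V] [VectorBundle ℝ F V]
  {S : Set B} {E G : ∀ x, Submodule ℝ (V x)}

/-- Compactness of the disc bundle in the form used for limits: along an ultrafilter, bounded
vectors over converging base points converge. -/
lemma exists_tendsto_of_norm_le [IsContinuousRiemannianBundle F V] [CompactSpace B] [T2Space B]
    [FiniteDimensional ℝ F] {ι : Type*} {f : Ultrafilter ι} {b : ι → B} {v : ∀ i, V (b i)} {x : B}
    {R : ℝ} (hb : Tendsto b f (𝓝 x)) (hv : ∀ᶠ i in f, ‖v i‖ ≤ R) :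
    ∃ v₀ : V x, Tendsto (fun i => (⟨b i, v i⟩ : TotalSpace F V)) f (𝓝 ⟨x, v₀⟩) := by
  obtain ⟨w, -, hw⟩ := isCompact_iff_ultrafilter_le_nhds.1 (isCompact_discBundle (F := F) (V := V) R)
    (f.map fun i => (⟨b i, v i⟩ : TotalSpace F V)) (by
      rw [Ultrafilter.coe_map, le_principal_iff]; exact hv)
  rw [Ultrafilter.coe_map] at hw
  have h1 : Tendsto b f (𝓝 w.1) := ((FiberBundle.continuous_proj F V).tendsto w).comp hw
  obtain ⟨y, v₀⟩ := w
  obtain rfl : x = y := tendsto_nhds_unique hb h1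
  exact ⟨v₀, hw⟩

/-- A closed graph argument: the projections are uniformly bounded, and any limit of projections
lies in `E` with complement in `G`, so it is the projection of the limit. -/
lemma isContinuousSplitting_of_isClosed [IsContinuousRiemannianBundle F V] [CompactSpace B]
    [T2Space B] [FiniteDimensional ℝ F] (hc : ∀ x ∈ S, IsCompl (E x) (G x))
    (hE : IsClosed {w : TotalSpace F V | w.1 ∈ S ∧ w.2 ∈ E w.1})
    (hG : IsClosed {w : TotalSpace F V | w.1 ∈ S ∧ w.2 ∈ G w.1}) :
    IsContinuousSplitting F S E G := by
  -- Otherwise there are unit vectors `u ∈ E` and vectors `v ∈ G` with `u + v` tending to 0; a limit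
  -- of the `u` is a unit vector of `E ∩ G`.
  have hbound : ∃ C : ℝ, ∀ x ∈ S, ∀ u ∈ E x, ∀ v ∈ G x, ‖u‖ ≤ C * ‖u + v‖ := by
    by_contra! hcon
    have hcon' : ∀ k : ℕ, ∃ w : TotalSpace F V, ∃ z : V w.1, w.1 ∈ S ∧ w.2 ∈ E w.1 ∧
        z - w.2 ∈ G w.1 ∧ ‖w.2‖ = 1 ∧ ‖z‖ ≤ 1 / (k + 1) := by
      intro k
      obtain ⟨x, hx, u, hu, v, hv, h⟩ := hcon (k + 1)
      have hu0 : 0 < ‖u‖ := lt_of_le_of_lt (by positivity) h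
      refine ⟨⟨x, ‖u‖⁻¹ • u⟩, ‖u‖⁻¹ • (u + v), hx, Submodule.smul_mem _ _ hu, ?_, ?_, ?_⟩
      · simpa using Submodule.smul_mem _ _ hv
      · rw [norm_smul, norm_inv, norm_norm, inv_mul_cancel₀ hu0.ne']
      · rw [norm_smul, norm_inv, norm_norm, inv_mul_eq_div, div_le_div_iff₀ hu0 (by positivity)]
        linarith
    choose w z hwS hwE hzG hw1 hz1 using hcon'
    set f : Ultrafilter ℕ := Ultrafilter.of atTop
    have hf : (f : Filter ℕ) ≤ atTop := Ultrafilter.of_le atTop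
    obtain ⟨x, -, hx⟩ := isCompact_iff_ultrafilter_le_nhds.1 (isCompact_univ (X := B))
      (f.map fun k => (w k).1) (by simp)
    replace hx : Tendsto (fun k => (w k).1) f (𝓝 x) := hx
    obtain ⟨u, hu⟩ := exists_tendsto_of_norm_le (F := F) (v := fun k => (w k).2) hx
      (Eventually.of_forall fun k => (hw1 k).le)
    obtain ⟨y, hy⟩ := exists_tendsto_of_norm_le (F := F) (v := z) (R := 1) hx
      (Eventually.of_forall fun k => (hz1 k).trans (by
        rw [div_le_one (by positivity)]; linarith [Nat.cast_nonneg (α := ℝ) k]))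
    have hu1 : ‖u‖ = 1 := tendsto_nhds_unique (tendsto_fiber_norm hu)
      (by simp only [hw1]; exact tendsto_const_nhds)
    have hy0 : y = 0 := by
      have h1 : Tendsto (fun k => ‖z k‖) f (𝓝 0) :=
        (squeeze_zero (fun k => norm_nonneg _) hz1
          tendsto_one_div_add_atTop_nhds_zero_nat).mono_left hf
      exact norm_eq_zero.1 (tendsto_nhds_unique (tendsto_fiber_norm hy) h1)
    have huE := hE.mem_of_tendsto hu (Eventually.of_forall fun k => ⟨hwS k, hwE k⟩)
    have huG := hG.mem_of_tendsto (tendsto_fiber_sub hy hu)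
      (Eventually.of_forall fun k => ⟨hwS k, hzG k⟩)
    have huG' : u ∈ G x := by
      have := huG.2
      simp only [hy0, zero_sub] at this
      exact (G x).neg_mem_iff.1 this
    have := (Submodule.disjoint_def.1 (hc x huE.1).disjoint) u huE.2 huG'
    rw [this, norm_zero] at hu1
    exact zero_ne_one hu1
  obtain ⟨C, hC⟩ := hbound
  refine ⟨hc, fun w₀ hw₀ => tendsto_iff_ultrafilter _ _ _ |>.2 fun f hf => ?_⟩
  have hf1 : Tendsto id (f : Filter (TotalSpace F V)) (𝓝 w₀) := hf.trans nhdsWithin_le_nhds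
  have hfS : ∀ᶠ w : TotalSpace F V in f, w.1 ∈ S := hf self_mem_nhdsWithin
  have hbd : ∀ᶠ w : TotalSpace F V in f, ‖fiberProj E G w.1 w.2‖ ≤ |C| * (‖w₀.2‖ + 1) := by
    have h1 : ∀ᶠ w : TotalSpace F V in f, ‖w.2‖ < ‖w₀.2‖ + 1 :=
      (tendsto_fiber_norm hf1).eventually_lt_const (by linarith)
    filter_upwards [h1, hfS] with w h1 h2
    have h3 := hC w.1 h2 _ (fiberProj_mem (hc _ h2) w.2) _ (sub_fiberProj_mem (hc _ h2) w.2)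
    rw [add_sub_cancel] at h3
    calc _ ≤ C * ‖w.2‖ := h3
      _ ≤ |C| * ‖w.2‖ := by gcongr; exact le_abs_self C
      _ ≤ _ := by gcongr
  obtain ⟨u, hu⟩ := exists_tendsto_of_norm_le (F := F)
    (v := fun w : TotalSpace F V => fiberProj E G w.1 w.2)
    (((FiberBundle.continuous_proj F V).tendsto w₀).comp hf1) hbd
  have huE := hE.mem_of_tendsto hu (hfS.mono fun w hw => ⟨hw, fiberProj_mem (hc _ hw) _⟩)
  have huG := hG.mem_of_tendsto (tendsto_fiber_sub hf1 hu)
    (hfS.mono fun w hw => ⟨hw, sub_fiberProj_mem (hc _ hw) _⟩)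
  have : fiberProj E G w₀.1 w₀.2 = u := by
    have := fiberProj_add (hc _ hw₀) huE.2 huG.2
    rwa [add_sub_cancel] at this
  show Tendsto _ (f : Filter (TotalSpace F V))
    (𝓝 (TotalSpace.mk w₀.1 (fiberProj E G w₀.1 w₀.2) : TotalSpace F V))
  rw [this]
  exact hu

lemma finrank_fiber_eq [∀ x, FiniteDimensional ℝ (V x)] (x : B) :
    Module.finrank ℝ (V x) = Module.finrank ℝ F :=
  ((trivializationAt F V x).linearEquivAt ℝ x
    (FiberBundle.mem_baseSet_trivializationAt' x)).finrank_eq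

/-- Near a point of `S`, the projections of a constant frame of `E x₀` are independent. -/
lemma IsContinuousSplitting.exists_sections [FiniteDimensional ℝ F]
    [∀ x, FiniteDimensional ℝ (V x)] (h : IsContinuousSplitting F S E G) {x₀ : B} (hx₀ : x₀ ∈ S) :
    ∃ N ∈ 𝓝 x₀, ∃ e : Fin (Module.finrank ℝ (E x₀)) → ∀ x, V x,
      (∀ i, ContinuousOn (fun x => (⟨x, e i x⟩ : TotalSpace F V)) (S ∩ N)) ∧
      ∀ x ∈ S ∩ N, LinearIndependent ℝ (fun i => e i x) ∧ ∀ i, e i x ∈ E x := by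
  set τ := trivializationAt F V x₀
  have hx₀τ : x₀ ∈ τ.baseSet := FiberBundle.mem_baseSet_trivializationAt' x₀
  set bE := Module.finBasis ℝ (E x₀)
  set z : Fin (Module.finrank ℝ (E x₀)) → F := fun i => τ.linearMapAt ℝ x₀ (bE i)
  set e : Fin (Module.finrank ℝ (E x₀)) → ∀ x, V x := fun i x => fiberProj E G x (τ.symm x (z i))
  have hcont : ∀ i, ContinuousOn (fun x => (⟨x, e i x⟩ : TotalSpace F V)) (S ∩ τ.baseSet) := by
    intro i
    have h1 : ContinuousOn (fun x => (⟨x, τ.symm x (z i)⟩ : TotalSpace F V)) τ.baseSet := by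
      have := τ.continuousOn_symm.comp (f := fun x : B => (x, z i))
        (continuous_id.prodMk continuous_const).continuousOn
        (s := τ.baseSet) (fun x hx => ⟨hx, mem_univ _⟩)
      exact this
    exact h.2.comp (h1.mono inter_subset_right) (fun x hx => hx.1)
  have he₀ : ∀ i, e i x₀ = bE i := by
    intro i
    have h1 : τ.symm x₀ (z i) = bE i := τ.symm_linearMapAt hx₀τ _
    have h2 := fiberProj_add (h.1 x₀ hx₀) (bE i).2 (G x₀).zero_mem
    simp only [e, h1]
    rwa [add_zero] at h2
  have hli : ∀ᶠ x in 𝓝[S ∩ τ.baseSet] x₀,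
      LinearIndependent ℝ fun i => τ.linearMapAt ℝ x (e i x) := by
    have hopen := isOpen_setOfPred_linearIndependent (𝕜 := ℝ) (E := F)
      (ι := Fin (Module.finrank ℝ (E x₀)))
    have h0 : LinearIndependent ℝ fun i => τ.linearMapAt ℝ x₀ (e i x₀) := by
      simp only [he₀]
      exact ((bE.linearIndependent.map' (E x₀).subtype (Submodule.ker_subtype _))).map'
        (τ.linearMapAt ℝ x₀) (LinearMap.ker_eq_bot.2 (linearMapAt_injective hx₀τ))
    have ht : Tendsto (fun x => fun i => τ.linearMapAt ℝ x (e i x)) (𝓝[S ∩ τ.baseSet] x₀)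
        (𝓝 fun i => τ.linearMapAt ℝ x₀ (e i x₀)) := by
      refine tendsto_pi_nhds.2 fun i => ?_
      exact (tendsto_totalSpace_iff.1 (hcont i x₀ ⟨hx₀, hx₀τ⟩)).2
    exact ht (hopen.mem_nhds h0)
  obtain ⟨N, hN, hNs⟩ := mem_nhdsWithin_iff_exists_mem_nhds_inter.1 hli
  refine ⟨N ∩ τ.baseSet, inter_mem hN (τ.open_baseSet.mem_nhds hx₀τ), e, fun i =>
    (hcont i).mono (inter_subset_inter_right _ inter_subset_right), fun x hx => ⟨?_, fun i =>
      fiberProj_mem (h.1 x hx.1) _⟩⟩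
  exact LinearIndependent.of_comp (τ.linearMapAt ℝ x) (hNs ⟨hx.2.1, hx.1, hx.2.2⟩)

/-- The projected frames show that neither rank drops near `x₀`. The two ranks have a constant sum,
so both are locally constant, and the frame of `E` spans. -/
lemma IsContinuousSplitting.hasLocalFrames_left [FiniteDimensional ℝ F]
    [∀ x, FiniteDimensional ℝ (V x)] (h : IsContinuousSplitting F S E G) :
    HasLocalFrames F S E := by
  intro x₀ hx₀
  obtain ⟨N₁, hN₁, e, hec, he⟩ := h.exists_sections hx₀
  obtain ⟨N₂, hN₂, f, -, hf⟩ := h.symm.exists_sections hx₀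
  refine ⟨N₁ ∩ N₂, inter_mem hN₁ hN₂, _, e, fun i =>
    (hec i).mono (inter_subset_inter_right _ inter_subset_left), fun x hx => ?_⟩
  obtain ⟨hli, hmem⟩ := he x ⟨hx.1, hx.2.1⟩
  obtain ⟨hli', hmem'⟩ := hf x ⟨hx.1, hx.2.2⟩
  refine ⟨hli, ?_⟩
  have hle : ∀ {k : ℕ} {H : Submodule ℝ (V x)} {g : Fin k → V x}, LinearIndependent ℝ g →
      (∀ i, g i ∈ H) → k ≤ Module.finrank ℝ H := by
    intro k H g hg hgm
    have h2 : LinearIndependent ℝ (fun i => (⟨g i, hgm i⟩ : H)) :=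
      LinearIndependent.of_comp H.subtype hg
    simpa using h2.fintype_card_le_finrank
  have h1 := hle hli hmem
  have h2 := hle hli' hmem'
  have h3 := Submodule.finrank_add_eq_of_isCompl (h.1 x hx.1)
  have h4 := Submodule.finrank_add_eq_of_isCompl (h.1 x₀ hx₀)
  rw [finrank_fiber_eq (F := F)] at h3 h4
  refine Submodule.eq_of_le_of_finrank_le (Submodule.span_le.2 ?_) ?_
  · rintro _ ⟨i, rfl⟩
    exact hmem i
  · rw [finrank_span_eq_card hli, Fintype.card_fin]
    omega

/-! ### Linear flows on a vector bundle. -/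

/-- A continuous flow on the total space of a vector bundle which is linear on fibres. -/
structure LinearFlow (F : Type*) [NormedAddCommGroup F] [NormedSpace ℝ F]
    (V : B → Type*) [TopologicalSpace (TotalSpace F V)] [∀ x, NormedAddCommGroup (V x)]
    [∀ x, InnerProductSpace ℝ (V x)] where
  /-- The flow on the base. -/
  base : ℝ → B → B
  /-- The linear maps between the fibres. -/
  map : ∀ (t : ℝ) (x : B), V x →L[ℝ] V (base t x)
  /-- The flow on the total space. -/
  total : ℝ → TotalSpace F V → TotalSpace F V
  total_eq : ∀ t x v, total t ⟨x, v⟩ = ⟨base t x, map t x v⟩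
  total_zero : ∀ w, total 0 w = w
  total_add : ∀ s t w, total (s + t) w = total s (total t w)
  continuous_total : Continuous fun p : ℝ × TotalSpace F V => total p.1 p.2

namespace LinearFlow

variable (Ψ : LinearFlow F V)

lemma total_fst (t : ℝ) (w : TotalSpace F V) : (Ψ.total t w).1 = Ψ.base t w.1 := by
  obtain ⟨x, v⟩ := w; rw [Ψ.total_eq]

/-- The time-reversed flow. -/
def reverse : LinearFlow F V where
  base t := Ψ.base (-t)
  map t := Ψ.map (-t)
  total t := Ψ.total (-t)
  total_eq t := Ψ.total_eq (-t)
  total_zero w := by rw [neg_zero, Ψ.total_zero]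
  total_add s t w := by rw [neg_add, Ψ.total_add]
  continuous_total := Ψ.continuous_total.comp (continuous_fst.neg.prodMk continuous_snd)

lemma total_neg_total (t : ℝ) (w : TotalSpace F V) : Ψ.total (-t) (Ψ.total t w) = w := by
  rw [← Ψ.total_add, neg_add_cancel, Ψ.total_zero]

lemma total_total_neg (t : ℝ) (w : TotalSpace F V) : Ψ.total t (Ψ.total (-t) w) = w := by
  rw [← Ψ.total_add, add_neg_cancel, Ψ.total_zero]

lemma base_zero (x : B) : Ψ.base 0 x = x := by
  rw [← Ψ.total_fst 0 ⟨x, 0⟩, Ψ.total_zero]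

lemma base_add (s t : ℝ) (x : B) : Ψ.base (s + t) x = Ψ.base s (Ψ.base t x) := by
  rw [← Ψ.total_fst (s + t) ⟨x, 0⟩, Ψ.total_add, Ψ.total_fst, Ψ.total_fst]

lemma base_neg_base (t : ℝ) (x : B) : Ψ.base (-t) (Ψ.base t x) = x := by
  rw [← Ψ.base_add, neg_add_cancel, Ψ.base_zero]

lemma base_base_neg (t : ℝ) (x : B) : Ψ.base t (Ψ.base (-t) x) = x := by
  rw [← Ψ.base_add, add_neg_cancel, Ψ.base_zero]

lemma continuous_base : Continuous fun p : ℝ × B => Ψ.base p.1 p.2 := by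
  have h := (FiberBundle.continuous_proj F V).comp (Ψ.continuous_total.comp
    (continuous_fst.prodMk
      ((Bundle.Trivialization.continuous_zeroSection ℝ (F := F) (E := V)).comp continuous_snd) :
      Continuous fun p : ℝ × B => (p.1, zeroSection F V p.2)))
  refine h.congr fun p => ?_
  exact Ψ.total_fst _ _

lemma map_injective (t : ℝ) (x : B) : Function.Injective (Ψ.map t x) := by
  refine (injective_iff_map_eq_zero _).2 fun v hv => ?_
  have h := Ψ.total_neg_total t ⟨x, v⟩
  rw [Ψ.total_eq t x v, hv, Ψ.total_eq, map_zero] at h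
  have h2 := congrArg (fun w : TotalSpace F V => ‖w.2‖) h
  exact norm_eq_zero.1 (by simpa using h2.symm)

/-- The fibres over `x` and over `Ψ.base (-t) (Ψ.base t x)` are different types, so the inverse is
expressed by an equality in the total space. -/
lemma exists_map_eq (t : ℝ) (x : B) (v : V (Ψ.base t x)) :
    ∃ u : V x, Ψ.map t x u = v ∧ Ψ.total (-t) ⟨Ψ.base t x, v⟩ = ⟨x, u⟩ := by
  have h := Ψ.total_total_neg t ⟨Ψ.base t x, v⟩
  have h1 : (Ψ.total (-t) ⟨Ψ.base t x, v⟩).1 = x := by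
    rw [Ψ.total_fst, Ψ.base_neg_base]
  generalize hw : Ψ.total (-t) ⟨Ψ.base t x, v⟩ = w at h h1
  obtain ⟨y, u⟩ := w
  obtain rfl : y = x := h1
  refine ⟨u, ?_, rfl⟩
  rw [Ψ.total_eq] at h
  exact eq_of_heq (TotalSpace.mk.inj h).2

lemma total_ne_zero {t : ℝ} {w : TotalSpace F V} (hw : w.2 ≠ 0) : (Ψ.total t w).2 ≠ 0 := by
  obtain ⟨x, v⟩ := w
  rw [Ψ.total_eq]
  exact fun h => hw ((map_eq_zero_iff _ (Ψ.map_injective t x)).1 h)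

/-- The linear isomorphism between fibres given by the flow. -/
def mapEquiv (t : ℝ) (x : B) : V x ≃ₗ[ℝ] V (Ψ.base t x) :=
  LinearEquiv.ofBijective (Ψ.map t x).toLinearMap
    ⟨Ψ.map_injective t x, fun v => (Ψ.exists_map_eq t x v).imp fun _ h => h.1⟩

lemma continuous_total_const (t : ℝ) : Continuous (Ψ.total t) :=
  Ψ.continuous_total.comp (continuous_const.prodMk continuous_id)

/-- The family of subspaces `E x`, `x ∈ S`, is invariant. -/
def IsInvariantFamily (Ψ : LinearFlow F V) (S : Set B) (E : ∀ x, Submodule ℝ (V x)) : Prop :=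
  ∀ t, ∀ w : TotalSpace F V, w.1 ∈ S → w.2 ∈ E w.1 → (Ψ.total t w).2 ∈ E (Ψ.total t w).1

/-- `S` is invariant under the flow on the base. -/
def IsInvariantSet (Ψ : LinearFlow F V) (S : Set B) : Prop := ∀ t, ∀ x ∈ S, Ψ.base t x ∈ S

end LinearFlow

/-! ### Slope functions and the angle between the two subbundles. -/

/-- The slope `‖v‖ / (‖u‖ + ‖v‖)` of `u + v`, `u ∈ E x`, `v ∈ G x`, over a closed set extends to a
function which is continuous off the zero section and homogeneous. -/
lemma IsContinuousSplitting.exists_slope [IsContinuousRiemannianBundle F V] [CompactSpace B]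
    [T2Space B] [FiniteDimensional ℝ F] (h : IsContinuousSplitting F S E G) (hS : IsClosed S) :
    ∃ Θ : TotalSpace F V → ℝ, (∀ w : TotalSpace F V, w.2 ≠ 0 → ContinuousAt Θ w) ∧
      (∀ x (v : V x) (c : ℝ), 0 < c → Θ ⟨x, c • v⟩ = Θ ⟨x, v⟩) ∧
      ∀ x ∈ S, ∀ u ∈ E x, ∀ v ∈ G x, u + v ≠ 0 → Θ ⟨x, u + v⟩ = ‖v‖ / (‖u‖ + ‖v‖) := by
  have : T2Space (TotalSpace F V) := t2Space_totalSpace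
  have hsph : IsCompact {w : TotalSpace F V | ‖w.2‖ = 1} :=
    (isCompact_discBundle 1).of_isClosed_subset
      (isClosed_eq continuous_norm_totalSpace continuous_const) fun w hw => le_of_eq hw
  have hcs : CompactSpace {w : TotalSpace F V | ‖w.2‖ = 1} := isCompact_iff_compactSpace.1 hsph
  set σ : TotalSpace F V → ℝ := fun w => ‖w.2 - fiberProj E G w.1 w.2‖ /
    (‖fiberProj E G w.1 w.2‖ + ‖w.2 - fiberProj E G w.1 w.2‖)
  have hσ : ContinuousOn σ {w | w.1 ∈ S ∧ w.2 ≠ 0} := by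
    intro w hw
    have h1 : Tendsto (fun z : TotalSpace F V => ‖fiberProj E G z.1 z.2‖)
        (𝓝[{w | w.1 ∈ S ∧ w.2 ≠ 0}] w) (𝓝 ‖fiberProj E G w.1 w.2‖) :=
      tendsto_fiber_norm ((h.2 w hw.1).mono fun z hz => hz.1)
    have h2 : Tendsto (fun z : TotalSpace F V => ‖z.2 - fiberProj E G z.1 z.2‖)
        (𝓝[{w | w.1 ∈ S ∧ w.2 ≠ 0}] w) (𝓝 ‖w.2 - fiberProj E G w.1 w.2‖) :=
      tendsto_fiber_norm (tendsto_fiber_sub (tendsto_id.mono_left nhdsWithin_le_nhds)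
        ((h.2 w hw.1).mono fun z hz => hz.1))
    refine h2.div (h1.add h2) ?_
    have h3 := norm_add_le (fiberProj E G w.1 w.2) (w.2 - fiberProj E G w.1 w.2)
    rw [add_sub_cancel] at h3
    exact ((norm_pos_iff.2 hw.2).trans_le h3).ne'
  set A : Set {w : TotalSpace F V | ‖w.2‖ = 1} := {w | w.1.1 ∈ S}
  have hA : IsClosed A :=
    hS.preimage ((FiberBundle.continuous_proj F V).comp continuous_subtype_val)
  have hσA : Continuous fun w : A => σ w.1.1 := by
    refine hσ.comp_continuous (continuous_subtype_val.comp continuous_subtype_val) fun w => ?_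
    refine ⟨w.2, norm_ne_zero_iff.1 ?_⟩
    have := w.1.2
    rw [mem_ofPred_eq] at this
    simp [this]
  -- Tietze extension from the part over `S` to the whole unit sphere bundle. The extension may
  -- leave `[0, 1]`, which is harmless: only comparisons of the slope with thresholds are used.
  obtain ⟨g, hg⟩ := ContinuousMap.exists_restrict_eq hA ⟨_, hσA⟩
  have hunit : ∀ w : TotalSpace F V, w.2 ≠ 0 → ‖(‖w.2‖⁻¹ • w.2)‖ = 1 := fun w hw => by
    rw [norm_smul, norm_inv, norm_norm, inv_mul_cancel₀ (norm_ne_zero_iff.2 hw)]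
  classical
  set N : {w : TotalSpace F V | w.2 ≠ 0} → {w : TotalSpace F V | ‖w.2‖ = 1} :=
    fun w => ⟨⟨w.1.1, ‖w.1.2‖⁻¹ • w.1.2⟩, hunit w.1 w.2⟩
  have hN : Continuous N := by
    refine Continuous.subtype_mk ?_ _
    rw [continuous_iff_continuousAt]
    intro w
    exact tendsto_fiber_smul
      (((continuous_norm_totalSpace.comp continuous_subtype_val).tendsto w).inv₀
        (norm_ne_zero_iff.2 w.2)) (continuous_subtype_val.tendsto w)
  refine ⟨fun w => if hw : w.2 ≠ 0 then g (N ⟨w, hw⟩) else 0, fun w hw => ?_, fun x v c hc => ?_,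
    fun x hx u hu v hv huv => ?_⟩
  · have hopen : IsOpen {w : TotalSpace F V | w.2 ≠ 0} := by
      have : {w : TotalSpace F V | w.2 ≠ 0} = {w : TotalSpace F V | ‖w.2‖ ≠ 0} := by
        ext w; simp
      rw [this]
      exact isOpen_ne_fun continuous_norm_totalSpace continuous_const
    have hon : ContinuousOn (fun w : TotalSpace F V => if hw : w.2 ≠ 0 then g (N ⟨w, hw⟩) else 0)
        {w | w.2 ≠ 0} := by
      rw [continuousOn_iff_continuous_domRestrict]
      refine (g.continuous.comp hN).congr fun w => ?_
      have hw2 : w.1.2 ≠ 0 := w.2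
      simp only [domRestrict_apply, Function.comp]
      rw [dif_pos hw2]
    exact hon.continuousAt (hopen.mem_nhds hw)
  · by_cases hv : v = 0
    · simp [hv]
    · have hcv : c • v ≠ 0 := smul_ne_zero hc.ne' hv
      simp only [ne_eq, hcv, hv, not_false_eq_true, dif_pos]
      congr 1
      apply Subtype.ext
      simp only [N]
      rw [norm_smul, Real.norm_of_nonneg hc.le, smul_smul, mul_inv, mul_assoc,
        mul_comm _ c, ← mul_assoc, inv_mul_cancel₀ hc.ne', one_mul]
  · simp only [ne_eq, huv, not_false_eq_true, dif_pos]
    have h1 : N ⟨⟨x, u + v⟩, huv⟩ ∈ A := hx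
    have h2 := congrArg (fun k => k ⟨_, h1⟩) hg
    have h3 : g (N ⟨⟨x, u + v⟩, huv⟩) = σ (N ⟨⟨x, u + v⟩, huv⟩).1 := h2
    rw [h3]
    simp only [σ, N]
    set c := ‖u + v‖⁻¹
    have hc : 0 < c := inv_pos.2 (norm_pos_iff.2 huv)
    rw [smul_add, fiberProj_add (h.1 x hx) (Submodule.smul_mem _ _ hu)
      (Submodule.smul_mem _ _ hv), add_sub_cancel_left, norm_smul, norm_smul,
      Real.norm_of_nonneg hc.le, ← mul_add, mul_div_mul_left _ _ hc.ne']

/-- The unit sphere bundle. -/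
lemma isCompact_sphereBundle [IsContinuousRiemannianBundle F V] [CompactSpace B] [T2Space B]
    [FiniteDimensional ℝ F] : IsCompact {w : TotalSpace F V | ‖w.2‖ = 1} :=
  (isCompact_discBundle 1).of_isClosed_subset
    (isClosed_eq continuous_norm_totalSpace continuous_const) fun _ hw => le_of_eq hw

lemma IsContinuousSplitting.exists_norm_le [IsContinuousRiemannianBundle F V] [CompactSpace B]
    [T2Space B] [FiniteDimensional ℝ F] (h : IsContinuousSplitting F S E G) (hS : IsClosed S) :
    ∃ κ > (0 : ℝ), ∀ x ∈ S, ∀ u ∈ E x, ∀ v ∈ G x, ‖u‖ ≤ κ * ‖u + v‖ := by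
  have hK : IsCompact ({w : TotalSpace F V | ‖w.2‖ = 1} ∩ {w | w.1 ∈ S}) :=
    isCompact_sphereBundle.inter_right (hS.preimage (FiberBundle.continuous_proj F V))
  obtain ⟨C, hC⟩ := hK.exists_bound_of_continuousOn
    (continuous_norm_totalSpace.comp_continuousOn (h.2.mono inter_subset_right))
  refine ⟨|C| + 1, by positivity, fun x hx u hu v hv => ?_⟩
  rcases eq_or_ne (u + v) 0 with h0 | h0
  · have h1 := fiberProj_add (h.1 x hx) hu hv
    have h2 := fiberProj_add (h.1 x hx) (E x).zero_mem (G x).zero_mem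
    rw [h0] at h1
    rw [add_zero, h1] at h2
    rw [h2, norm_zero]; positivity
  · have hpos : 0 < ‖u + v‖ := norm_pos_iff.2 h0
    have h1 := hC ⟨x, ‖u + v‖⁻¹ • (u + v)⟩ ⟨by
      rw [mem_ofPred_eq, norm_smul, norm_inv, norm_norm, inv_mul_cancel₀ hpos.ne'], hx⟩
    simp only [Function.comp, smul_add] at h1
    rw [fiberProj_add (h.1 x hx) (Submodule.smul_mem _ _ hu) (Submodule.smul_mem _ _ hv),
      norm_smul, norm_inv, norm_norm, norm_mul, norm_inv, norm_norm, norm_norm,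
      inv_mul_le_iff₀ hpos] at h1
    nlinarith [le_abs_self C]

lemma exists_add_eq_of_isCompl {x : B} (h : IsCompl (E x) (G x)) (w : V x) :
    ∃ u ∈ E x, ∃ v ∈ G x, u + v = w :=
  ⟨_, fiberProj_mem h w, _, sub_fiberProj_mem h w, add_sub_cancel _ _⟩

/-- A slope function for the splitting `E ⊕ G` over `S`. -/
structure IsSlope (S : Set B) (E G : ∀ x, Submodule ℝ (V x)) (Θ : TotalSpace F V → ℝ) : Prop where
  continuousAt : ∀ w : TotalSpace F V, w.2 ≠ 0 → ContinuousAt Θ w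
  smul : ∀ x (v : V x) (c : ℝ), 0 < c → Θ ⟨x, c • v⟩ = Θ ⟨x, v⟩
  add : ∀ x ∈ S, ∀ u ∈ E x, ∀ v ∈ G x, u + v ≠ 0 → Θ ⟨x, u + v⟩ = ‖v‖ / (‖u‖ + ‖v‖)

lemma norm_add_norm_pos {x : B} {u v : V x} (h : u + v ≠ 0) : 0 < ‖u‖ + ‖v‖ :=
  (norm_pos_iff.2 h).trans_le (norm_add_le _ _)

/-- With the reversed flow, this lets every statement about `E` be applied to `G`. -/
lemma IsSlope.reverse {Θ : TotalSpace F V → ℝ} (h : IsSlope S E G Θ) :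
    IsSlope S G E (fun w => 1 - Θ w) := by
  refine ⟨fun w hw => continuousAt_const.sub (h.continuousAt w hw), fun x v c hc => ?_,
    fun x hx u hu v hv huv => ?_⟩
  · simp only [h.smul x v c hc]
  · have hpos := norm_add_norm_pos huv
    rw [add_comm] at huv
    simp only [add_comm u v]
    rw [h.add x hx v hv u hu huv, one_sub_div (by linarith), add_sub_cancel_right]
    rw [add_comm]

namespace LinearFlow
variable {Ψ : LinearFlow F V}

lemma total_smul (t c : ℝ) (w : TotalSpace F V) :
    Ψ.total t ⟨w.1, c • w.2⟩ = ⟨(Ψ.total t w).1, c • (Ψ.total t w).2⟩ := by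
  obtain ⟨x, v⟩ := w
  rw [Ψ.total_eq, Ψ.total_eq, map_smul]

lemma norm_total_smul (t c : ℝ) (w : TotalSpace F V) :
    ‖(Ψ.total t ⟨w.1, c • w.2⟩).2‖ = |c| * ‖(Ψ.total t w).2‖ := by
  rw [total_smul, norm_smul, Real.norm_eq_abs]

lemma total_add_fiber (t : ℝ) (x : B) (u v : V x) :
    Ψ.total t ⟨x, u + v⟩ = ⟨Ψ.base t x, Ψ.map t x u + Ψ.map t x v⟩ := by
  rw [Ψ.total_eq, map_add]

lemma IsInvariantFamily.map_mem (h : Ψ.IsInvariantFamily S E) (t : ℝ) {x : B} (hx : x ∈ S) {u : V x}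
    (hu : u ∈ E x) : Ψ.map t x u ∈ E (Ψ.base t x) := by
  have := h t ⟨x, u⟩ hx hu
  rwa [Ψ.total_eq] at this

lemma IsInvariantFamily.reverse (h : Ψ.IsInvariantFamily S E) : Ψ.reverse.IsInvariantFamily S E :=
  fun t => h (-t)

lemma IsInvariantSet.reverse (h : Ψ.IsInvariantSet S) : Ψ.reverse.IsInvariantSet S :=
  fun t => h (-t)

/-- `G` dominates `E` over `S`, with constants `K` and `lam`. -/
def IsDominatedBy (Ψ : LinearFlow F V) (S : Set B) (E G : ∀ x, Submodule ℝ (V x)) (K lam : ℝ) :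
    Prop :=
  ∀ t, 0 ≤ t → ∀ x ∈ S, ∀ u ∈ E x, ∀ v ∈ G x,
    ‖Ψ.map t x u‖ * ‖v‖ ≤ K * Real.exp (-lam * t) * (‖Ψ.map t x v‖ * ‖u‖)

lemma norm_map_map_neg (t : ℝ) (x : B) (u : V x) :
    ‖Ψ.map t (Ψ.base (-t) x) (Ψ.map (-t) x u)‖ = ‖u‖ := by
  have h := Ψ.total_total_neg t ⟨x, u⟩
  rw [Ψ.total_eq (-t) x u, Ψ.total_eq] at h
  exact congrArg (fun w : TotalSpace F V => ‖w.2‖) h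

lemma IsDominatedBy.reverse {K lam : ℝ} (h : Ψ.IsDominatedBy S E G K lam)
    (hS : Ψ.IsInvariantSet S) (hE : Ψ.IsInvariantFamily S E) (hG : Ψ.IsInvariantFamily S G) :
    Ψ.reverse.IsDominatedBy S G E K lam := by
  intro t ht x hx v hv u hu
  have h1 := h t ht _ (hS (-t) x hx) _ (hE.map_mem (-t) hx hu) _ (hG.map_mem (-t) hx hv)
  rw [norm_map_map_neg, norm_map_map_neg] at h1
  rw [mul_comm, mul_comm ‖_‖ ‖v‖]
  exact h1

/-- The forward invariance and domination properties over `U` of the cones defined by `Θ`. -/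
structure IsConeNhd (Ψ : LinearFlow F V) (Θ : TotalSpace F V → ℝ) (ε T : ℝ) (U : Set B) : Prop where
  back : ∀ w : TotalSpace F V, w.1 ∈ U → w.2 ≠ 0 → Θ w ≤ 1 / 2 → Θ (Ψ.total (-T) w) ≤ ε
  short : ∀ s ∈ Icc 0 T, ∀ w : TotalSpace F V, w.1 ∈ U → w.2 ≠ 0 → Θ w ≤ ε →
    Θ (Ψ.total (-s) w) ≤ 1 / 2
  comp : ∀ a b : TotalSpace F V, a.1 = b.1 → a.1 ∈ U → a.2 ≠ 0 → b.2 ≠ 0 → Θ a ≤ 1 / 2 →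
    Θ (Ψ.total T a) ≤ 1 / 2 → 1 / 2 ≤ Θ b →
      ‖(Ψ.total T a).2‖ * ‖b.2‖ ≤ 1 / 2 * (‖(Ψ.total T b).2‖ * ‖a.2‖)

lemma IsConeNhd.mono {Θ : TotalSpace F V → ℝ} {ε T : ℝ} {U U' : Set B}
    (h : Ψ.IsConeNhd Θ ε T U) (hU : U' ⊆ U) : Ψ.IsConeNhd Θ ε T U' :=
  ⟨fun w hw => h.back w (hU hw), fun s hs w hw => h.short s hs w (hU hw),
    fun a b hab ha => h.comp a b hab (hU ha)⟩

lemma norm_map_pos (t : ℝ) {x : B} {u : V x} (hu : 0 < ‖u‖) : 0 < ‖Ψ.map t x u‖ :=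
  norm_pos_iff.2 fun h => (norm_pos_iff.1 hu) ((map_eq_zero_iff _ (Ψ.map_injective t x)).1 h)

/-! ### Cone estimates over the invariant set itself. -/

section estimates
variable {Θ : TotalSpace F V → ℝ} {K lam T : ℝ}

/-- The slope along an orbit over `S`. -/
lemma slope_total (hΘ : IsSlope S E G Θ) (hS : Ψ.IsInvariantSet S)
    (hE : Ψ.IsInvariantFamily S E) (hG : Ψ.IsInvariantFamily S G) (t : ℝ) {x : B} (hx : x ∈ S)
    {u v : V x} (hu : u ∈ E x) (hv : v ∈ G x) (huv : u + v ≠ 0) :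
    Θ (Ψ.total t ⟨x, u + v⟩) = ‖Ψ.map t x v‖ / (‖Ψ.map t x u‖ + ‖Ψ.map t x v‖) ∧
      0 < ‖Ψ.map t x u‖ + ‖Ψ.map t x v‖ := by
  have h0 : Ψ.map t x u + Ψ.map t x v ≠ 0 := by
    rw [← map_add]
    exact fun h => huv ((map_eq_zero_iff _ (Ψ.map_injective t x)).1 h)
  rw [total_add_fiber, hΘ.add _ (hS t x hx) _ (hE.map_mem t hx hu) _ (hG.map_mem t hx hv) h0]
  exact ⟨rfl, norm_add_norm_pos h0⟩

/-- Slope at most `c` means `(1 - c)‖v‖ ≤ c‖u‖`. Going back by time `t` shrinks `‖v‖ / ‖u‖` by `K *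
exp (-lam * t)`, so the new ratio is below `c'`, and the slope never exceeds the ratio. -/
lemma slope_back (hΘ : IsSlope S E G Θ) (hS : Ψ.IsInvariantSet S)
    (hE : Ψ.IsInvariantFamily S E) (hG : Ψ.IsInvariantFamily S G)
    (hdom : Ψ.IsDominatedBy S E G K lam) {t : ℝ} (ht : 0 ≤ t) {x : B} (hx : x ∈ S)
    {u v : V x} (hu : u ∈ E x) (hv : v ∈ G x) (huv : u + v ≠ 0) {c c' : ℝ} (hc : c < 1)
    (h : Θ ⟨x, u + v⟩ ≤ c) (hc' : K * Real.exp (-lam * t) * c < c' * (1 - c)) (hcc : 0 ≤ c')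
    (hk : 0 ≤ K) : Θ (Ψ.total (-t) ⟨x, u + v⟩) < c' := by
  have hd := hdom.reverse hS hE hG t ht x hx v hv u hu
  change ‖Ψ.map (-t) x v‖ * ‖u‖ ≤ _ * (‖Ψ.map (-t) x u‖ * ‖v‖) at hd
  obtain ⟨h1, h2⟩ := slope_total hΘ hS hE hG (-t) hx hu hv huv
  rw [h1, div_lt_iff₀ h2]
  have h3 := norm_add_norm_pos huv
  rw [hΘ.add x hx u hu v hv huv, div_le_iff₀ h3] at h
  have hu0 : 0 < ‖u‖ := by
    rcases (norm_nonneg u).eq_or_lt with h0 | h0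
    · rw [← h0] at h h3; nlinarith [norm_nonneg v]
    · exact h0
  have hu1 := norm_map_pos (Ψ := Ψ) (-t) hu0
  set k := K * Real.exp (-lam * t)
  have hk0 : 0 ≤ k := by positivity
  set p := ‖Ψ.map (-t) x u‖
  set q := ‖Ψ.map (-t) x v‖
  have h4 : (1 - c) * ‖v‖ ≤ c * ‖u‖ := by linarith
  have h5 : (1 - c) * q * ‖u‖ ≤ k * c * p * ‖u‖ := by
    calc (1 - c) * q * ‖u‖ = (1 - c) * (q * ‖u‖) := by ring
      _ ≤ (1 - c) * (k * (p * ‖v‖)) := by gcongr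
      _ = k * p * ((1 - c) * ‖v‖) := by ring
      _ ≤ k * p * (c * ‖u‖) := by gcongr
      _ = _ := by ring
  have h6 := le_of_mul_le_mul_right h5 hu0
  have h7 : (1 - c) * q < (1 - c) * (c' * p) := by nlinarith
  have h8 := lt_of_mul_lt_mul_left h7 (by linarith)
  have hq : 0 ≤ c' * q := mul_nonneg hcc (norm_nonneg _)
  linarith

/-- For `a = u + v` and `b = u' + v'`, the slope conditions give that the image of `a` is at most
twice that of `u`, and `‖b‖ ≤ 2‖v'‖`. Domination compares `u` with `v'`, and the angle constant `κ`
is paid twice to return to `a` and `b`. -/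
lemma comp_on {κ : ℝ} (hΘ : IsSlope S E G Θ) (hS : Ψ.IsInvariantSet S)
    (hE : Ψ.IsInvariantFamily S E) (hG : Ψ.IsInvariantFamily S G)
    (hdom : Ψ.IsDominatedBy S E G K lam) (hT : 0 ≤ T) (hK : 0 ≤ K)
    (hκE : ∀ x ∈ S, ∀ u ∈ E x, ∀ v ∈ G x, ‖u‖ ≤ κ * ‖u + v‖)
    (hκG : ∀ x ∈ S, ∀ u ∈ G x, ∀ v ∈ E x, ‖u‖ ≤ κ * ‖u + v‖)
    (hκT : 4 * κ ^ 2 * (K * Real.exp (-lam * T)) < 1 / 2) (hc : ∀ x ∈ S, IsCompl (E x) (G x))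
    {x : B} (hx : x ∈ S) {a b : V x} (ha0 : a ≠ 0) (hb0 : b ≠ 0) (ha : Θ ⟨x, a⟩ ≤ 1 / 2)
    (haT : Θ (Ψ.total T ⟨x, a⟩) ≤ 1 / 2) (hb : 1 / 2 ≤ Θ ⟨x, b⟩) :
    ‖Ψ.map T x a‖ * ‖b‖ < 1 / 2 * (‖Ψ.map T x b‖ * ‖a‖) := by
  obtain ⟨u, hu, v, hv, rfl⟩ := exists_add_eq_of_isCompl (hc x hx) a
  obtain ⟨u', hu', v', hv', rfl⟩ := exists_add_eq_of_isCompl (hc x hx) b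
  obtain ⟨h1, h2⟩ := slope_total hΘ hS hE hG T hx hu hv ha0
  have h3 := norm_add_norm_pos hb0
  rw [hΘ.add x hx u' hu' v' hv' hb0, le_div_iff₀ h3] at hb
  rw [h1, div_le_iff₀ h2] at haT
  have h4 : ‖Ψ.map T x (u + v)‖ ≤ 2 * ‖Ψ.map T x u‖ := by
    rw [map_add]; linarith [norm_add_le (Ψ.map T x u) (Ψ.map T x v)]
  have h5 : ‖u' + v'‖ ≤ 2 * ‖v'‖ := by linarith [norm_add_le u' v']
  have h6 := hdom T hT x hx u hu v' hv'
  have h7 : ‖Ψ.map T x v'‖ ≤ κ * ‖Ψ.map T x (u' + v')‖ := by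
    rw [map_add, add_comm]
    exact hκG _ (hS T x hx) _ (hG.map_mem T hx hv') _ (hE.map_mem T hx hu')
  have h8 := hκE x hx u hu v hv
  set k := K * Real.exp (-lam * T)
  have hk0 : 0 ≤ k := by positivity
  have hpa : 0 < ‖u + v‖ := norm_pos_iff.2 ha0
  have hpb : 0 < ‖Ψ.map T x (u' + v')‖ := norm_map_pos T (norm_pos_iff.2 hb0)
  calc ‖Ψ.map T x (u + v)‖ * ‖u' + v'‖ ≤ (2 * ‖Ψ.map T x u‖) * (2 * ‖v'‖) := by gcongr
    _ = 4 * (‖Ψ.map T x u‖ * ‖v'‖) := by ring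
    _ ≤ 4 * (k * (‖Ψ.map T x v'‖ * ‖u‖)) := by gcongr
    _ ≤ 4 * (k * ((κ * ‖Ψ.map T x (u' + v')‖) * (κ * ‖u + v‖))) := by
      gcongr
      exact (norm_nonneg _).trans h7
    _ = (4 * κ ^ 2 * k) * (‖Ψ.map T x (u' + v')‖ * ‖u + v‖) := by ring
    _ < _ := by gcongr

end estimates

/-! ### Persistence of the cone estimates near the invariant set. -/

section exists_cone
variable {Θ : TotalSpace F V → ℝ} {K lam T : ℝ}

/-- The cone properties hold over a neighbourhood of an invariant set with a dominated splitting. -/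
lemma exists_isConeNhd [IsContinuousRiemannianBundle F V] [CompactSpace B] [T2Space B]
    [FiniteDimensional ℝ F] {κ : ℝ} (hΘ : IsSlope S E G Θ) (hS : Ψ.IsInvariantSet S)
    (hE : Ψ.IsInvariantFamily S E) (hG : Ψ.IsInvariantFamily S G)
    (hdom : Ψ.IsDominatedBy S E G K lam) (hT : 0 ≤ T) (hK : 1 ≤ K) (hlam : 0 ≤ lam)
    (hκE : ∀ x ∈ S, ∀ u ∈ E x, ∀ v ∈ G x, ‖u‖ ≤ κ * ‖u + v‖)
    (hκG : ∀ x ∈ S, ∀ u ∈ G x, ∀ v ∈ E x, ‖u‖ ≤ κ * ‖u + v‖)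
    (hκT : 4 * κ ^ 2 * (K * Real.exp (-lam * T)) < 1 / 2)
    (hεT : K * Real.exp (-lam * T) < 1 / (4 * K)) (hc : ∀ x ∈ S, IsCompl (E x) (G x)) :
    ∃ U ∈ 𝓝ˢ S, Ψ.IsConeNhd Θ (1 / (4 * K)) T U := by
  set ε := 1 / (4 * K) with hε
  have hε0 : 0 < ε := by positivity
  have hε4 : ε ≤ 1 / 4 := by
    rw [hε, div_le_div_iff₀ (by positivity) (by norm_num)]; linarith
  -- This choice of `ε` handles short times: a loss by a factor up to `K` takes slope `ε` to a slope
  -- still below `1/2`.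
  have hKε : K * ε = 1 / 4 := by rw [hε]; field_simp
  have hne : ∀ {w : TotalSpace F V}, ‖w.2‖ = 1 → w.2 ≠ 0 := fun h =>
    norm_ne_zero_iff.1 (by rw [h]; exact one_ne_zero)
  have hcont : ∀ t, ∀ {w : TotalSpace F V}, w.2 ≠ 0 → ContinuousAt (fun w => Θ (Ψ.total t w)) w :=
    fun t w hw => (hΘ.continuousAt _ (Ψ.total_ne_zero hw)).comp
      (f := Ψ.total t) (Ψ.continuous_total_const t).continuousAt
  have hproj := FiberBundle.continuous_proj F V
  -- backward contraction of the cone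
  obtain ⟨U₁, hU₁, h1⟩ := exists_nhdsSet_forall_of_isCompact
    (isCompact_sphereBundle (F := F) (V := V)) hproj (Λ := S)
    (Q := fun w => Θ w ≤ 1 / 2 → Θ (Ψ.total (-T) w) ≤ ε) (by
      intro w hw hwS
      refine Filter.Eventually.filter_mono nhdsWithin_le_nhds ?_
      -- If the premise fails at `w`, it fails nearby; if it holds, the conclusion is strict at `w`
      -- and persists. The two later applications use the same dichotomy.
      by_cases hle : Θ w ≤ 1 / 2
      · have : Θ (Ψ.total (-T) w) < ε := by
          obtain ⟨x, z⟩ := w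
          obtain ⟨u, hu, v, hv, rfl⟩ :=
            exists_add_eq_of_isCompl (hc x hwS) z
          exact slope_back hΘ hS hE hG hdom hT hwS hu hv (hne hw) (by norm_num) hle (by linarith)
            hε0.le (by linarith)
        filter_upwards [(hcont (-T) (hne hw)).eventually_lt continuousAt_const this] with z hz _
        exact hz.le
      · filter_upwards [continuousAt_const.eventually_lt (hΘ.continuousAt w (hne hw))
          (not_le.1 hle)] with z hz hz'
        exact absurd hz' (not_le.2 hz))
  -- short backward times
  obtain ⟨U₂, hU₂, h2⟩ := exists_nhdsSet_forall_of_isCompact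
    ((isCompact_Icc (a := (0 : ℝ)) (b := T)).prod (isCompact_sphereBundle (F := F) (V := V)))
    (hproj.comp continuous_snd) (Λ := S)
    (Q := fun p => Θ p.2 ≤ ε → Θ (Ψ.total (-p.1) p.2) ≤ 1 / 2) (by
      rintro ⟨s, w⟩ ⟨hs, hw⟩ hwS
      have hw0 := hne hw
      refine Filter.Eventually.filter_mono nhdsWithin_le_nhds ?_
      by_cases hle : Θ w ≤ ε
      · have : Θ (Ψ.total (-s) w) < 1 / 2 := by
          obtain ⟨x, z⟩ := w
          obtain ⟨u, hu, v, hv, rfl⟩ :=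
            exists_add_eq_of_isCompl (hc x hwS) z
          refine slope_back hΘ hS hE hG hdom hs.1 hwS hu hv hw0 (by linarith) hle ?_ (by norm_num)
            (by linarith)
          have : K * Real.exp (-lam * s) ≤ K * 1 := by
            gcongr
            rw [Real.exp_le_one_iff]
            nlinarith [hs.1]
          nlinarith
        have hct : ContinuousAt (fun p : ℝ × TotalSpace F V => Θ (Ψ.total (-p.1) p.2)) (s, w) :=
          ContinuousAt.comp (f := fun p : ℝ × TotalSpace F V => Ψ.total (-p.1) p.2)
            (hΘ.continuousAt _ (Ψ.total_ne_zero hw0))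
            (Ψ.continuous_total.comp (continuous_fst.neg.prodMk continuous_snd)).continuousAt
        filter_upwards [hct.eventually_lt continuousAt_const this] with z hz _
        exact hz.le
      · have hct : ContinuousAt (fun p : ℝ × TotalSpace F V => Θ p.2) (s, w) :=
          ContinuousAt.comp (f := fun p : ℝ × TotalSpace F V => p.2)
            (hΘ.continuousAt _ hw0) continuousAt_snd
        filter_upwards [continuousAt_const.eventually_lt hct (not_le.1 hle)] with z hz hz'
        exact absurd hz' (not_le.2 hz))
  -- domination
  have hZ : IsCompact (({w : TotalSpace F V | ‖w.2‖ = 1} ×ˢ {w : TotalSpace F V | ‖w.2‖ = 1}) ∩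
      {p | p.1.1 = p.2.1}) :=
    (isCompact_sphereBundle.prod isCompact_sphereBundle).inter_right
      (isClosed_eq (hproj.comp continuous_fst) (hproj.comp continuous_snd))
  obtain ⟨U₃, hU₃, h3⟩ := exists_nhdsSet_forall_of_isCompact hZ (hproj.comp continuous_fst)
    (Λ := S) (Q := fun p => Θ p.1 ≤ 1 / 2 → Θ (Ψ.total T p.1) ≤ 1 / 2 → 1 / 2 ≤ Θ p.2 →
      ‖(Ψ.total T p.1).2‖ * ‖p.2.2‖ ≤ 1 / 2 * (‖(Ψ.total T p.2).2‖ * ‖p.1.2‖)) (by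
      rintro ⟨a, b⟩ ⟨⟨ha, hb⟩, hab⟩ haS
      refine Filter.Eventually.filter_mono nhdsWithin_le_nhds ?_
      have ha0 := hne ha
      have hb0 := hne hb
      have hc1 : ContinuousAt (fun p : TotalSpace F V × TotalSpace F V => Θ p.1) (a, b) :=
        ContinuousAt.comp (f := fun p : TotalSpace F V × TotalSpace F V => p.1)
          (hΘ.continuousAt _ ha0) continuousAt_fst
      have hc2 : ContinuousAt (fun p : TotalSpace F V × TotalSpace F V => Θ (Ψ.total T p.1))
          (a, b) :=
        ContinuousAt.comp (f := fun p : TotalSpace F V × TotalSpace F V => p.1)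
          (g := fun w => Θ (Ψ.total T w)) (hcont T ha0) continuousAt_fst
      have hc3 : ContinuousAt (fun p : TotalSpace F V × TotalSpace F V => Θ p.2) (a, b) :=
        ContinuousAt.comp (f := fun p : TotalSpace F V × TotalSpace F V => p.2)
          (hΘ.continuousAt _ hb0) continuousAt_snd
      by_cases hle1 : Θ a ≤ 1 / 2
      · by_cases hle2 : Θ (Ψ.total T a) ≤ 1 / 2
        · by_cases hle3 : 1 / 2 ≤ Θ b
          · have hlt : ‖(Ψ.total T a).2‖ * ‖b.2‖ < 1 / 2 * (‖(Ψ.total T b).2‖ * ‖a.2‖) := by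
              obtain ⟨x, z⟩ := a
              obtain ⟨y, z'⟩ := b
              obtain rfl : x = y := hab
              have := comp_on hΘ hS hE hG hdom hT (by linarith) hκE hκG hκT hc haS ha0 hb0
                hle1 hle2 hle3
              rw [Ψ.total_eq, Ψ.total_eq]
              exact this
            have hn := continuous_norm_totalSpace (F := F) (V := V)
            have hnT := hn.comp (Ψ.continuous_total_const T)
            have hl := (hnT.comp continuous_fst).mul (hn.comp continuous_snd)
            have hr := continuous_const (y := (1 / 2 : ℝ)) |>.mul
              ((hnT.comp continuous_snd).mul (hn.comp continuous_fst))
            filter_upwards [(isOpen_lt hl hr).mem_nhds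
              (show (a, b) ∈ {p | _ < _} from hlt)] with p hp _ _ _
            exact le_of_lt hp
          · filter_upwards [hc3.eventually_lt continuousAt_const (not_le.1 hle3)]
              with p hp _ _ hp'
            exact absurd hp' (not_le.2 hp)
        · filter_upwards [continuousAt_const.eventually_lt hc2 (not_le.1 hle2)] with p hp _ hp'
          exact absurd hp' (not_le.2 hp)
      · filter_upwards [continuousAt_const.eventually_lt hc1 (not_le.1 hle1)] with p hp hp'
        exact absurd hp' (not_le.2 hp))
  have hunit : ∀ w : TotalSpace F V, w.2 ≠ 0 → ‖(‖w.2‖⁻¹ • w.2)‖ = 1 := fun w hw => by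
    rw [norm_smul, norm_inv, norm_norm, inv_mul_cancel₀ (norm_ne_zero_iff.2 hw)]
  have hinv : ∀ w : TotalSpace F V, w.2 ≠ 0 → 0 < ‖w.2‖⁻¹ := fun w hw =>
    inv_pos.2 (norm_pos_iff.2 hw)
  refine ⟨U₁ ∩ (U₂ ∩ U₃), inter_mem hU₁ (inter_mem hU₂ hU₃), fun w hw hw0 hle => ?_,
    fun s hs w hw hw0 hle => ?_, fun a b hab ha ha0 hb0 ha1 ha2 hb1 => ?_⟩
  · have := h1 ⟨w.1, ‖w.2‖⁻¹ • w.2⟩ (hunit w hw0) hw.1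
    rw [total_smul, hΘ.smul _ _ _ (hinv w hw0), hΘ.smul _ _ _ (hinv w hw0)] at this
    exact this hle
  · have := h2 (s, ⟨w.1, ‖w.2‖⁻¹ • w.2⟩) ⟨hs, hunit w hw0⟩ hw.2.1
    simp only [total_smul] at this
    rw [hΘ.smul _ _ _ (hinv w hw0), hΘ.smul _ _ _ (hinv w hw0)] at this
    exact this hle
  · have := h3 (⟨a.1, ‖a.2‖⁻¹ • a.2⟩, ⟨b.1, ‖b.2‖⁻¹ • b.2⟩) ⟨⟨hunit a ha0, hunit b hb0⟩, hab⟩ ha.2.2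
    simp only [norm_total_smul, hunit a ha0, hunit b hb0, abs_of_pos (hinv a ha0),
      abs_of_pos (hinv b hb0)] at this
    rw [total_smul, hΘ.smul _ _ _ (hinv a ha0), hΘ.smul _ _ _ (hinv a ha0),
      hΘ.smul _ _ _ (hinv b hb0)] at this
    have := this ha1 ha2 hb1
    have hpa := norm_pos_iff.2 ha0
    have hpb := norm_pos_iff.2 hb0
    field_simp at this ⊢
    linarith

end exists_cone
end LinearFlow

/-! ### Subspaces contained in cones. -/

/-- A decreasing sequence of closed sets, each of which contains a `d`-dimensional subspace, has a
`d`-dimensional subspace in common. -/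
lemma exists_submodule_forall_subset {H : Type*} [NormedAddCommGroup H] [InnerProductSpace ℝ H]
    [FiniteDimensional ℝ H] {A : ℕ → Set H} (hA : ∀ n, IsClosed (A n)) (hanti : Antitone A) {d : ℕ}
    (h : ∀ n, ∃ W : Submodule ℝ H, Module.finrank ℝ W = d ∧ (W : Set H) ⊆ A n) :
    ∃ W : Submodule ℝ H, Module.finrank ℝ W = d ∧ ∀ n, (W : Set H) ⊆ A n := by
  choose W hWd hWA using h
  set v : ℕ → Fin d → H := fun n i =>
    ((stdOrthonormalBasis ℝ (W n)).reindex (finCongr (hWd n)) i : H) with hv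
  have hvo : ∀ n, Orthonormal ℝ (v n) := fun n =>
    ((stdOrthonormalBasis ℝ (W n)).reindex (finCongr (hWd n))).orthonormal.comp_linearIsometry
      (W n).subtypeₗᵢ
  have hball : ∀ n, v n ∈ Metric.closedBall (0 : Fin d → H) 1 := fun n => by
    rw [mem_closedBall_zero_iff, pi_norm_le_iff_of_nonneg zero_le_one]
    exact fun i => ((hvo n).1 i).le
  -- Orthonormal bases of the subspaces have a convergent subsequence. The limit is orthonormal, so
  -- no dimension is lost.
  obtain ⟨a, -, φ, hφ, hlim⟩ := (isCompact_closedBall (0 : Fin d → H) 1).tendsto_subseq hball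
  have hlimi : ∀ i, Tendsto (fun k => v (φ k) i) atTop (𝓝 (a i)) := tendsto_pi_nhds.1 hlim
  have ha : Orthonormal ℝ a := by
    rw [orthonormal_iff_ite]
    intro i j
    refine tendsto_nhds_unique ((hlimi i).inner (hlimi j)) ?_
    simp only [orthonormal_iff_ite.1 (hvo _) i j]
    exact tendsto_const_nhds
  refine ⟨Submodule.span ℝ (range a), ?_, fun n w hw => ?_⟩
  · rw [finrank_span_eq_card ha.linearIndependent, Fintype.card_fin]
  · obtain ⟨c, rfl⟩ := (Submodule.mem_span_range_iff_exists_fun ℝ).1 hw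
    refine (hA n).mem_of_tendsto (tendsto_finsetSum (f := fun i k => c i • v (φ k) i) _
      fun i _ => (hlimi i).const_smul (c i)) ?_
    filter_upwards [eventually_ge_atTop n] with k hk
    refine hanti (hk.trans hφ.le_apply) (hWA _ ?_)
    exact Submodule.sum_mem _ fun i _ => Submodule.smul_mem _ _ (Subtype.coe_prop _)

/-- A subspace of a fibre on which a homogeneous function is less than `ε` extends to the
nearby fibres. -/
lemma eventually_exists_submodule [IsContinuousRiemannianBundle F V]
    [∀ x, FiniteDimensional ℝ (V x)] {Θ : TotalSpace F V → ℝ} {ε : ℝ}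
    (hΘc : ∀ w : TotalSpace F V, w.2 ≠ 0 → ContinuousAt Θ w)
    (hΘs : ∀ x (v : V x) (c : ℝ), 0 < c → Θ ⟨x, c • v⟩ = Θ ⟨x, v⟩) {z : B} {H : Submodule ℝ (V z)}
    (hH : ∀ w ∈ H, w ≠ 0 → Θ ⟨z, w⟩ < ε) :
    ∀ᶠ y in 𝓝 z, ∃ H' : Submodule ℝ (V y), Module.finrank ℝ H' = Module.finrank ℝ H ∧
      ∀ w ∈ H', w ≠ 0 → Θ ⟨y, w⟩ ≤ ε := by
  set e := trivializationAt F V z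
  have hz : z ∈ e.baseSet := FiberBundle.mem_baseSet_trivializationAt' z
  have hK : IsCompact {h : V z | h ∈ H ∧ ‖h‖ = 1} :=
    (isCompact_sphere (0 : V z) 1).of_isClosed_subset
      (H.closed_of_finiteDimensional.inter (isClosed_eq continuous_norm continuous_const))
      fun h hh => by simpa using hh.2
  have hloc : ∀ h ∈ {h : V z | h ∈ H ∧ ‖h‖ = 1}, ∀ᶠ p : B × V z in 𝓝 z ×ˢ 𝓝 h,
      Θ ⟨p.1, e.symmₗ ℝ p.1 (e.linearMapAt ℝ z p.2)⟩ < ε := by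
    rintro h ⟨hhH, hh1⟩
    have hh0 : h ≠ 0 := norm_ne_zero_iff.1 (by rw [hh1]; exact one_ne_zero)
    have hlim : Tendsto (fun p : B × V z =>
        (⟨p.1, e.symmₗ ℝ p.1 (e.linearMapAt ℝ z p.2)⟩ : TotalSpace F V)) (𝓝 z ×ˢ 𝓝 h)
        (𝓝 ⟨z, h⟩) := by
      rw [tendsto_totalSpace_iff]
      refine ⟨tendsto_fst, ?_⟩
      have h1 : Tendsto (fun p : B × V z => e.linearMapAt ℝ z p.2) (𝓝 z ×ˢ 𝓝 h)
          (𝓝 (e.linearMapAt ℝ z h)) :=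
        ((e.linearMapAt ℝ z).continuous_of_finiteDimensional.tendsto h).comp tendsto_snd
      refine h1.congr' ?_
      filter_upwards [tendsto_fst.eventually (e.open_baseSet.mem_nhds hz)] with p hp
      exact (e.linearMapAt_symmₗ hp _).symm
    exact hlim.eventually ((hΘc ⟨z, h⟩ hh0).eventually_lt continuousAt_const (hH h hhH hh0))
  -- The trivialization transports `H` to nearby fibres; compactness of the unit sphere of `H` makes
  -- the estimate uniform over its directions.
  have hall := hK.eventually_forall_of_forall_eventually (x₀ := z)
    (P := fun y h => Θ ⟨y, e.symmₗ ℝ y (e.linearMapAt ℝ z h)⟩ < ε) (by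
      intro h hh
      rw [nhds_prod_eq]
      exact hloc h hh)
  filter_upwards [hall, e.open_baseSet.mem_nhds hz] with y hy hye
  have hinj : Function.Injective (e.symmₗ ℝ y ∘ₗ e.linearMapAt ℝ z) := by
    intro a b hab
    have h1 := congrArg (e.linearMapAt ℝ y) hab
    simp only [LinearMap.comp_apply, e.linearMapAt_symmₗ hye] at h1
    exact linearMapAt_injective hz h1
  refine ⟨H.map (e.symmₗ ℝ y ∘ₗ e.linearMapAt ℝ z),
    (Submodule.equivMapOfInjective _ hinj H).finrank_eq.symm, ?_⟩
  rintro _ ⟨h, hhH, rfl⟩ hne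
  have hh0 : h ≠ 0 := by rintro rfl; exact hne (map_zero _)
  have hpos : 0 < ‖h‖ := norm_pos_iff.2 hh0
  have := hy (‖h‖⁻¹ • h) ⟨H.smul_mem _ hhH, by
    rw [norm_smul, norm_inv, norm_norm, inv_mul_cancel₀ hpos.ne']⟩
  rw [map_smul, map_smul, hΘs _ _ _ (inv_pos.2 hpos)] at this
  exact this.le

/-- The fibre over `y` is the sum of subspaces of dimensions `d` and `e` in the two cones. -/
def HasConeDim (Θ : TotalSpace F V → ℝ) (ε : ℝ) (d e : ℕ) (y : B) : Prop :=
  d + e = Module.finrank ℝ F ∧ ∃ H₁ H₂ : Submodule ℝ (V y),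
    Module.finrank ℝ H₁ = d ∧ Module.finrank ℝ H₂ = e ∧
      (∀ w ∈ H₁, w ≠ 0 → Θ ⟨y, w⟩ ≤ ε) ∧ ∀ w ∈ H₂, w ≠ 0 → 1 - ε ≤ Θ ⟨y, w⟩

section HasConeDim
variable {Θ : TotalSpace F V → ℝ} {ε : ℝ} {d e d' e' : ℕ} {y : B}

lemma HasConeDim.reverse (h : HasConeDim Θ ε d e y) : HasConeDim (fun w => 1 - Θ w) ε e d y := by
  obtain ⟨h0, H₁, H₂, h1, h2, h3, h4⟩ := h
  exact ⟨by omega, H₂, H₁, h2, h1, fun w hw hw0 => by linarith [h4 w hw hw0],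
    fun w hw hw0 => by linarith [h3 w hw hw0]⟩

lemma disjoint_of_cone (hε : ε < 1 / 2) {H₁ H₂ : Submodule ℝ (V y)}
    (h1 : ∀ w ∈ H₁, w ≠ 0 → Θ ⟨y, w⟩ ≤ 1 / 2) (h2 : ∀ w ∈ H₂, w ≠ 0 → 1 - ε ≤ Θ ⟨y, w⟩) :
    Disjoint H₁ H₂ := by
  refine Submodule.disjoint_def.2 fun w hw1 hw2 => ?_
  by_contra hw
  linarith [h1 w hw1 hw, h2 w hw2 hw]

/-- A subspace in the cone around `E` meets one in the cone around `G` trivially, so `d + e' ≤ d' +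
e'`. Used in both directions, this makes the dimension of the cones at a point unique. -/
lemma HasConeDim.le [∀ x, FiniteDimensional ℝ (V x)] (hε : ε < 1 / 2)
    (h : HasConeDim Θ ε d e y) (h' : HasConeDim Θ ε d' e' y) : d ≤ d' := by
  obtain ⟨h0, H₁, -, h1, -, h3, -⟩ := h
  obtain ⟨h0', -, H₂, -, h2, -, h4⟩ := h'
  have := Submodule.finrank_add_finrank_le_of_disjoint
    (disjoint_of_cone hε (fun w hw hw0 => (h3 w hw hw0).trans hε.le) h4)
  rw [finrank_fiber_eq (F := F)] at this
  omega

lemma IsSlope.eventually_hasConeDim [IsContinuousRiemannianBundle F V]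
    [∀ x, FiniteDimensional ℝ (V x)] (hΘ : IsSlope S E G Θ) (hc : ∀ x ∈ S, IsCompl (E x) (G x))
    (hε : 0 < ε) {z : B} (hz : z ∈ S) :
    ∀ᶠ y in 𝓝 z, HasConeDim Θ ε (Module.finrank ℝ (E z)) (Module.finrank ℝ (G z)) y := by
  have key : ∀ {E G : ∀ x, Submodule ℝ (V x)} {Θ : TotalSpace F V → ℝ}, IsSlope S E G Θ →
      ∀ᶠ y in 𝓝 z, ∃ H' : Submodule ℝ (V y), Module.finrank ℝ H' = Module.finrank ℝ (E z) ∧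
        ∀ w ∈ H', w ≠ 0 → Θ ⟨y, w⟩ ≤ ε := by
    intro E G Θ hΘ
    refine eventually_exists_submodule hΘ.continuousAt hΘ.smul fun w hw hw0 => ?_
    have := hΘ.add z hz w hw 0 (G z).zero_mem (by rwa [add_zero])
    rw [add_zero, norm_zero, zero_div] at this
    rwa [this]
  filter_upwards [key hΘ, key hΘ.reverse] with y ⟨H₁, h1, h3⟩ ⟨H₂, h2, h4⟩
  refine ⟨?_, H₁, H₂, h1, h2, h3, fun w hw hw0 => by linarith [h4 w hw hw0]⟩
  rw [Submodule.finrank_add_eq_of_isCompl (hc z hz), finrank_fiber_eq (F := F)]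

end HasConeDim

/-! ### Stable spaces of the cone field. -/

namespace LinearFlow

/-- The span of the vectors whose forward orbit stays in the cone `Θ ≤ 1 / 2`. -/
def stableSpace (Ψ : LinearFlow F V) (Θ : TotalSpace F V → ℝ) (T : ℝ) (x : B) : Submodule ℝ (V x) :=
  Submodule.span ℝ {w | ∀ n : ℕ, Θ (Ψ.total (n * T) ⟨x, w⟩) ≤ 1 / 2}

variable {Ψ : LinearFlow F V} {Θ : TotalSpace F V → ℝ} {ε T : ℝ} {U : Set B} {d e : ℕ} {x : B}

lemma total_succ (n : ℕ) (w : TotalSpace F V) :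
    Ψ.total T (Ψ.total (n * T) w) = Ψ.total ((n + 1 : ℕ) * T) w := by
  rw [← Ψ.total_add]; push_cast; congr 1; ring

lemma total_pred (n : ℕ) (w : TotalSpace F V) :
    Ψ.total (-T) (Ψ.total ((n + 1 : ℕ) * T) w) = Ψ.total (n * T) w := by
  rw [← Ψ.total_add]; push_cast; congr 1; ring

lemma isClosed_cone (hΘc : ∀ w : TotalSpace F V, w.2 ≠ 0 → ContinuousAt Θ w)
    [IsContinuousRiemannianBundle F V] (t c : ℝ) :
    IsClosed {w : TotalSpace F V | w.2 = 0 ∨ Θ (Ψ.total t w) ≤ c} := by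
  rw [← isOpen_compl_iff, isOpen_iff_mem_nhds]
  intro w hw
  simp only [mem_compl_iff, mem_ofPred_eq, not_or, not_le] at hw
  have h1 : ContinuousAt (fun w => Θ (Ψ.total t w)) w :=
    (hΘc _ (Ψ.total_ne_zero hw.1)).comp (f := Ψ.total t) (Ψ.continuous_total_const t).continuousAt
  have h2 : ∀ᶠ z : TotalSpace F V in 𝓝 w, 0 < ‖z.2‖ :=
    continuousAt_const.eventually_lt continuous_norm_totalSpace.continuousAt (norm_pos_iff.2 hw.1)
  filter_upwards [h2, continuousAt_const.eventually_lt h1 hw.2] with z hz1 hz2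
  simp only [mem_compl_iff, mem_ofPred_eq, not_or, not_le]
  exact ⟨norm_pos_iff.1 hz1, hz2⟩

/-- The cone is mapped into itself by time `-T`, so a vector in the cone at time `n * T` was in it
at all earlier multiples of `T`. -/
lemma IsConeNhd.le_of_le (h : Ψ.IsConeNhd Θ ε T U) (hε : ε < 1 / 2) {w : TotalSpace F V}
    (hw : ∀ t, Ψ.base t w.1 ∈ U) (hw0 : w.2 ≠ 0) {n : ℕ} (hn : Θ (Ψ.total (n * T) w) ≤ 1 / 2)
    {k : ℕ} (hk : k ≤ n) : Θ (Ψ.total (k * T) w) ≤ 1 / 2 := by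
  induction n, hk using Nat.le_induction with
  | base => exact hn
  | succ n hkn ih =>
    apply ih
    have := h.back (Ψ.total ((n + 1 : ℕ) * T) w) (by rw [total_fst]; exact hw _)
      (Ψ.total_ne_zero hw0) hn
    rw [total_pred] at this
    linarith

lemma IsConeNhd.ge_half (h : Ψ.reverse.IsConeNhd (fun w => 1 - Θ w) ε T U) (hε : ε < 1 / 2)
    {w : TotalSpace F V} (hw : ∀ t, Ψ.base t w.1 ∈ U) (hw0 : w.2 ≠ 0) (h0 : 1 / 2 ≤ Θ w) (n : ℕ) :
    1 / 2 ≤ Θ (Ψ.total (n * T) w) := by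
  induction n with
  | zero => rwa [Nat.cast_zero, zero_mul, Ψ.total_zero]
  | succ n ih =>
    have := h.back (Ψ.total (n * T) w) (by rw [total_fst]; exact hw _)
      (Ψ.total_ne_zero hw0) (by linarith)
    change 1 - Θ (Ψ.total (- -T) _) ≤ ε at this
    rw [neg_neg, total_succ] at this
    linarith

/-- `a` stays in one cone and `b` in the other, so each period `T` costs `a` a factor 2 relative to
`b`. -/
lemma IsConeNhd.norm_le (h : Ψ.IsConeNhd Θ ε T U)
    (h' : Ψ.reverse.IsConeNhd (fun w => 1 - Θ w) ε T U)
    (hε : ε < 1 / 2) (hx : ∀ t, Ψ.base t x ∈ U) {a b : V x} (hb0 : b ≠ 0)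
    (ha : a = 0 ∨ ∀ n : ℕ, Θ (Ψ.total (n * T) ⟨x, a⟩) ≤ 1 / 2) (hb : 1 / 2 ≤ Θ ⟨x, b⟩) (n : ℕ) :
    ‖Ψ.map (n * T) x a‖ * ‖b‖ ≤ (1 / 2) ^ n * (‖Ψ.map (n * T) x b‖ * ‖a‖) := by
  rcases ha with rfl | ha
  · simp
  by_cases ha0 : a = 0
  · simp [ha0]
  have hnorm : ∀ (t : ℝ) (v : V x), ‖Ψ.map t x v‖ = ‖(Ψ.total t ⟨x, v⟩).2‖ := fun t v => by
    rw [Ψ.total_eq]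
  simp only [hnorm]
  induction n with
  | zero => rw [Nat.cast_zero, zero_mul, Ψ.total_zero, Ψ.total_zero, pow_zero, one_mul, mul_comm]
  | succ n ih =>
    have h1 := h.comp (Ψ.total (n * T) ⟨x, a⟩) (Ψ.total (n * T) ⟨x, b⟩)
      (by rw [total_fst, total_fst]) (by rw [total_fst]; exact hx _) (Ψ.total_ne_zero ha0)
      (Ψ.total_ne_zero hb0) (ha n) (by rw [total_succ]; exact ha (n + 1))
      (h'.ge_half hε (w := ⟨x, b⟩) hx hb0 hb n)
    rw [total_succ, total_succ] at h1
    have h2 : 0 < ‖(Ψ.total (n * T) ⟨x, b⟩).2‖ := norm_pos_iff.2 (Ψ.total_ne_zero hb0)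
    refine le_of_mul_le_mul_right ?_ h2
    calc _ = (‖(Ψ.total ((n + 1 : ℕ) * T) ⟨x, a⟩).2‖ * ‖(Ψ.total (n * T) ⟨x, b⟩).2‖) * ‖b‖ := by
          ring
      _ ≤ (1 / 2 * (‖(Ψ.total ((n + 1 : ℕ) * T) ⟨x, b⟩).2‖ * ‖(Ψ.total (n * T) ⟨x, a⟩).2‖)) *
          ‖b‖ := by gcongr
      _ = 1 / 2 * ‖(Ψ.total ((n + 1 : ℕ) * T) ⟨x, b⟩).2‖ *
          (‖(Ψ.total (n * T) ⟨x, a⟩).2‖ * ‖b‖) := by ring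
      _ ≤ 1 / 2 * ‖(Ψ.total ((n + 1 : ℕ) * T) ⟨x, b⟩).2‖ *
          ((1 / 2) ^ n * (‖(Ψ.total (n * T) ⟨x, b⟩).2‖ * ‖a‖)) := by gcongr
      _ = _ := by ring

/-- Over an orbit in `U`, the stable space consists of the vectors whose forward orbit stays in the
cone, and it has the dimension of the cone. -/
lemma IsConeNhd.finrank_stableSpace [IsContinuousRiemannianBundle F V]
    [∀ x, FiniteDimensional ℝ (V x)] (h : Ψ.IsConeNhd Θ ε T U)
    (h' : Ψ.reverse.IsConeNhd (fun w => 1 - Θ w) ε T U)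
    (hΘc : ∀ w : TotalSpace F V, w.2 ≠ 0 → ContinuousAt Θ w)
    (hε : ε < 1 / 2) (hx : ∀ t, Ψ.base t x ∈ U) (hd : ∀ t, HasConeDim Θ ε d e (Ψ.base t x)) :
    Module.finrank ℝ (Ψ.stableSpace Θ T x) = d ∧
      ∀ w, w ∈ Ψ.stableSpace Θ T x ↔ w = 0 ∨ ∀ n : ℕ, Θ (Ψ.total (n * T) ⟨x, w⟩) ≤ 1 / 2 := by
  set A : ℕ → Set (V x) := fun n => {w | ∀ k ≤ n, w = 0 ∨ Θ (Ψ.total (k * T) ⟨x, w⟩) ≤ 1 / 2}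
  have hA : ∀ n, IsClosed (A n) := fun n => by
    have : A n = ⋂ (k : ℕ) (_ : k ≤ n), {w | w = 0 ∨ Θ (Ψ.total (k * T) ⟨x, w⟩) ≤ 1 / 2} := by
      ext; simp [A]
    rw [this]
    exact isClosed_iInter fun k => isClosed_iInter fun _ =>
      (isClosed_cone hΘc (k * T) (1 / 2)).preimage (FiberBundle.continuous_totalSpaceMk F V x)
  have hanti : Antitone A := fun m n hmn w hw k hk => hw k (hk.trans hmn)
  -- The preimage under time `n * T` of a `d`-dimensional subspace in the cone consists of vectors
  -- staying in the cone up to time `n * T`.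
  obtain ⟨W, hWd, hWA⟩ := exists_submodule_forall_subset hA hanti (d := d) fun n => by
    obtain ⟨-, H₁, -, h1, -, h3, -⟩ := hd (n * T)
    refine ⟨H₁.comap (Ψ.mapEquiv (n * T) x).toLinearMap, ?_, fun w hw k hk => ?_⟩
    · rw [← h1]
      exact ((Ψ.mapEquiv (n * T) x).ofSubmodule' H₁).finrank_eq
    · refine or_iff_not_imp_left.2 fun hw0 => ?_
      refine h.le_of_le hε (w := ⟨x, w⟩) hx hw0 (n := n) ?_ hk
      rw [Ψ.total_eq]
      exact (h3 _ hw fun h0 => hw0 ((map_eq_zero_iff _ (Ψ.map_injective _ x)).1 h0)).trans hε.le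
  have hW1 : ∀ w ∈ W, w = 0 ∨ ∀ n : ℕ, Θ (Ψ.total (n * T) ⟨x, w⟩) ≤ 1 / 2 := fun w hw =>
    or_iff_not_imp_left.2 fun hw0 n => (hWA n hw n le_rfl).resolve_left hw0
  -- Write `w = a + b` with `a ∈ W` and `b` in the opposite cone. Both `a` and `a + b` become
  -- negligible against `b` under the flow, although `b` is their difference; hence `b = 0`.
  have hW2 : ∀ w : V x, (∀ n : ℕ, Θ (Ψ.total (n * T) ⟨x, w⟩) ≤ 1 / 2) → w ∈ W := by
    intro w hw
    have hdx := hd 0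
    rw [Ψ.base_zero] at hdx
    obtain ⟨hde, -, H₂, -, h2, -, h4⟩ := hdx
    have hdisj : Disjoint W H₂ := by
      refine disjoint_of_cone hε (fun w hw hw0 => ?_) h4
      have := (hW1 w hw).resolve_left hw0 0
      rwa [Nat.cast_zero, zero_mul, Ψ.total_zero] at this
    have hcompl : IsCompl W H₂ := by
      refine ⟨hdisj, codisjoint_iff.2 (Submodule.eq_top_of_finrank_eq ?_)⟩
      have := Submodule.finrank_sup_add_finrank_inf_eq W H₂
      rw [disjoint_iff.1 hdisj, finrank_bot, hWd, h2, hde] at this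
      rw [finrank_fiber_eq (F := F)]
      omega
    obtain ⟨a, b, ha, hb, rfl⟩ := Submodule.codisjoint_iff_exists_add_eq.1 hcompl.codisjoint w
    suffices hb0 : b = 0 by rwa [hb0, add_zero]
    by_contra hb0
    have hbΘ : 1 / 2 ≤ Θ ⟨x, b⟩ := by linarith [h4 b hb hb0]
    have hle : ∀ n : ℕ, ‖b‖ ≤ (1 / 2) ^ n * (‖a + b‖ + ‖a‖) := fun n => by
      have h5 := h.norm_le h' hε hx hb0 (hW1 a ha) hbΘ n
      have h6 := h.norm_le h' hε hx hb0 (Or.inr hw) hbΘ n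
      have h7 : ‖Ψ.map (n * T) x b‖ ≤ ‖Ψ.map (n * T) x (a + b)‖ + ‖Ψ.map (n * T) x a‖ := by
        have := norm_sub_le (Ψ.map (n * T) x (a + b)) (Ψ.map (n * T) x a)
        rwa [← map_sub, add_sub_cancel_left] at this
      have h8 : 0 < ‖Ψ.map (n * T) x b‖ := norm_map_pos _ (norm_pos_iff.2 hb0)
      refine le_of_mul_le_mul_left ?_ h8
      calc ‖Ψ.map (n * T) x b‖ * ‖b‖
          ≤ (‖Ψ.map (n * T) x (a + b)‖ + ‖Ψ.map (n * T) x a‖) * ‖b‖ := by gcongr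
        _ = ‖Ψ.map (n * T) x (a + b)‖ * ‖b‖ + ‖Ψ.map (n * T) x a‖ * ‖b‖ := by ring
        _ ≤ (1 / 2) ^ n * (‖Ψ.map (n * T) x b‖ * ‖a + b‖) +
            (1 / 2) ^ n * (‖Ψ.map (n * T) x b‖ * ‖a‖) := add_le_add h6 h5
        _ = _ := by ring
    have hlim : Tendsto (fun n : ℕ => (1 / 2 : ℝ) ^ n * (‖a + b‖ + ‖a‖)) atTop (𝓝 0) := by
      have := (tendsto_pow_atTop_nhds_zero_of_lt_one (by norm_num : (0 : ℝ) ≤ 1 / 2)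
        (by norm_num)).mul_const (‖a + b‖ + ‖a‖)
      rwa [zero_mul] at this
    exact absurd (ge_of_tendsto' hlim hle) (not_le.2 (norm_pos_iff.2 hb0))
  have hWeq : Ψ.stableSpace Θ T x = W := by
    refine le_antisymm (Submodule.span_le.2 hW2) fun w hw => ?_
    rcases hW1 w hw with rfl | h1
    · exact Submodule.zero_mem _
    · exact Submodule.subset_span h1
  refine ⟨hWeq ▸ hWd, fun w => ?_⟩
  rw [hWeq]
  refine ⟨hW1 w, ?_⟩
  rintro (rfl | h1)
  · exact W.zero_mem
  · exact hW2 w h1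

end LinearFlow

namespace LinearFlow

variable {Ψ : LinearFlow F V} {Θ : TotalSpace F V → ℝ} {ε T : ℝ} {U : Set B} {d e : ℕ} {x : B}

lemma IsConeNhd.reverse_reverse (h : Ψ.IsConeNhd Θ ε T U) :
    Ψ.reverse.reverse.IsConeNhd Θ ε T U := by
  have hb : Ψ.reverse.reverse.total = Ψ.total := by
    funext t w; exact congrArg (fun s => Ψ.total s w) (neg_neg t)
  constructor <;> rw [hb]
  exacts [h.back, h.short, h.comp]

lemma IsInvariantFamily.of_reverse (h : Ψ.reverse.IsInvariantFamily S E) :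
    Ψ.IsInvariantFamily S E := by
  intro t
  have h1 : ∀ w : TotalSpace F V, w.1 ∈ S → w.2 ∈ E w.1 →
      (Ψ.total (- -t) w).2 ∈ E (Ψ.total (- -t) w).1 := h (-t)
  rwa [neg_neg] at h1

/-- Backward invariance adds the negative multiples of `T`, and one more backward step improves the
slope to `ε` at every multiple. Any other time lies less than `T` before a multiple, where `short`
applies. -/
lemma IsConeNhd.le_half_total (h : Ψ.IsConeNhd Θ ε T U) (hT : 0 < T) (hε : ε < 1 / 2)
    {w : TotalSpace F V} (hx : ∀ t, Ψ.base t w.1 ∈ U) (hw0 : w.2 ≠ 0)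
    (hw : ∀ n : ℕ, Θ (Ψ.total (n * T) w) ≤ 1 / 2) (s : ℝ) (n : ℕ) :
    Θ (Ψ.total (n * T) (Ψ.total s w)) ≤ 1 / 2 := by
  have hU : ∀ t, (Ψ.total t w).1 ∈ U := fun t => by rw [total_fst]; exact hx t
  -- integer multiples of `T`
  have hneg : ∀ k : ℕ, Θ (Ψ.total (-(k * T)) w) ≤ 1 / 2 := fun k => by
    induction k with
    | zero =>
      have := hw 0
      rw [Nat.cast_zero, zero_mul] at this ⊢
      rwa [neg_zero]
    | succ k ih =>
      have := h.back _ (hU _) (Ψ.total_ne_zero hw0) ih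
      rw [← Ψ.total_add] at this
      have heq : -T + -(k * T) = -((k + 1 : ℕ) * T) := by push_cast; ring
      rw [heq] at this
      linarith
  have hint : ∀ m : ℤ, Θ (Ψ.total (m * T) w) ≤ 1 / 2 := fun m => by
    obtain ⟨k, rfl | rfl⟩ := m.eq_nat_or_neg
    · exact_mod_cast hw k
    · have := hneg k
      rw [← neg_mul] at this
      exact_mod_cast this
  have hint' : ∀ m : ℤ, Θ (Ψ.total (m * T) w) ≤ ε := fun m => by
    have := h.back _ (hU _) (Ψ.total_ne_zero hw0) (hint (m + 1))
    rw [← Ψ.total_add] at this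
    have heq : -T + ((m + 1 : ℤ) : ℝ) * T = m * T := by push_cast; ring
    rwa [heq] at this
  rw [← Ψ.total_add]
  set t := n * T + s
  have h1 : t ≤ ⌈t / T⌉ * T := by rw [← div_le_iff₀ hT]; exact Int.le_ceil _
  have h2 : ⌈t / T⌉ * T < t + T := by
    have := Int.ceil_lt_add_one (t / T)
    calc ⌈t / T⌉ * T < (t / T + 1) * T := by gcongr
      _ = t + T := by field_simp
  have := h.short (⌈t / T⌉ * T - t) ⟨by linarith, by linarith⟩ _ (hU _) (Ψ.total_ne_zero hw0)
    (hint' ⌈t / T⌉)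
  rw [← Ψ.total_add] at this
  have heq : -(⌈t / T⌉ * T - t) + ⌈t / T⌉ * T = t := by ring
  rwa [heq] at this

section stableFamily
variable [IsContinuousRiemannianBundle F V] [∀ x, FiniteDimensional ℝ (V x)]

lemma IsConeNhd.isInvariantFamily (h : Ψ.IsConeNhd Θ ε T U)
    (h' : Ψ.reverse.IsConeNhd (fun w => 1 - Θ w) ε T U)
    (hΘc : ∀ w : TotalSpace F V, w.2 ≠ 0 → ContinuousAt Θ w) (hT : 0 < T) (hε : ε < 1 / 2)
    (hS : Ψ.IsInvariantSet S) (hSU : S ⊆ U)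
    (hd : ∀ x ∈ S, ∃ d e, ∀ t, HasConeDim Θ ε d e (Ψ.base t x)) :
    Ψ.IsInvariantFamily S (Ψ.stableSpace Θ T) := by
  intro t w hwS hw
  have hmem : ∀ x ∈ S, ∀ w, w ∈ Ψ.stableSpace Θ T x ↔
      w = 0 ∨ ∀ n : ℕ, Θ (Ψ.total (n * T) ⟨x, w⟩) ≤ 1 / 2 := fun x hx => by
    obtain ⟨d, e, hde⟩ := hd x hx
    exact (h.finrank_stableSpace h' hΘc hε (fun t => hSU (hS t x hx)) hde).2
  by_cases hw0 : w.2 = 0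
  · obtain ⟨x, v⟩ := w
    obtain rfl : v = 0 := hw0
    rw [Ψ.total_eq, map_zero]
    exact Submodule.zero_mem _
  · rw [hmem _ (by rw [total_fst]; exact hS _ _ hwS)]
    right
    exact h.le_half_total hT hε (fun t => hSU (hS t _ hwS)) hw0
      (((hmem _ hwS _).1 hw).resolve_left hw0) t

lemma IsConeNhd.isClosed_stableSpace (h : Ψ.IsConeNhd Θ ε T U)
    (h' : Ψ.reverse.IsConeNhd (fun w => 1 - Θ w) ε T U)
    (hΘc : ∀ w : TotalSpace F V, w.2 ≠ 0 → ContinuousAt Θ w) (hε : ε < 1 / 2)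
    (hS : Ψ.IsInvariantSet S) (hSc : IsClosed S) (hSU : S ⊆ U)
    (hd : ∀ x ∈ S, ∃ d e, ∀ t, HasConeDim Θ ε d e (Ψ.base t x)) :
    IsClosed {w : TotalSpace F V | w.1 ∈ S ∧ w.2 ∈ Ψ.stableSpace Θ T w.1} := by
  have : {w : TotalSpace F V | w.1 ∈ S ∧ w.2 ∈ Ψ.stableSpace Θ T w.1} =
      {w : TotalSpace F V | w.1 ∈ S} ∩
        ⋂ n : ℕ, {w | w.2 = 0 ∨ Θ (Ψ.total (n * T) w) ≤ 1 / 2} := by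
    ext w
    simp only [mem_ofPred_eq, mem_inter_iff, mem_iInter]
    refine and_congr_right fun hw => ?_
    obtain ⟨d, e, hde⟩ := hd _ hw
    rw [(h.finrank_stableSpace h' hΘc hε (fun t => hSU (hS t _ hw)) hde).2, forall_or_left]
  rw [this]
  exact (hSc.preimage (FiberBundle.continuous_proj F V)).inter
    (isClosed_iInter fun n => isClosed_cone hΘc _ _)

/-- Vectors of the invariant family `E` have slope 0 along their whole orbit. -/
lemma IsSlope.le_stableSpace (hΘ : IsSlope S E G Θ) (hS : Ψ.IsInvariantSet S)
    (hE : Ψ.IsInvariantFamily S E) {x : B} (hx : x ∈ S) : E x ≤ Ψ.stableSpace Θ T x := by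
  intro w hw
  by_cases hw0 : w = 0
  · rw [hw0]; exact Submodule.zero_mem _
  refine Submodule.subset_span fun n => ?_
  have h1 := hΘ.add _ (hS (n * T) x hx) _ (hE.map_mem (n * T) hx hw) 0 (Submodule.zero_mem _)
    (by rw [add_zero]; exact fun h => hw0 ((map_eq_zero_iff _ (Ψ.map_injective _ x)).1 h))
  rw [add_zero, norm_zero, zero_div] at h1
  rw [Ψ.total_eq, h1]
  norm_num

end stableFamily

/-- The ranks need not be constant on the base, but they are locally constant along an orbit, which
is parametrized by the connected space ℝ. -/
lemma exists_hasConeDim_orbit [∀ x, FiniteDimensional ℝ (V x)] (hε : ε < 1 / 2)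
    (hx : ∀ t, ∃ d e, ∀ᶠ y in 𝓝 (Ψ.base t x), HasConeDim Θ ε d e y) :
    ∃ d e, ∀ t, HasConeDim Θ ε d e (Ψ.base t x) := by
  choose d e hde using hx
  have hcont : Continuous fun t => Ψ.base t x :=
    Ψ.continuous_base.comp (continuous_id.prodMk continuous_const)
  have hd : IsLocallyConstant d := by
    rw [IsLocallyConstant.iff_eventually_eq]
    intro t
    filter_upwards [hcont.continuousAt.eventually (hde t)] with s hs
    exact le_antisymm ((hde s).self_of_nhds.le hε hs) (hs.le hε (hde s).self_of_nhds)
  refine ⟨d 0, e 0, fun t => ?_⟩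
  have h1 := (hde t).self_of_nhds
  have h2 := (hde 0).self_of_nhds
  rw [hd.apply_eq_of_preconnectedSpace t 0] at h1
  have h3 : e t = e 0 := by have := h1.1; have := h2.1; omega
  rwa [h3] at h1

/-- A dominated splitting over a closed invariant set extends to the invariant sets in a
neighbourhood. -/
theorem exists_extension_splitting [IsContinuousRiemannianBundle F V] [CompactSpace B]
    [T2Space B] [FiniteDimensional ℝ F] [∀ x, FiniteDimensional ℝ (V x)] {K lam : ℝ}
    (hSc : IsClosed S) (hS : Ψ.IsInvariantSet S) (hspl : IsContinuousSplitting F S E G)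
    (hE : Ψ.IsInvariantFamily S E) (hG : Ψ.IsInvariantFamily S G) (hK : 1 ≤ K) (hlam : 0 < lam)
    (hdom : Ψ.IsDominatedBy S E G K lam) :
    ∃ U ∈ 𝓝ˢ S, ∃ E' G' : ∀ x, Submodule ℝ (V x),
      (∀ S' : Set B, IsClosed S' → Ψ.IsInvariantSet S' → S' ⊆ U →
        IsContinuousSplitting F S' E' G' ∧ Ψ.IsInvariantFamily S' E' ∧
          Ψ.IsInvariantFamily S' G') ∧
      ∀ x ∈ S, E' x = E x ∧ G' x = G x := by
  obtain ⟨Θ, hΘ₁, hΘ₂, hΘ₃⟩ := hspl.exists_slope hSc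
  have hΘ : IsSlope S E G Θ := ⟨hΘ₁, hΘ₂, hΘ₃⟩
  obtain ⟨κ₁, hκ₁, hκE⟩ := hspl.exists_norm_le hSc
  obtain ⟨κ₂, hκ₂, hκG⟩ := hspl.symm.exists_norm_le hSc
  set κ := max κ₁ κ₂
  have hκE' : ∀ x ∈ S, ∀ u ∈ E x, ∀ v ∈ G x, ‖u‖ ≤ κ * ‖u + v‖ := fun x hx u hu v hv =>
    (hκE x hx u hu v hv).trans (by gcongr; exact le_max_left _ _)
  have hκG' : ∀ x ∈ S, ∀ u ∈ G x, ∀ v ∈ E x, ‖u‖ ≤ κ * ‖u + v‖ := fun x hx u hu v hv =>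
    (hκG x hx u hu v hv).trans (by gcongr; exact le_max_right _ _)
  have hlim : Tendsto (fun T : ℝ => K * Real.exp (-lam * T)) atTop (𝓝 0) := by
    have h1 : Tendsto (fun T : ℝ => -lam * T) atTop atBot :=
      tendsto_id.const_mul_atTop_of_neg (by linarith)
    have := (Real.tendsto_exp_atBot.comp h1).const_mul K
    rwa [mul_zero] at this
  have hlim' : Tendsto (fun T : ℝ => 4 * κ ^ 2 * (K * Real.exp (-lam * T))) atTop (𝓝 0) := by
    have := hlim.const_mul (4 * κ ^ 2)
    rwa [mul_zero] at this
  obtain ⟨T, hT, hεT, hκT⟩ := ((eventually_gt_atTop (0 : ℝ)).and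
    ((hlim.eventually_lt_const (by positivity : 0 < 1 / (4 * K))).and
      (hlim'.eventually_lt_const (by norm_num : (0 : ℝ) < 1 / 2)))).exists
  obtain ⟨U₁, hU₁, h₁⟩ := exists_isConeNhd hΘ hS hE hG hdom hT.le hK hlam.le hκE' hκG' hκT hεT
    hspl.1
  obtain ⟨U₂, hU₂, h₂⟩ := exists_isConeNhd hΘ.reverse hS.reverse hG.reverse hE.reverse
    (hdom.reverse hS hE hG) hT.le hK hlam.le hκG' hκE' hκT hεT hspl.symm.1
  set ε := 1 / (4 * K) with hεdef
  have hε0 : 0 < ε := by positivity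
  have hε : ε < 1 / 2 := by
    rw [hεdef, div_lt_div_iff₀ (by positivity) (by norm_num)]; linarith
  -- Asking for the dimensions on a whole neighbourhood of `y`, not only at `y`, is what gives local
  -- constancy along orbits.
  set O : Set B := {y | ∃ d e, ∀ᶠ z in 𝓝 y, HasConeDim Θ ε d e z}
  have hO : O ∈ 𝓝ˢ S := by
    refine mem_nhdsSet_iff_forall.2 fun z hz => ?_
    filter_upwards [(hΘ.eventually_hasConeDim hspl.1 hε0 hz).eventually_nhds] with y hy
    exact ⟨_, _, hy⟩
  have hU : U₁ ∩ U₂ ∩ O ∈ 𝓝ˢ S := inter_mem (inter_mem hU₁ hU₂) hO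
  have h₁' := h₁.mono (U' := U₁ ∩ U₂ ∩ O) fun x hx => hx.1.1
  have h₂' := h₂.mono (U' := U₁ ∩ U₂ ∩ O) fun x hx => hx.1.2
  have hΘΘ : (fun w : TotalSpace F V => 1 - (1 - Θ w)) = Θ := by funext w; ring
  have h₁'' : Ψ.reverse.reverse.IsConeNhd (fun w => 1 - (1 - Θ w)) ε T (U₁ ∩ U₂ ∩ O) := by
    rw [hΘΘ]; exact h₁'.reverse_reverse
  have key : ∀ S' : Set B, IsClosed S' → Ψ.IsInvariantSet S' → S' ⊆ U₁ ∩ U₂ ∩ O →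
      IsContinuousSplitting F S' (Ψ.stableSpace Θ T)
        (Ψ.reverse.stableSpace (fun w => 1 - Θ w) T) ∧
      Ψ.IsInvariantFamily S' (Ψ.stableSpace Θ T) ∧
      Ψ.IsInvariantFamily S' (Ψ.reverse.stableSpace (fun w => 1 - Θ w) T) := by
    intro S' hSc' hS' hSU'
    have hd : ∀ x ∈ S', ∃ d e, ∀ t, HasConeDim Θ ε d e (Ψ.base t x) := fun x hx =>
      exists_hasConeDim_orbit hε fun t => (hSU' (hS' t x hx)).2
    have hd' : ∀ x ∈ S', ∃ d e, ∀ t, HasConeDim (fun w => 1 - Θ w) ε d e (Ψ.reverse.base t x) :=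
      fun x hx => by
        obtain ⟨d, e, hde⟩ := hd x hx
        exact ⟨e, d, fun t => (hde (-t)).reverse⟩
    have hcl := h₁'.isClosed_stableSpace h₂' hΘ.continuousAt hε hS' hSc' hSU' hd
    have hcl' := h₂'.isClosed_stableSpace h₁'' hΘ.reverse.continuousAt hε hS'.reverse hSc' hSU' hd'
    refine ⟨isContinuousSplitting_of_isClosed (fun x hx => ?_) hcl hcl',
      h₁'.isInvariantFamily h₂' hΘ.continuousAt hT hε hS' hSU' hd, ?_⟩
    · obtain ⟨d, e, hde⟩ := hd x hx
      have hx1 : ∀ t, Ψ.base t x ∈ U₁ ∩ U₂ ∩ O := fun t => hSU' (hS' t x hx)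
      obtain ⟨hr1, hm1⟩ := h₁'.finrank_stableSpace h₂' hΘ.continuousAt hε hx1 hde
      obtain ⟨hr2, hm2⟩ := h₂'.finrank_stableSpace h₁'' hΘ.reverse.continuousAt hε
        (fun t => hx1 (-t)) (fun t => (hde (-t)).reverse)
      have hdisj : Disjoint (Ψ.stableSpace Θ T x)
          (Ψ.reverse.stableSpace (fun w => 1 - Θ w) T x) := by
        -- A common nonzero vector is in the first cone at time `T`, hence has slope at most `ε` at
        -- time 0; but membership in the second space at `n = 0` gives slope at least `1/2`.
        refine Submodule.disjoint_def.2 fun w hw1 hw2 => ?_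
        by_contra hw0
        have h1 := ((hm1 w).1 hw1).resolve_left hw0 1
        have h2 := ((hm2 w).1 hw2).resolve_left hw0 0
        rw [Nat.cast_zero, zero_mul, Ψ.reverse.total_zero] at h2
        have h3 := h₁'.back _ (by rw [total_fst]; exact hx1 _) (Ψ.total_ne_zero hw0) h1
        rw [Nat.cast_one, one_mul, total_neg_total] at h3
        linarith
      refine ⟨hdisj, codisjoint_iff.2 (Submodule.eq_top_of_finrank_eq ?_)⟩
      have := Submodule.finrank_sup_add_finrank_inf_eq (Ψ.stableSpace Θ T x)
        (Ψ.reverse.stableSpace (fun w => 1 - Θ w) T x)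
      rw [disjoint_iff.1 hdisj, finrank_bot, hr1, hr2, (hde 0).1] at this
      rw [finrank_fiber_eq (F := F)]
      omega
    · exact (h₂'.isInvariantFamily h₁'' hΘ.reverse.continuousAt hT hε hS'.reverse hSU'
        hd').of_reverse
  refine ⟨_, hU, _, _, key, fun x hx => ?_⟩
  have hc := (key S hSc hS (subset_of_mem_nhdsSet hU)).1.1 x hx
  have hle1 : E x ≤ Ψ.stableSpace Θ T x := IsSlope.le_stableSpace hΘ hS hE hx
  have hle2 : G x ≤ Ψ.reverse.stableSpace (fun w => 1 - Θ w) T x :=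
    IsSlope.le_stableSpace hΘ.reverse hS.reverse hG.reverse hx
  -- Enlarging both summands of a direct decomposition while keeping them disjoint changes neither.
  have aux : ∀ {A A' C C' : Submodule ℝ (V x)}, IsCompl A C → Disjoint A' C' → A ≤ A' → C ≤ C' →
      A' = A := by
    intro A A' C C' h h' hA hC
    refine le_antisymm (fun w hw => ?_) hA
    obtain ⟨a, c, ha, hc, rfl⟩ := Submodule.codisjoint_iff_exists_add_eq.1 h.codisjoint w
    have : c = 0 := Submodule.disjoint_def.1 h' c
      (by simpa using A'.sub_mem hw (hA ha)) (hC hc)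
    rwa [this, add_zero]
  exact ⟨aux (hspl.1 x hx) hc.disjoint hle1 hle2,
    aux (hspl.1 x hx).symm hc.symm.disjoint hle2 hle1⟩

end LinearFlow

/-! ### From an estimate at one time to exponential rates, and areas of parallelograms. -/

/-- Write `t = n * T + s` with `0 ≤ s < T`. The factor 2 in the conclusion pays for rounding `t / T`
down to `n`, since `2 ^ (-n) ≤ 2 * 2 ^ (-t / T)`. -/
lemma le_exp_of_halving {g : ℝ → ℝ} {T C : ℝ} (hT : 0 < T)
    (h1 : ∀ t, 0 ≤ t → g (t + T) ≤ 1 / 2 * g t) (h2 : ∀ s ∈ Icc 0 T, g s ≤ C * g 0)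
    (hC : 0 ≤ C * g 0) {t : ℝ} (ht : 0 ≤ t) :
    g t ≤ 2 * C * Real.exp (-(Real.log 2 / T) * t) * g 0 := by
  have hiter : ∀ (n : ℕ) (s : ℝ), 0 ≤ s → g (s + n * T) ≤ (1 / 2) ^ n * g s := by
    intro n s hs
    induction n with
    | zero => simp
    | succ n ih =>
      have h3 := h1 (s + n * T) (by positivity)
      have heq : s + (n + 1 : ℕ) * T = s + n * T + T := by push_cast; ring
      rw [heq, pow_succ]
      linarith
  set n := ⌊t / T⌋₊
  have hn1 : n * T ≤ t := by
    rw [← le_div_iff₀ hT]; exact Nat.floor_le (by positivity)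
  have hn2 : t < (n + 1) * T := by
    rw [← div_lt_iff₀ hT]; exact Nat.lt_floor_add_one _
  have h3 := hiter n (t - n * T) (by linarith)
  rw [sub_add_cancel] at h3
  have h4 := h2 (t - n * T) ⟨by linarith, by linarith⟩
  have h5 : (1 / 2 : ℝ) ^ n ≤ 2 * Real.exp (-(Real.log 2 / T) * t) := by
    have e1 : (1 / 2 : ℝ) ^ n = Real.exp (-(Real.log 2 * n)) := by
      rw [Real.exp_neg, mul_comm, Real.exp_nat_mul, Real.exp_log two_pos, one_div, inv_pow]
    have e2 : 2 * Real.exp (-(Real.log 2 / T) * t) =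
        Real.exp (Real.log 2 + -(Real.log 2 / T) * t) := by
      rw [Real.exp_add, Real.exp_log two_pos]
    rw [e1, e2, Real.exp_le_exp]
    have h6 : Real.log 2 / T * t ≤ Real.log 2 * (n + 1) := by
      rw [div_mul_eq_mul_div, div_le_iff₀ hT, mul_assoc]
      exact mul_le_mul_of_nonneg_left hn2.le (Real.log_nonneg one_le_two)
    linarith
  calc g t ≤ (1 / 2) ^ n * g (t - n * T) := h3
    _ ≤ (1 / 2) ^ n * (C * g 0) := by gcongr
    _ ≤ 2 * Real.exp (-(Real.log 2 / T) * t) * (C * g 0) := by gcongr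
    _ = _ := by ring

/-- The square of the area of the parallelogram spanned by `v` and `w`. -/
def gramTwo {H : Type*} [NormedAddCommGroup H] [InnerProductSpace ℝ H] (v w : H) : ℝ :=
  ‖v‖ ^ 2 * ‖w‖ ^ 2 - inner ℝ v w ^ 2

section gramTwo
variable {H H' : Type*} [NormedAddCommGroup H] [InnerProductSpace ℝ H] [NormedAddCommGroup H']
  [InnerProductSpace ℝ H']

lemma gramTwo_nonneg (v w : H) : 0 ≤ gramTwo v w := by
  have h := abs_real_inner_le_norm v w
  have := pow_le_pow_left₀ (abs_nonneg _) h 2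
  rw [sq_abs, mul_pow] at this
  exact sub_nonneg.2 this

lemma gramTwo_le (v w : H) : gramTwo v w ≤ ‖v‖ ^ 2 * ‖w‖ ^ 2 :=
  sub_le_self _ (sq_nonneg _)

lemma gramTwo_smul_add (e f : H) (a b c : ℝ) :
    gramTwo (a • e) (b • e + c • f) = (a * c) ^ 2 * gramTwo e f := by
  simp only [gramTwo, ← real_inner_self_eq_norm_sq, inner_add_left, inner_add_right,
    real_inner_smul_left, real_inner_smul_right, real_inner_comm e f]
  ring

lemma gramTwo_of_orthonormal {e f : H} (he : ‖e‖ = 1) (hf : ‖f‖ = 1) (hef : inner ℝ e f = 0) :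
    gramTwo e f = 1 := by simp [gramTwo, he, hf, hef]

/-- Gram–Schmidt in triangular form. By `gramTwo_smul_add` a linear map then multiplies the squared
area of `v, w` by the same factor as that of `e, f`. -/
lemma exists_orthonormal_pair {v w : H} (h : 0 < gramTwo v w) :
    ∃ (e f : H) (a b c : ℝ), ‖e‖ = 1 ∧ ‖f‖ = 1 ∧ inner ℝ e f = 0 ∧ v = a • e ∧ w = b • e + c • f ∧
      ∀ L : Submodule ℝ H, v ∈ L → w ∈ L → e ∈ L ∧ f ∈ L := by
  have hv : v ≠ 0 := by rintro rfl; simp [gramTwo] at h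
  have hv0 : ‖v‖ ≠ 0 := norm_ne_zero_iff.2 hv
  set e := ‖v‖⁻¹ • v
  have hve : v = ‖v‖ • e := by rw [smul_smul, mul_inv_cancel₀ hv0, one_smul]
  have he : ‖e‖ = 1 := by rw [norm_smul, norm_inv, norm_norm, inv_mul_cancel₀ hv0]
  set z := w - inner ℝ e w • e
  have hez : inner ℝ e z = 0 := by
    rw [inner_sub_right, real_inner_smul_right, real_inner_self_eq_norm_sq, he]; ring
  have hz : z ≠ 0 := by
    intro hz
    have hw : w = inner ℝ e w • e := sub_eq_zero.1 hz
    have h1 := gramTwo_smul_add e e ‖v‖ (inner ℝ e w) 0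
    rw [zero_smul, add_zero, ← hw, ← hve] at h1
    rw [h1] at h
    simp at h
  have hz0 : ‖z‖ ≠ 0 := norm_ne_zero_iff.2 hz
  refine ⟨e, ‖z‖⁻¹ • z, ‖v‖, inner ℝ e w, ‖z‖, he, ?_, ?_, hve, ?_, fun L hvL hwL => ?_⟩
  · rw [norm_smul, norm_inv, norm_norm, inv_mul_cancel₀ hz0]
  · rw [real_inner_smul_right, hez, mul_zero]
  · rw [smul_smul ‖z‖, mul_inv_cancel₀ hz0, one_smul, add_sub_cancel]
  · have : e ∈ L := L.smul_mem _ hvL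
    exact ⟨this, L.smul_mem _ (L.sub_mem hwL (L.smul_mem _ this))⟩

lemma eq_smul_of_gramTwo_eq_zero {v w : H} (h : gramTwo v w = 0) : v = 0 ∨ ∃ c : ℝ, w = c • v := by
  refine or_iff_not_imp_left.2 fun hv => ⟨inner ℝ v w / ‖v‖ ^ 2, ?_⟩
  have hv0 : ‖v‖ ≠ 0 := norm_ne_zero_iff.2 hv
  have h1 : ‖w - (inner ℝ v w / ‖v‖ ^ 2) • v‖ ^ 2 * ‖v‖ ^ 2 = gramTwo v w := by
    rw [norm_sub_sq_real, real_inner_smul_right, norm_smul, mul_pow, Real.norm_eq_abs, sq_abs,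
      real_inner_comm v w, gramTwo]
    field_simp
    ring
  rw [h, mul_eq_zero, or_iff_left (by positivity), sq_eq_zero_iff, norm_eq_zero] at h1
  exact sub_eq_zero.1 h1

lemma gramTwo_map_le {A : H →L[ℝ] H'} {C : ℝ} (hA : ∀ v, ‖A v‖ ≤ C * ‖v‖) (v w : H) :
    gramTwo (A v) (A w) ≤ C ^ 4 * gramTwo v w := by
  rcases (gramTwo_nonneg v w).eq_or_lt with h0 | h0
  · rw [← h0, mul_zero]
    rcases eq_smul_of_gramTwo_eq_zero h0.symm with rfl | ⟨c, rfl⟩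
    · simp [gramTwo]
    · have := gramTwo_smul_add (A v) (A v) 1 c 0
      rw [one_smul, zero_smul, add_zero] at this
      rw [map_smul, this]
      simp
  obtain ⟨e, f, a, b, d, he, hf, hef, rfl, rfl, -⟩ := exists_orthonormal_pair h0
  rw [map_add, map_smul, map_smul, map_smul, gramTwo_smul_add, gramTwo_smul_add,
    gramTwo_of_orthonormal he hf hef, mul_one, mul_comm]
  refine mul_le_mul_of_nonneg_right ((gramTwo_le _ _).trans ?_) (sq_nonneg _)
  have h1 := hA e
  have h2 := hA f
  rw [he, mul_one] at h1
  rw [hf, mul_one] at h2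
  calc ‖A e‖ ^ 2 * ‖A f‖ ^ 2 ≤ C ^ 2 * C ^ 2 := by gcongr
    _ = C ^ 4 := by ring

/-- A lower bound for the expansion of areas on orthonormal pairs gives one for all pairs. -/
lemma le_gramTwo_map {A : H →L[ℝ] H'} {L : Submodule ℝ H} {c : ℝ}
    (h : ∀ e ∈ L, ∀ f ∈ L, ‖e‖ = 1 → ‖f‖ = 1 → inner ℝ e f = 0 → c ≤ gramTwo (A e) (A f))
    {v w : H} (hv : v ∈ L) (hw : w ∈ L) : c * gramTwo v w ≤ gramTwo (A v) (A w) := by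
  rcases (gramTwo_nonneg v w).eq_or_lt with h0 | h0
  · rw [← h0, mul_zero]; exact gramTwo_nonneg _ _
  obtain ⟨e, f, a, b, d, he, hf, hef, rfl, rfl, hL⟩ := exists_orthonormal_pair h0
  obtain ⟨heL, hfL⟩ := hL L hv hw
  rw [map_add, map_smul, map_smul, map_smul, gramTwo_smul_add, gramTwo_smul_add,
    gramTwo_of_orthonormal he hf hef, mul_one, mul_comm]
  exact mul_le_mul_of_nonneg_left (h e heL f hfL he hf hef) (sq_nonneg _)

end gramTwo

/-- `E` is the fixed set of its continuous projection. -/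
lemma IsContinuousSplitting.isClosed_left [T2Space B] (h : IsContinuousSplitting F S E G)
    (hS : IsClosed S) : IsClosed {w : TotalSpace F V | w.1 ∈ S ∧ w.2 ∈ E w.1} := by
  have : T2Space (TotalSpace F V) := t2Space_totalSpace
  refine isClosed_of_closure_subset fun w hw => ?_
  have hwS : w.1 ∈ S := by
    exact closure_minimal (t := {w : TotalSpace F V | w.1 ∈ S}) (fun w hw => hw.1)
      (hS.preimage (FiberBundle.continuous_proj F V)) hw
  have hne := mem_closure_iff_nhdsWithin_neBot.1 hw
  have h1 := (h.2 w hwS).mono (s := {w : TotalSpace F V | w.1 ∈ S ∧ w.2 ∈ E w.1}) fun w hw => hw.1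
  have h2 : Tendsto (fun w : TotalSpace F V =>
      (⟨w.1, fiberProj E G w.1 w.2⟩ : TotalSpace F V))
      (𝓝[{w : TotalSpace F V | w.1 ∈ S ∧ w.2 ∈ E w.1}] w) (𝓝 w) := by
    refine (tendsto_id.mono_left nhdsWithin_le_nhds).congr' ?_
    filter_upwards [self_mem_nhdsWithin] with z hz
    have := fiberProj_add (h.1 _ hz.1) hz.2 (G z.1).zero_mem
    rw [add_zero] at this
    rw [this]
    rfl
  have h3 := tendsto_nhds_unique h1 h2
  refine ⟨hwS, ?_⟩
  have h4 := fiberProj_mem (h.1 _ hwS) w.2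
  have h5 : ∀ z : TotalSpace F V, (⟨w.1, fiberProj E G w.1 w.2⟩ : TotalSpace F V) = z →
      z.2 ∈ E z.1 := by rintro z rfl; exact h4
  exact h5 w h3

namespace LinearFlow

variable {Ψ : LinearFlow F V} {T : ℝ} {Λ : Set B}

/-! ### Persistence of contraction and domination near Λ. -/

section extension
variable [IsContinuousRiemannianBundle F V] [CompactSpace B] [T2Space B] [FiniteDimensional ℝ F]

lemma exists_norm_total_le (Ψ : LinearFlow F V) (T : ℝ) :
    ∃ C > (0 : ℝ), ∀ s ∈ Icc (-T) T, ∀ w, ‖(Ψ.total s w).2‖ ≤ C * ‖w.2‖ := by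
  obtain ⟨C, hC⟩ := ((isCompact_Icc (a := -T) (b := T)).prod
    (isCompact_sphereBundle (F := F) (V := V))).exists_bound_of_continuousOn
    ((continuous_norm_totalSpace (F := F) (V := V)).comp Ψ.continuous_total).continuousOn
  refine ⟨|C| + 1, by positivity, fun s hs w => ?_⟩
  rcases eq_or_ne w.2 0 with h0 | h0
  · obtain ⟨x, v⟩ := w
    obtain rfl : v = 0 := h0
    rw [Ψ.total_eq, map_zero, norm_zero, norm_zero, mul_zero]
  · have hpos := norm_pos_iff.2 h0
    have h1 := hC (s, ⟨w.1, ‖w.2‖⁻¹ • w.2⟩) ⟨hs, by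
      rw [mem_ofPred_eq, norm_smul, norm_inv, norm_norm, inv_mul_cancel₀ hpos.ne']⟩
    simp only [Function.comp, norm_total_smul] at h1
    rw [Real.norm_of_nonneg (by positivity), abs_of_pos (inv_pos.2 hpos),
      inv_mul_le_iff₀ hpos] at h1
    nlinarith [le_abs_self C]

/-- Uniform contraction extends to a neighbourhood. -/
lemma exists_contraction (hT : 0 < T) (hE : Ψ.IsInvariantFamily S E)
    (hcl : IsClosed {w : TotalSpace F V | w.1 ∈ S ∧ w.2 ∈ E w.1})
    (h : ∀ x ∈ Λ, ∀ u ∈ E x, u ≠ 0 → ‖Ψ.map T x u‖ < 1 / 2 * ‖u‖) :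
    ∃ U ∈ 𝓝ˢ Λ, ∃ K > (0 : ℝ), ∃ lam > (0 : ℝ), ∀ S' ⊆ S ∩ U, Ψ.IsInvariantSet S' →
      ∀ x ∈ S', ∀ t, 0 ≤ t → ∀ u ∈ E x, ‖Ψ.map t x u‖ ≤ K * Real.exp (-lam * t) * ‖u‖ := by
  have hn := continuous_norm_totalSpace (F := F) (V := V)
  obtain ⟨U, hU, hQ⟩ := exists_nhdsSet_forall_of_isCompact
    ((isCompact_sphereBundle (F := F) (V := V)).inter_right hcl) (FiberBundle.continuous_proj F V)
    (Λ := Λ) (Q := fun w => ‖(Ψ.total T w).2‖ ≤ 1 / 2 * ‖w.2‖) (by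
      intro w hw hwΛ
      refine Filter.Eventually.filter_mono nhdsWithin_le_nhds ?_
      have hlt : ‖(Ψ.total T w).2‖ < 1 / 2 * ‖w.2‖ := by
        obtain ⟨x, u⟩ := w
        rw [Ψ.total_eq]
        exact h x hwΛ u hw.2.2 (norm_ne_zero_iff.1 (by rw [hw.1]; exact one_ne_zero))
      filter_upwards [((hn.comp (Ψ.continuous_total_const T)).continuousAt).eventually_lt
        (hn.const_mul (1 / 2)).continuousAt hlt] with z hz
      exact le_of_lt hz)
  have hQ' : ∀ w : TotalSpace F V, w.1 ∈ S → w.1 ∈ U → w.2 ∈ E w.1 →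
      ‖(Ψ.total T w).2‖ ≤ 1 / 2 * ‖w.2‖ := by
    intro w hwS hwU hwE
    rcases eq_or_ne w.2 0 with h0 | h0
    · obtain ⟨x, v⟩ := w
      obtain rfl : v = 0 := h0
      rw [Ψ.total_eq, map_zero, norm_zero, norm_zero, mul_zero]
    · have hpos := norm_pos_iff.2 h0
      have h2 : ‖(‖w.2‖⁻¹ • w.2)‖ = 1 := by
        rw [norm_smul, norm_inv, norm_norm, inv_mul_cancel₀ hpos.ne']
      have h1 := hQ ⟨w.1, ‖w.2‖⁻¹ • w.2⟩ ⟨h2, hwS, (E w.1).smul_mem _ hwE⟩ hwU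
      rw [norm_total_smul, h2, abs_of_pos (inv_pos.2 hpos), inv_mul_le_iff₀ hpos] at h1
      linarith
  obtain ⟨C, hC, hCT⟩ := Ψ.exists_norm_total_le T
  refine ⟨U, hU, 2 * C, by positivity, Real.log 2 / T, div_pos (Real.log_pos one_lt_two) hT,
    fun S' hS'U hS' x hx t ht u hu => ?_⟩
  have h0 : ‖(Ψ.total 0 ⟨x, u⟩).2‖ = ‖u‖ := by rw [Ψ.total_zero]
  have := le_exp_of_halving (g := fun t => ‖(Ψ.total t ⟨x, u⟩).2‖) (C := C) hT (fun t _ => by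
      rw [add_comm, Ψ.total_add]
      have hm := hS'U (hS' t x hx)
      exact hQ' _ (by rw [total_fst]; exact hm.1) (by rw [total_fst]; exact hm.2)
        (hE t ⟨x, u⟩ (hS'U hx).1 hu))
    (fun s hs => by simpa only [h0] using hCT s ⟨by linarith [hs.1], hs.2⟩ ⟨x, u⟩)
    (by positivity) ht
  simp only [h0] at this
  rwa [Ψ.total_eq] at this

/-- Domination extends to a neighbourhood. -/
lemma exists_domination (hT : 0 < T) (hE : Ψ.IsInvariantFamily S E) (hG : Ψ.IsInvariantFamily S G)
    (hcl : IsClosed {w : TotalSpace F V | w.1 ∈ S ∧ w.2 ∈ E w.1})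
    (hcl' : IsClosed {w : TotalSpace F V | w.1 ∈ S ∧ w.2 ∈ G w.1})
    (h : ∀ x ∈ Λ, ∀ u ∈ E x, ∀ v ∈ G x, u ≠ 0 → v ≠ 0 →
      ‖Ψ.map T x u‖ * ‖v‖ < 1 / 2 * (‖Ψ.map T x v‖ * ‖u‖)) :
    ∃ U ∈ 𝓝ˢ Λ, ∃ K > (0 : ℝ), ∃ lam > (0 : ℝ), ∀ S' ⊆ S ∩ U, Ψ.IsInvariantSet S' →
      Ψ.IsDominatedBy S' E G K lam := by
  have hn := continuous_norm_totalSpace (F := F) (V := V)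
  have hproj := FiberBundle.continuous_proj F V
  have hZ : IsCompact ((({w : TotalSpace F V | ‖w.2‖ = 1} ∩ {w | w.1 ∈ S ∧ w.2 ∈ E w.1}) ×ˢ
      ({w : TotalSpace F V | ‖w.2‖ = 1} ∩ {w | w.1 ∈ S ∧ w.2 ∈ G w.1})) ∩ {p | p.1.1 = p.2.1}) :=
    ((isCompact_sphereBundle.inter_right hcl).prod
      (isCompact_sphereBundle.inter_right hcl')).inter_right
      (isClosed_eq (hproj.comp continuous_fst) (hproj.comp continuous_snd))
  obtain ⟨U, hU, hQ⟩ := exists_nhdsSet_forall_of_isCompact hZ (hproj.comp continuous_fst)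
    (Λ := Λ) (Q := fun p => ‖(Ψ.total T p.1).2‖ * ‖p.2.2‖ ≤
      1 / 2 * (‖(Ψ.total T p.2).2‖ * ‖p.1.2‖)) (by
      rintro ⟨a, b⟩ ⟨⟨⟨ha, ha'⟩, hb, hb'⟩, hab⟩ haΛ
      refine Filter.Eventually.filter_mono nhdsWithin_le_nhds ?_
      have hlt : ‖(Ψ.total T a).2‖ * ‖b.2‖ < 1 / 2 * (‖(Ψ.total T b).2‖ * ‖a.2‖) := by
        obtain ⟨x, u⟩ := a
        obtain ⟨y, v⟩ := b
        obtain rfl : x = y := hab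
        rw [Ψ.total_eq, Ψ.total_eq]
        exact h x haΛ u ha'.2 v hb'.2 (norm_ne_zero_iff.1 (by rw [ha]; exact one_ne_zero))
          (norm_ne_zero_iff.1 (by rw [hb]; exact one_ne_zero))
      have hnT := hn.comp (Ψ.continuous_total_const T)
      have hl := (hnT.comp continuous_fst).mul (hn.comp continuous_snd)
      have hr := continuous_const (y := (1 / 2 : ℝ)) |>.mul
        ((hnT.comp continuous_snd).mul (hn.comp continuous_fst))
      filter_upwards [(isOpen_lt hl hr).mem_nhds (show (a, b) ∈ {p | _ < _} from hlt)] with p hp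
      exact le_of_lt hp)
  have hQ' : ∀ a b : TotalSpace F V, a.1 = b.1 → a.1 ∈ S → a.1 ∈ U → a.2 ∈ E a.1 → b.2 ∈ G b.1 →
      a.2 ≠ 0 → b.2 ≠ 0 → ‖(Ψ.total T a).2‖ * ‖b.2‖ ≤ 1 / 2 * (‖(Ψ.total T b).2‖ * ‖a.2‖) := by
    intro a b hab haS haU haE hbG ha0 hb0
    have hunit : ∀ w : TotalSpace F V, w.2 ≠ 0 → ‖(‖w.2‖⁻¹ • w.2)‖ = 1 := fun w hw => by
      rw [norm_smul, norm_inv, norm_norm, inv_mul_cancel₀ (norm_ne_zero_iff.2 hw)]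
    have hinv : ∀ w : TotalSpace F V, w.2 ≠ 0 → 0 < ‖w.2‖⁻¹ := fun w hw =>
      inv_pos.2 (norm_pos_iff.2 hw)
    have := hQ (⟨a.1, ‖a.2‖⁻¹ • a.2⟩, ⟨b.1, ‖b.2‖⁻¹ • b.2⟩)
      ⟨⟨⟨hunit a ha0, haS, (E a.1).smul_mem _ haE⟩, hunit b hb0, hab ▸ haS,
        (G b.1).smul_mem _ hbG⟩, hab⟩ haU
    simp only [norm_total_smul, hunit a ha0, hunit b hb0, abs_of_pos (hinv a ha0),
      abs_of_pos (hinv b hb0)] at this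
    have hpa := norm_pos_iff.2 ha0
    have hpb := norm_pos_iff.2 hb0
    field_simp at this ⊢
    linarith
  obtain ⟨C, hC, hCT⟩ := Ψ.exists_norm_total_le T
  refine ⟨U, hU, 2 * C ^ 2, by positivity, Real.log 2 / T, div_pos (Real.log_pos one_lt_two) hT,
    fun S' hS'U hS' t ht x hx u hu v hv => ?_⟩
  rcases eq_or_ne u 0 with rfl | hu0
  · simp
  rcases eq_or_ne v 0 with rfl | hv0
  · simp
  have hpos : ∀ t, 0 < ‖(Ψ.total t ⟨x, v⟩).2‖ := fun t => norm_pos_iff.2 (Ψ.total_ne_zero hv0)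
  have h0 : ∀ u : V x, ‖(Ψ.total 0 ⟨x, u⟩).2‖ = ‖u‖ := fun u => by rw [Ψ.total_zero]
  -- The quotient of norms is halved in each period. The initial constant `C ^ 2` combines a forward
  -- bound for `u` with a backward bound for `v`.
  have := le_exp_of_halving (g := fun t => ‖(Ψ.total t ⟨x, u⟩).2‖ / ‖(Ψ.total t ⟨x, v⟩).2‖)
    (C := C ^ 2) hT (fun t _ => by
      rw [add_comm, Ψ.total_add, Ψ.total_add]
      have hm := hS'U (hS' t x hx)
      have h1 := hQ' (Ψ.total t ⟨x, u⟩) (Ψ.total t ⟨x, v⟩) (by rw [total_fst, total_fst])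
        (by rw [total_fst]; exact hm.1) (by rw [total_fst]; exact hm.2)
        (hE t ⟨x, u⟩ (hS'U hx).1 hu) (hG t ⟨x, v⟩ (hS'U hx).1 hv) (Ψ.total_ne_zero hu0)
        (Ψ.total_ne_zero hv0)
      have h2 := hpos t
      have h3 : 0 < ‖(Ψ.total T (Ψ.total t ⟨x, v⟩)).2‖ := by
        rw [← Ψ.total_add]; exact hpos _
      rw [← mul_div_assoc, div_le_div_iff₀ h3 h2]
      linarith)
    (fun s hs => by
      have h1 := hCT s ⟨by linarith [hs.1], hs.2⟩ ⟨x, u⟩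
      have h2 := hCT (-s) ⟨by linarith [hs.2], by linarith [hs.1]⟩ (Ψ.total s ⟨x, v⟩)
      rw [total_neg_total] at h2
      simp only [h0] at h1 h2 ⊢
      have hv1 := norm_pos_iff.2 hv0
      rw [← mul_div_assoc, div_le_div_iff₀ (hpos s) hv1]
      calc _ ≤ (C * ‖u‖) * (C * ‖(Ψ.total s ⟨x, v⟩).2‖) := by gcongr
        _ = _ := by ring)
    (by positivity) ht
  simp only [h0] at this
  have hv1 := norm_pos_iff.2 hv0
  rw [Ψ.total_eq, Ψ.total_eq, ← mul_div_assoc, div_le_div_iff₀ (norm_map_pos t hv1) hv1] at this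
  linarith

end extension

end LinearFlow

/-- A property holds near a closed set if it cannot fail along an ultrafilter converging to a point
of the set. -/
lemma eventually_nhdsSet_of_ultrafilter {B : Type*} [TopologicalSpace B] [CompactSpace B]
    [T2Space B] {Λ : Set B} (hΛ : IsClosed Λ) {P : B → Prop}
    (h : ∀ (f : Ultrafilter B), ∀ x ∈ Λ, (f : Filter B) ≤ 𝓝 x → (∀ᶠ y in f, ¬ P y) → False) :
    ∀ᶠ y in 𝓝ˢ Λ, P y := by
  by_contra hP
  have hne : (𝓝ˢ Λ ⊓ 𝓟 {y | ¬ P y}).NeBot := frequently_iff_neBot.1 (not_eventually.1 hP)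
  obtain ⟨f, hf⟩ := Ultrafilter.exists_le (𝓝ˢ Λ ⊓ 𝓟 {y | ¬ P y})
  obtain ⟨x, -, hx⟩ := isCompact_univ.ultrafilter_le_nhds f (by simp)
  refine h f x ?_ hx (le_principal_iff.1 (hf.trans inf_le_right))
  by_contra hxΛ
  -- A limit outside the closed set `Λ` would have neighbourhoods disjoint from neighbourhoods of
  -- `Λ`, on which the ultrafilter is concentrated.
  have hd := RegularSpace.regular hΛ hxΛ
  exact f.neBot.ne (le_bot_iff.1 (hd (hf.trans inf_le_left) hx))

namespace LinearFlow

variable {Ψ : LinearFlow F V} {T : ℝ} {Λ : Set B}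

lemma gramTwo_congr {y z : B} {a b : V y} {c d : V z}
    (h1 : (⟨y, a⟩ : TotalSpace F V) = ⟨z, c⟩) (h2 : (⟨y, b⟩ : TotalSpace F V) = ⟨z, d⟩) :
    gramTwo a b = gramTwo c d := by
  obtain ⟨rfl, h1⟩ := TotalSpace.mk.inj h1
  obtain ⟨-, h2⟩ := TotalSpace.mk.inj h2
  rw [eq_of_heq h1, eq_of_heq h2]

lemma gramTwo_map_add (s t : ℝ) (x : B) (v w : V x) :
    gramTwo (Ψ.map (s + t) x v) (Ψ.map (s + t) x w) =
      gramTwo (Ψ.map s (Ψ.base t x) (Ψ.map t x v)) (Ψ.map s (Ψ.base t x) (Ψ.map t x w)) := by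
  refine gramTwo_congr (F := F) ?_ ?_ <;>
  rw [← Ψ.total_eq, ← Ψ.total_eq, ← Ψ.total_eq, Ψ.total_add]

lemma gramTwo_map_zero (x : B) (v w : V x) :
    gramTwo (Ψ.map 0 x v) (Ψ.map 0 x w) = gramTwo v w := by
  refine gramTwo_congr (F := F) ?_ ?_ <;>
  rw [← Ψ.total_eq, Ψ.total_zero]

/-! ### Persistence of sectional expansion near Λ. -/

section extension
variable [IsContinuousRiemannianBundle F V] [CompactSpace B] [T2Space B] [FiniteDimensional ℝ F]

lemma exists_gramTwo_map_le (Ψ : LinearFlow F V) (T : ℝ) :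
    ∃ C > (0 : ℝ), ∀ s ∈ Icc (-T) T, ∀ x, ∀ v w : V x,
      gramTwo (Ψ.map s x v) (Ψ.map s x w) ≤ C * gramTwo v w := by
  obtain ⟨C, hC, h⟩ := Ψ.exists_norm_total_le T
  refine ⟨C ^ 4, by positivity, fun s hs x v w => gramTwo_map_le (fun v => ?_) v w⟩
  have := h s hs ⟨x, v⟩
  rwa [Ψ.total_eq] at this

/-- The inverse map distorts areas by a bounded factor, so a nonzero area cannot be sent to zero. -/
lemma gramTwo_map_pos (Ψ : LinearFlow F V) (t : ℝ) {x : B} {v w : V x} (h : 0 < gramTwo v w) :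
    0 < gramTwo (Ψ.map t x v) (Ψ.map t x w) := by
  obtain ⟨C, hC, hCT⟩ := Ψ.exists_gramTwo_map_le |t|
  have h1 := hCT (-t) ⟨neg_le_neg (le_abs_self t), neg_le_abs t⟩ _ (Ψ.map t x v) (Ψ.map t x w)
  rw [← gramTwo_map_add, neg_add_cancel, gramTwo_map_zero] at h1
  exact pos_of_mul_pos_right (h.trans_le h1) hC.le

/-- Sectional expansion extends to a neighbourhood. -/
lemma exists_sectional_expansion (hT : 0 < T) (hG : Ψ.IsInvariantFamily S G)
    (hcl : IsClosed {w : TotalSpace F V | w.1 ∈ S ∧ w.2 ∈ G w.1}) (hΛ : IsClosed Λ)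
    (h : ∀ x ∈ Λ, ∀ e ∈ G x, ∀ f ∈ G x, ‖e‖ = 1 → ‖f‖ = 1 → inner ℝ e f = 0 →
      2 < gramTwo (Ψ.map T x e) (Ψ.map T x f)) :
    ∃ U ∈ 𝓝ˢ Λ, ∃ K > (0 : ℝ), ∃ lam > (0 : ℝ), ∀ S' ⊆ S ∩ U, Ψ.IsInvariantSet S' →
      ∀ x ∈ S', ∀ t, 0 ≤ t → ∀ e ∈ G x, ∀ f ∈ G x, ‖e‖ = 1 → ‖f‖ = 1 → inner ℝ e f = 0 →
        K * Real.exp (lam * t) ≤ gramTwo (Ψ.map t x e) (Ψ.map t x f) := by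
  have hev : ∀ᶠ x in 𝓝ˢ Λ, x ∈ S → ∀ e ∈ G x, ∀ f ∈ G x, ‖e‖ = 1 → ‖f‖ = 1 → inner ℝ e f = 0 →
      2 ≤ gramTwo (Ψ.map T x e) (Ψ.map T x f) := by
    refine eventually_nhdsSet_of_ultrafilter hΛ fun φ x hx hφ hbad => ?_
    -- A pair violating the estimate is chosen wherever there is one, with 0 as a dummy elsewhere.
    -- The limit along `φ` is an orthonormal pair over `Λ` with squared area at most 2.
    have hex : ∀ y, ∃ p : V y × V y, (¬ (y ∈ S → ∀ e ∈ G y, ∀ f ∈ G y, ‖e‖ = 1 → ‖f‖ = 1 →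
        inner ℝ e f = 0 → 2 ≤ gramTwo (Ψ.map T y e) (Ψ.map T y f))) →
        y ∈ S ∧ p.1 ∈ G y ∧ p.2 ∈ G y ∧ ‖p.1‖ = 1 ∧ ‖p.2‖ = 1 ∧ inner ℝ p.1 p.2 = 0 ∧
          gramTwo (Ψ.map T y p.1) (Ψ.map T y p.2) < 2 := by
      intro y
      by_cases hy : y ∈ S → ∀ e ∈ G y, ∀ f ∈ G y, ‖e‖ = 1 → ‖f‖ = 1 →
        inner ℝ e f = 0 → 2 ≤ gramTwo (Ψ.map T y e) (Ψ.map T y f)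
      · exact ⟨0, fun hy' => absurd hy hy'⟩
      · have hy' := hy
        push Not at hy'
        obtain ⟨h1, e, h2, f, h3, h4, h5, h6, h7⟩ := hy'
        exact ⟨(e, f), fun _ => ⟨h1, h2, h3, h4, h5, h6, h7⟩⟩
    choose p hp using hex
    have hb : Tendsto id (φ : Filter B) (𝓝 x) := hφ
    obtain ⟨e, he⟩ := exists_tendsto_of_norm_le (F := F) (b := id) (v := fun y => (p y).1) (R := 1)
      hb (hbad.mono fun y hy => (hp y hy).2.2.2.1.le)
    obtain ⟨f, hf⟩ := exists_tendsto_of_norm_le (F := F) (b := id) (v := fun y => (p y).2) (R := 1)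
      hb (hbad.mono fun y hy => (hp y hy).2.2.2.2.1.le)
    have heG := hcl.mem_of_tendsto he (hbad.mono fun y hy => ⟨(hp y hy).1, (hp y hy).2.1⟩)
    have hfG := hcl.mem_of_tendsto hf (hbad.mono fun y hy => ⟨(hp y hy).1, (hp y hy).2.2.1⟩)
    have he1 : ‖e‖ = 1 := tendsto_nhds_unique ((tendsto_fiber_norm he).congr'
      (hbad.mono fun y hy => (hp y hy).2.2.2.1)) tendsto_const_nhds
    have hf1 : ‖f‖ = 1 := tendsto_nhds_unique ((tendsto_fiber_norm hf).congr'
      (hbad.mono fun y hy => (hp y hy).2.2.2.2.1)) tendsto_const_nhds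
    have hef : inner ℝ e f = 0 := tendsto_nhds_unique ((tendsto_fiber_inner he hf).congr'
      (hbad.mono fun y hy => (hp y hy).2.2.2.2.2.1)) tendsto_const_nhds
    have hmap : ∀ {u : ∀ y, V y} {u₀ : V x},
        Tendsto (fun y => (⟨y, u y⟩ : TotalSpace F V)) φ (𝓝 ⟨x, u₀⟩) →
        Tendsto (fun y => (⟨Ψ.base T y, Ψ.map T y (u y)⟩ : TotalSpace F V)) φ
          (𝓝 ⟨Ψ.base T x, Ψ.map T x u₀⟩) := fun hu => by
      have := ((Ψ.continuous_total_const T).tendsto _).comp hu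
      simp only [Function.comp_def, Ψ.total_eq] at this
      exact this
    have heT := hmap he
    have hfT := hmap hf
    have hlim : Tendsto (fun y => gramTwo (Ψ.map T y (p y).1) (Ψ.map T y (p y).2)) φ
        (𝓝 (gramTwo (Ψ.map T x e) (Ψ.map T x f))) :=
      (((tendsto_fiber_norm heT).pow 2).mul ((tendsto_fiber_norm hfT).pow 2)).sub
        ((tendsto_fiber_inner heT hfT).pow 2)
    have hle := le_of_tendsto hlim (hbad.mono fun y hy => (hp y hy).2.2.2.2.2.2.le)
    exact absurd (h x hx e heG.2 f hfG.2 he1 hf1 hef) (not_lt.2 hle)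
  obtain ⟨C, hC, hCT⟩ := Ψ.exists_gramTwo_map_le T
  refine ⟨_, hev, (2 * C)⁻¹, by positivity, Real.log 2 / T, div_pos (Real.log_pos one_lt_two) hT,
    fun S' hS'U hS' x hx t ht e he f hf he1 hf1 hef => ?_⟩
  have h1 : gramTwo e f = 1 := gramTwo_of_orthonormal he1 hf1 hef
  have hpos : ∀ t, 0 < gramTwo (Ψ.map t x e) (Ψ.map t x f) := fun t =>
    Ψ.gramTwo_map_pos t (by rw [h1]; exact one_pos)
  -- Growth by 2 of the squared area is halving of its inverse.
  have := le_exp_of_halving (g := fun t => (gramTwo (Ψ.map t x e) (Ψ.map t x f))⁻¹)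
    (C := C) hT (fun t _ => by
      rw [add_comm, gramTwo_map_add]
      have hm := hS'U (hS' t x hx)
      -- The images of `e` and `f` at time `t` are no longer orthonormal, so the bound for
      -- orthonormal pairs is first transferred to arbitrary pairs of `G`.
      have h2 := le_gramTwo_map (L := G (Ψ.base t x)) (hm.2 hm.1) (hG.map_mem t (hS'U hx).1 he)
        (hG.map_mem t (hS'U hx).1 hf)
      have h3 := hpos t
      rw [one_div, ← mul_inv]
      exact inv_anti₀ (by positivity) h2)
    (fun s hs => by
      have h2 := hCT (-s) ⟨by linarith [hs.2], by linarith [hs.1]⟩ _ (Ψ.map s x e) (Ψ.map s x f)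
      rw [← gramTwo_map_add, neg_add_cancel, gramTwo_map_zero, h1] at h2
      simp only [gramTwo_map_zero, h1, inv_one, mul_one]
      exact inv_le_of_inv_le₀ hC (by rwa [inv_le_iff_one_le_mul₀' hC]))
    (by simp only [gramTwo_map_zero, h1, inv_one, mul_one]; exact hC.le) ht
  simp only [gramTwo_map_zero, h1, inv_one, mul_one] at this
  have h4 := inv_anti₀ (inv_pos.2 (hpos t)) this
  rw [inv_inv, mul_inv, ← Real.exp_neg] at h4
  rwa [neg_mul, neg_neg] at h4

end extension

end LinearFlow

lemma exists_mem_nhdsSet_isClosed_subset {B : Type*} [TopologicalSpace B] [NormalSpace B]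
    {Λ U : Set B} (hΛ : IsClosed Λ) (hU : U ∈ 𝓝ˢ Λ) :
    ∃ N ∈ 𝓝ˢ Λ, IsClosed N ∧ N ⊆ U := by
  obtain ⟨O, hO, hΛO, hOU⟩ := mem_nhdsSet_iff_exists.1 hU
  obtain ⟨W, hW, hΛW, hWO⟩ := normal_exists_closure_subset hΛ hO hΛO
  exact ⟨closure W, Filter.mem_of_superset (hW.mem_nhdsSet.2 hΛW) subset_closure, isClosed_closure,
    hWO.trans hOU⟩

/-! ### Extension of a sectional-hyperbolic splitting. -/

namespace LinearFlow

variable {Ψ : LinearFlow F V} {Λ : Set B}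

/-- An invariant splitting over `S` which is dominated, contracting and sectional-expanding. -/
structure IsSectionalSplitting (Ψ : LinearFlow F V) (S : Set B) (E G : ∀ x, Submodule ℝ (V x)) :
    Prop where
  splitting : IsContinuousSplitting F S E G
  left : Ψ.IsInvariantFamily S E
  right : Ψ.IsInvariantFamily S G
  dominated : ∃ K > (0 : ℝ), ∃ lam > (0 : ℝ), ∀ x ∈ S, ∀ t > 0, ∀ u ∈ E x, ∀ v ∈ G x,
    ‖Ψ.map t x u‖ * ‖v‖ ≤ K * Real.exp (-lam * t) * (‖Ψ.map t x v‖ * ‖u‖)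
  contracting : ∃ K > (0 : ℝ), ∃ lam > (0 : ℝ), ∀ x ∈ S, ∀ t > 0, ∀ u ∈ E x,
    ‖Ψ.map t x u‖ ≤ K * Real.exp (-lam * t) * ‖u‖
  expanding : ∃ K > (0 : ℝ), ∃ lam > (0 : ℝ), ∀ x ∈ S, ∀ t > 0, ∀ e ∈ G x, ∀ f ∈ G x,
    ‖e‖ = 1 → ‖f‖ = 1 → inner ℝ e f = 0 →
      K * Real.exp (lam * t) ≤ gramTwo (Ψ.map t x e) (Ψ.map t x f)

/-- The points whose whole orbit lies in `N`. -/
def invariantCore (Ψ : LinearFlow F V) (N : Set B) : Set B := {x | ∀ t, Ψ.base t x ∈ N}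

lemma isClosed_invariantCore {N : Set B} (hN : IsClosed N) : IsClosed (Ψ.invariantCore N) := by
  have : Ψ.invariantCore N = ⋂ t, Ψ.base t ⁻¹' N := by ext; simp [invariantCore]
  rw [this]
  exact isClosed_iInter fun t => hN.preimage
    (Ψ.continuous_base.comp (continuous_const.prodMk continuous_id))

lemma isInvariantSet_invariantCore (N : Set B) : Ψ.IsInvariantSet (Ψ.invariantCore N) :=
  fun t x hx s => by rw [← base_add]; exact hx _

lemma invariantCore_subset (N : Set B) : Ψ.invariantCore N ⊆ N := fun x hx => by
  simpa only [base_zero] using hx 0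

lemma IsInvariantSet.subset_invariantCore {S' N : Set B} (h : Ψ.IsInvariantSet S') (hN : S' ⊆ N) :
    S' ⊆ Ψ.invariantCore N := fun x hx t => hN (h t x hx)

lemma norm_map_zero (x : B) (u : V x) : ‖Ψ.map 0 x u‖ = ‖u‖ := by
  have h := Ψ.total_zero ⟨x, u⟩
  rw [Ψ.total_eq] at h
  exact congrArg (fun w : TotalSpace F V => ‖w.2‖) h

lemma tendsto_mul_exp_neg {lam : ℝ} (hlam : 0 < lam) (K : ℝ) :
    Tendsto (fun T : ℝ => K * Real.exp (-lam * T)) atTop (𝓝 0) := by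
  have h1 : Tendsto (fun T : ℝ => -lam * T) atTop atBot :=
    tendsto_id.const_mul_atTop_of_neg (by linarith)
  have := (Real.tendsto_exp_atBot.comp h1).const_mul K
  rwa [mul_zero] at this

/-- A sectional-hyperbolic splitting over a closed invariant set extends to all closed invariant
sets in a neighbourhood. -/
theorem IsSectionalSplitting.exists_extension [IsContinuousRiemannianBundle F V] [CompactSpace B]
    [T2Space B] [FiniteDimensional ℝ F] [∀ x, FiniteDimensional ℝ (V x)] (hΛ : IsClosed Λ)
    (hinv : Ψ.IsInvariantSet Λ) (h : Ψ.IsSectionalSplitting Λ E G) :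
    ∃ U ∈ 𝓝ˢ Λ, IsClosed U ∧ ∃ E' G' : ∀ x, Submodule ℝ (V x),
      ∀ S' : Set B, IsClosed S' → Ψ.IsInvariantSet S' → S' ⊆ U →
        Ψ.IsSectionalSplitting S' E' G' := by
  obtain ⟨hspl, hE, hG, ⟨K, hK, lam, hlam, hdom⟩, ⟨K₂, hK₂, lam₂, hlam₂, hcon⟩,
    K₃, hK₃, lam₃, hlam₃, hsec⟩ := h
  -- The cone argument also uses domination at `t = 0`, which forces a constant at least 1.
  have hdom' : Ψ.IsDominatedBy Λ E G (max K 1) lam := by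
    intro t ht x hx u hu v hv
    rcases ht.eq_or_lt with rfl | ht
    · rw [norm_map_zero, norm_map_zero, mul_zero, Real.exp_zero, mul_one, mul_comm ‖v‖]
      exact le_mul_of_one_le_left (by positivity) (le_max_right _ _)
    · exact (hdom x hx t ht u hu v hv).trans (by gcongr; exact le_max_left _ _)
  obtain ⟨U, hU, E', G', hext, hEG⟩ :=
    exists_extension_splitting hΛ hinv hspl hE hG (le_max_right K 1) hlam hdom'
  obtain ⟨N, hN, hNc, hNU⟩ := exists_mem_nhdsSet_isClosed_subset hΛ hU
  -- The extended splitting is fixed once and for all over this closed invariant set; the estimates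
  -- are then proved on smaller neighbourhoods inside it.
  set S := Ψ.invariantCore N
  have hSc : IsClosed S := isClosed_invariantCore hNc
  have hSi : Ψ.IsInvariantSet S := isInvariantSet_invariantCore N
  obtain ⟨hspl', hE', hG'⟩ := hext S hSc hSi ((invariantCore_subset N).trans hNU)
  have hcl := hspl'.isClosed_left hSc
  have hcl' := hspl'.symm.isClosed_left hSc
  have hpos : ∀ {x : B} {u : V x} (t : ℝ), u ≠ 0 → 0 < ‖Ψ.map t x u‖ := fun t hu =>
    norm_map_pos t (norm_pos_iff.2 hu)
  obtain ⟨T₁, hT₁, hT₁'⟩ := ((eventually_gt_atTop (0 : ℝ)).and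
    ((tendsto_mul_exp_neg hlam K).eventually_lt_const (by norm_num : (0 : ℝ) < 1 / 2))).exists
  obtain ⟨T₂, hT₂, hT₂'⟩ := ((eventually_gt_atTop (0 : ℝ)).and
    ((tendsto_mul_exp_neg hlam₂ K₂).eventually_lt_const (by norm_num : (0 : ℝ) < 1 / 2))).exists
  -- The condition `2 / K₃ * exp (-lam₃ * T₃) < 1` says that squared areas grow by more than 2 in
  -- time `T₃`.
  obtain ⟨T₃, hT₃, hT₃'⟩ := ((eventually_gt_atTop (0 : ℝ)).and
    ((tendsto_mul_exp_neg hlam₃ (2 / K₃)).eventually_lt_const one_pos)).exists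
  obtain ⟨U₁, hU₁, h₁⟩ := exists_domination (Λ := Λ) hT₁ hE' hG' hcl hcl' fun x hx u hu v hv hu0
      hv0 => by
    rw [(hEG x hx).1] at hu
    rw [(hEG x hx).2] at hv
    refine (hdom x hx T₁ hT₁ u hu v hv).trans_lt ?_
    exact mul_lt_mul_of_pos_right hT₁' (mul_pos (hpos _ hv0) (norm_pos_iff.2 hu0))
  obtain ⟨U₂, hU₂, h₂⟩ := exists_contraction (Λ := Λ) hT₂ hE' hcl fun x hx u hu hu0 => by
    rw [(hEG x hx).1] at hu
    refine (hcon x hx T₂ hT₂ u hu).trans_lt ?_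
    exact mul_lt_mul_of_pos_right hT₂' (norm_pos_iff.2 hu0)
  obtain ⟨U₃, hU₃, h₃⟩ := exists_sectional_expansion (Λ := Λ) hT₃ hG' hcl' hΛ
      fun x hx e he f hf he1 hf1 hef => by
    rw [(hEG x hx).2] at he hf
    refine lt_of_lt_of_le ?_ (hsec x hx T₃ hT₃ e he f hf he1 hf1 hef)
    rw [neg_mul, Real.exp_neg, ← div_eq_mul_inv, div_div, div_lt_one (by positivity)] at hT₃'
    exact hT₃'
  obtain ⟨N', hN', hNc', hNU'⟩ := exists_mem_nhdsSet_isClosed_subset hΛ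
    (inter_mem hN (inter_mem hU₁ (inter_mem hU₂ hU₃)))
  refine ⟨N', hN', hNc', E', G', fun S' hS'c hS' hS'N => ?_⟩
  have hS'S : S' ⊆ S := hS'.subset_invariantCore fun x hx => (hNU' (hS'N hx)).1
  obtain ⟨k₁, hk₁, l₁, hl₁, h₁'⟩ := h₁
  obtain ⟨k₂, hk₂, l₂, hl₂, h₂'⟩ := h₂
  obtain ⟨k₃, hk₃, l₃, hl₃, h₃'⟩ := h₃
  obtain ⟨hs1, hs2, hs3⟩ := hext S' hS'c hS' fun x hx => hNU (hNU' (hS'N hx)).1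
  refine ⟨hs1, hs2, hs3, ⟨k₁, hk₁, l₁, hl₁, fun x hx t ht => ?_⟩,
    ⟨k₂, hk₂, l₂, hl₂, fun x hx t ht => ?_⟩, ⟨k₃, hk₃, l₃, hl₃, fun x hx t ht => ?_⟩⟩
  · exact h₁' S' (fun x hx => ⟨hS'S hx, (hNU' (hS'N hx)).2.1⟩) hS' t ht.le x hx
  · exact h₂' S' (fun x hx => ⟨hS'S hx, (hNU' (hS'N hx)).2.2.1⟩) hS' x hx t ht.le
  · exact h₃' S' (fun x hx => ⟨hS'S hx, (hNU' (hS'N hx)).2.2.2⟩) hS' x hx t ht.le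

end LinearFlow

end Bundles

/-! ### Area determinants on planes as Gram determinants. -/

section absDetOn
variable {H H' : Type*} [NormedAddCommGroup H] [InnerProductSpace ℝ H] [FiniteDimensional ℝ H]
  [NormedAddCommGroup H'] [InnerProductSpace ℝ H'] [FiniteDimensional ℝ H']

/-- In an orthonormal basis of `L` the matrix of `B* B` is the Gram matrix of the images of the
basis vectors. -/
lemma absDetOn_eq_of_basis (A : H →ₗ[ℝ] H') {L : Submodule ℝ H}
    (b : OrthonormalBasis (Fin 2) ℝ L) :
    absDetOn A L = √(gramTwo (A (b 0)) (A (b 1))) := by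
  rw [absDetOn]
  congr 1
  rw [← LinearMap.det_toMatrix b.toBasis, Matrix.det_fin_two]
  simp only [LinearMap.toMatrix_apply, OrthonormalBasis.coe_toBasis,
    OrthonormalBasis.coe_toBasis_repr_apply, OrthonormalBasis.repr_apply_apply,
    LinearMap.comp_apply, LinearMap.adjoint_inner_right, Submodule.subtype_apply]
  rw [gramTwo, real_inner_self_eq_norm_sq, real_inner_self_eq_norm_sq,
    real_inner_comm (A (b 0)) (A (b 1))]
  ring

lemma exists_absDetOn_eq (A : H →ₗ[ℝ] H') {L : Submodule ℝ H} (hL : Module.finrank ℝ L = 2) :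
    ∃ e ∈ L, ∃ f ∈ L, ‖e‖ = 1 ∧ ‖f‖ = 1 ∧ inner ℝ e f = 0 ∧
      absDetOn A L = √(gramTwo (A e) (A f)) := by
  set b := (stdOrthonormalBasis ℝ L).reindex (finCongr hL)
  refine ⟨b 0, (b 0).2, b 1, (b 1).2, b.orthonormal.1 0, b.orthonormal.1 1, ?_,
    absDetOn_eq_of_basis A b⟩
  exact b.orthonormal.2 (by simp)

lemma exists_submodule_absDetOn_eq (A : H →ₗ[ℝ] H') {P : Submodule ℝ H} {e f : H} (he : e ∈ P)
    (hf : f ∈ P) (he1 : ‖e‖ = 1) (hf1 : ‖f‖ = 1) (hef : inner ℝ e f = 0) :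
    ∃ L ≤ P, Module.finrank ℝ L = 2 ∧ absDetOn A L = √(gramTwo (A e) (A f)) := by
  have ho : Orthonormal ℝ ![e, f] := by
    rw [orthonormal_iff_ite]
    intro i j
    fin_cases i <;> fin_cases j <;> simp [he1, hf1, hef, real_inner_comm]
  set L := Submodule.span ℝ (range ![e, f])
  have hL : L ≤ P := by
    refine Submodule.span_le.2 ?_
    rintro _ ⟨i, rfl⟩
    fin_cases i
    · exact he
    · exact hf
  have hfr : Module.finrank ℝ L = 2 := by
    rw [finrank_span_eq_card ho.linearIndependent, Fintype.card_fin]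
  set b : OrthonormalBasis (Fin 2) ℝ L :=
    (Module.Basis.span ho.linearIndependent).toOrthonormalBasis (by
      have : (L.subtypeₗᵢ ∘ ⇑(Module.Basis.span ho.linearIndependent)) = ![e, f] := by
        funext i
        exact congrArg Subtype.val (Module.Basis.span_apply ho.linearIndependent i)
      rw [← this] at ho
      exact (L.subtypeₗᵢ.orthonormal_comp_iff).1 ho)
  have hb : ∀ i, (b i : H) = ![e, f] i := fun i => by
    simp only [b, Module.Basis.coe_toOrthonormalBasis]
    exact congrArg Subtype.val (Module.Basis.span_apply ho.linearIndependent i)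
  refine ⟨L, hL, hfr, ?_⟩
  rw [absDetOn_eq_of_basis A b, hb, hb]
  rfl

end absDetOn

lemma isContinuousRiemannianBundle_tangent {n : ℕ} {M : Type*} [TopologicalSpace M]
    [ChartedSpace (EuclideanSpace ℝ (Fin n)) M] [IsManifold (𝓡 n) ∞ M]
    [Bundle.RiemannianBundle (fun x : M => TangentSpace (𝓡 n) x)]
    [h : IsContMDiffRiemannianBundle (𝓡 n) ∞ (EuclideanSpace ℝ (Fin n))
      (fun x : M => TangentSpace (𝓡 n) x)] :
    IsContinuousRiemannianBundle (EuclideanSpace ℝ (Fin n))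
      (fun x : M => TangentSpace (𝓡 n) x) := by
  obtain ⟨g, hg, h⟩ := h.exists_contMDiff
  exact ⟨g, hg.continuous, h⟩

/-! ### Translation between the tangent flow and linear flows. -/

section tangent
variable {n : ℕ} {M : Type*} [TopologicalSpace M] [T2Space M] [CompactSpace M]
  [ChartedSpace (EuclideanSpace ℝ (Fin n)) M] [IsManifold (𝓡 n) ∞ M]
  [Bundle.RiemannianBundle (fun x : M => TangentSpace (𝓡 n) x)]
  {X : (x : M) → TangentSpace (𝓡 n) x}

/-- The tangent flow as a linear flow on the tangent bundle. -/
def tangentLinearFlow (hX : IsC1VectorField X) :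
    LinearFlow (EuclideanSpace ℝ (Fin n)) (fun x : M => TangentSpace (𝓡 n) x) where
  base := flow X
  map := tangentFlow X
  total := tangentBundleFlow X
  total_eq _ _ _ := rfl
  total_zero := hX.tangentBundleFlow_zero
  total_add := hX.tangentBundleFlow_add
  continuous_total := hX.continuous_tangentBundleFlow

lemma isFlowInvariant_iff (hX : IsC1VectorField X) {S : Set M} :
    IsFlowInvariant X S ↔ (tangentLinearFlow hX).IsInvariantSet S := by
  refine ⟨fun h t x hx => h t ▸ mem_image_of_mem _ hx, fun h t => ?_⟩
  refine (image_subset_iff.2 fun x hx => h t x hx).antisymm fun x hx => ?_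
  exact ⟨flow X (-t) x, h (-t) x hx, (tangentLinearFlow hX).base_base_neg t x⟩

/-- By the group law, `x ∈ X_{-t}(U)` exactly when `X_t(x) ∈ U`. -/
lemma maximalInvariantSet_eq (hX : IsC1VectorField X) (U : Set M) :
    maximalInvariantSet X U = (tangentLinearFlow hX).invariantCore U := by
  ext x
  simp only [maximalInvariantSet, mem_iInter]
  constructor
  · intro h t
    obtain ⟨y, hy, hyx⟩ := h (-t)
    have h1 : flow X t x = y := by
      have := (tangentLinearFlow hX).base_base_neg t y
      rwa [show (tangentLinearFlow hX).base (-t) y = x from hyx] at this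
    change flow X t x ∈ U
    rwa [h1]
  · intro h t
    exact ⟨flow X (-t) x, h (-t), (tangentLinearFlow hX).base_base_neg t x⟩

lemma isInvariantFamily_iff (hX : IsC1VectorField X) {S : Set M}
    {E : (x : M) → Submodule ℝ (TangentSpace (𝓡 n) x)}
    (hS : (tangentLinearFlow hX).IsInvariantSet S) :
    (tangentLinearFlow hX).IsInvariantFamily S E ↔
      ∀ x ∈ S, ∀ t : ℝ, (E x).map (tangentFlow X t x).toLinearMap = E (flow X t x) := by
  refine ⟨fun h x hx t => le_antisymm ?_ fun v hv => ?_, fun h t w hwS hw => ?_⟩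
  · rintro _ ⟨u, hu, rfl⟩
    exact h t ⟨x, u⟩ hx hu
  · obtain ⟨u, hu, hu'⟩ := (tangentLinearFlow hX).exists_map_eq t x v
    have h1 := h (-t) ⟨flow X t x, v⟩ (hS t x hx) hv
    have h2 : ∀ w : TangentBundle (𝓡 n) M,
        (tangentLinearFlow hX).total (-t) ⟨flow X t x, v⟩ = w →
          w.2 ∈ E w.1 := by rintro w rfl; exact h1
    exact ⟨u, h2 _ hu', hu⟩
  · have h1 : tangentFlow X t w.1 w.2 ∈ E (flow X t w.1) := by
      rw [← h w.1 hwS t]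
      exact Submodule.mem_map_of_mem hw
    exact h1

lemma isSectionalSplitting_of (hX : IsC1VectorField X) {S : Set M}
    {E G : (x : M) → Submodule ℝ (TangentSpace (𝓡 n) x)}
    (hS : (tangentLinearFlow hX).IsInvariantSet S) (h : IsInvariantSplitting X S E G)
    (hd : IsDominated X S E G) (hc : IsUniformlyContracting X S E)
    (he : IsSectionalExpanding X S G) :
    (tangentLinearFlow hX).IsSectionalSplitting S E G := by
  refine ⟨HasLocalFrames.isContinuousSplitting h.isCompl h.continuous_left h.continuous_right,
    (isInvariantFamily_iff hX hS).2 h.map_left, (isInvariantFamily_iff hX hS).2 h.map_right, hd,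
    hc, ?_⟩
  obtain ⟨K, hK, lam, hlam, h⟩ := he
  -- `gramTwo` is a squared area, so the constant and the exponential are squared.
  refine ⟨K ^ 2, by positivity, 2 * lam, by positivity, fun x hx t ht e he f hf he1 hf1 hef => ?_⟩
  obtain ⟨L, hL, hL2, heq⟩ :=
    exists_submodule_absDetOn_eq (tangentFlow X t x).toLinearMap he hf he1 hf1 hef
  have h1 := h x hx t ht L hL hL2
  rw [heq, Real.le_sqrt (by positivity) (gramTwo_nonneg _ _)] at h1
  calc K ^ 2 * Real.exp (2 * lam * t) = (K * Real.exp (lam * t)) ^ 2 := by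
        rw [mul_pow, ← Real.exp_nat_mul]; congr 2; push_cast; ring
    _ ≤ _ := h1

lemma LinearFlow.IsSectionalSplitting.isSectionalExpanding {hX : IsC1VectorField X} {S : Set M}
    {E G : (x : M) → Submodule ℝ (TangentSpace (𝓡 n) x)}
    (h : (tangentLinearFlow hX).IsSectionalSplitting S E G) : IsSectionalExpanding X S G := by
  obtain ⟨K, hK, lam, hlam, h⟩ := h.expanding
  refine ⟨√K, Real.sqrt_pos.2 hK, lam / 2, by positivity, fun x hx t ht L hL hL2 => ?_⟩
  obtain ⟨e, he, f, hf, he1, hf1, hef, heq⟩ :=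
    exists_absDetOn_eq (tangentFlow X t x).toLinearMap hL2
  rw [heq]
  refine Real.le_sqrt_of_sq_le ?_
  refine le_trans (le_of_eq ?_) (h x hx t ht e (hL he) f (hL hf) he1 hf1 hef)
  rw [mul_pow, Real.sq_sqrt hK.le, ← Real.exp_nat_mul]
  congr 2; push_cast; ring

end tangent
end SectionalHyperbolicity

end

theorem mainTheorem7 {n : ℕ} {M : Type*} [TopologicalSpace M] [T2Space M] [CompactSpace M]
    [ChartedSpace (EuclideanSpace ℝ (Fin n)) M] [IsManifold (𝓡 n) ∞ M]
    [Bundle.RiemannianBundle (fun x : M => TangentSpace (𝓡 n) x)]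
    [IsContMDiffRiemannianBundle (𝓡 n) ∞ (EuclideanSpace ℝ (Fin n))
      (fun x : M => TangentSpace (𝓡 n) x)]
    (X : (x : M) → TangentSpace (𝓡 n) x) (hX : SectionalHyperbolicity.IsC1VectorField X)
    (Λ : Set M) (hΛ : SectionalHyperbolicity.IsSectionalHyperbolic X Λ) :
    ∃ U ∈ 𝓝ˢ Λ, SectionalHyperbolicity.IsSectionalHyperbolic X
      (SectionalHyperbolicity.maximalInvariantSet X U) := by
  open SectionalHyperbolicity in
  obtain ⟨hcpt, hinv, E, G, hspl, hd, hc, he⟩ := hΛ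
  have := isContinuousRiemannianBundle_tangent (n := n) (M := M)
  have hinv' := (isFlowInvariant_iff hX).1 hinv
  obtain ⟨U, hU, hUc, E', G', h⟩ :=
    (isSectionalSplitting_of hX hinv' hspl hd hc he).exists_extension
    hcpt.isClosed hinv'
  -- `U` was obtained closed, so its maximal invariant set is closed, hence compact, and the
  -- extension applies to that set itself.
  have hcl := LinearFlow.isClosed_invariantCore (Ψ := tangentLinearFlow hX) hUc
  have hi := LinearFlow.isInvariantSet_invariantCore (Ψ := tangentLinearFlow hX) U
  have h' := h _ hcl hi (LinearFlow.invariantCore_subset U)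
  refine ⟨U, hU, ?_⟩
  rw [maximalInvariantSet_eq hX]
  exact ⟨hcl.isCompact, (isFlowInvariant_iff hX).2 hi, E', G',
    ⟨h'.splitting.1, h'.splitting.hasLocalFrames_left, h'.splitting.symm.hasLocalFrames_left,
      (isInvariantFamily_iff hX hi).1 h'.left, (isInvariantFamily_iff hX hi).1 h'.right⟩,
    h'.dominated, h'.contracting, h'.isSectionalExpanding⟩
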